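/- Let $k,r\ge 1$ and $m_1,\dots,m_k,n_1,\dots,n_r\ge 1$ be integers, and put $m=\sum_i m_i$, $n=\sum_j n_j$, $d=m+n$. Fix an arbitrary norm $\|\cdot\|$ on each $\mathbb{R}^{m_i}$ and each $\mathbb{R}^{n_j}$, and equip $\mathbb{R}^m=\prod_i\mathbb{R}^{m_i}$, $\mathbb{R}^n=\prod_j\mathbb{R}^{n_j}$ and $\mathbb{R}^d=\mathbb{R}^m\times\mathbb{R}^n$ with the corresponding maximum norms. Let $\rho_i:\mathbb{R}^m\to\mathbb{R}^{m_i}$ and $\rho_j':\mathbb{R}^n\to\mathbb{R}^{n_j}$ be the coordinate projections. Fix $\varepsilon>0$ and $\eta_1,\dots,\eta_k>0$. For $\theta\in M_{m\times n}(\mathbb{R})$, a vector $(p,q)\in\mathbb{Z}^m\times\mathbb{Z}^n$ is called an $\varepsilon^*$-approximate of $\theta$ if $$\|\rho_i(p+\theta q)\|\le\eta_i\ (1\le i\le k),\qquad \Big(\prod_{i=1}^k\|\rho_i(p+\theta q)\|^{m_i}\Big)\Big(\prod_{j=1}^r\|\rho_j'(q)\|^{n_j}\Big)\le\varepsilon,\qquad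 \|\rho_j'(q)\|\ne 0\ (1\le j\le r).$$ For an integer $s\ge 1$ and real $T$, let $D(T,\theta,s)$ be the number of $\varepsilon^*$-approximates $(p,q)$ of $\theta$ with $\|q\|\le e^T$ and $s\mid\gcd(p,q)$, where $\gcd(p,q)$ is the greatest common divisor of all $d$ coordinates. Then for Lebesgue almost every $\theta\in M_{m\times n}(\mathbb{R})$ the following holds for every integer $s\ge 1$: $D(T,\theta,s)$ is finite for every $T$, and $$\lim_{T\to\infty}\frac{1}{T^{k+r-1}}D(T,\theta,s)=\frac{\varepsilon}{s^d}\,\frac{1}{(k+r-1)!}\,\mathrm{vol}(B_1^d)\,c_{k+r-1}(n_1,\dots,n_r),$$ where $\mathrm{vol}(B_1^d)$ is the Lebesgue measure of the unit ball of $(\mathbb{R}^d,\|\cdot\|)$ and $$c_{k+r-1}(n_1,\dots,n_r)=\sum_{(x_1,\dots,x_r)\in\{0,1\}^r}(-1)^{r-(x_1+\dots+x_r)}(n_1x_1+\dots+n_rx_r)^{k+r-1}.$$ -/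

import Mathlib

open MeasureTheory Filter Topology

noncomputable section

namespace MultDioph

/-- Coordinates of `ℝ^{l_1 + ⋯ + l_k} = ℝ^{l_1} × ⋯ × ℝ^{l_k}`: pairs (block `i`, position in the
block). Vectors in this space are functions `BlockIndex l → ℝ`. -/
abbrev BlockIndex {k : ℕ} (l : Fin k → ℕ) : Type := (i : Fin k) × Fin (l i)

/-- The projection `ℝ^{l_1} × ⋯ × ℝ^{l_k} → ℝ^{l_i}` onto the `i`-th block. -/
def blockProj {k : ℕ} {l : Fin k → ℕ} (i : Fin k) (x : BlockIndex l → ℝ) : Fin (l i) → ℝ :=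
  fun a => x ⟨i, a⟩

/-- The maximum of the norms of the blocks of `x`. -/
def blockNorm {k : ℕ} {l : Fin k → ℕ} (N : (i : Fin k) → Seminorm ℝ (Fin (l i) → ℝ))
    (x : BlockIndex l → ℝ) : ℝ :=
  ⨆ i, N i (blockProj i x)

/-- An integer vector regarded as a real vector. -/
def toReal {ι : Type} (v : ι → ℤ) : ι → ℝ := fun a => (v a : ℝ)

/-- The vector `p + θ q`. -/
def linForm {ι κ : Type} [Fintype κ] (θ : Matrix ι κ ℝ) (p : ι → ℤ) (q : κ → ℤ) : ι → ℝ :=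
  toReal p + θ.mulVec (toReal q)

/-- `(p, q)` is an `ε^*`-approximate of `θ` (no coprimality condition). -/
structure IsStarApprox {k r : ℕ} {m : Fin k → ℕ} {n : Fin r → ℕ}
    (NM : (i : Fin k) → Seminorm ℝ (Fin (m i) → ℝ))
    (NN : (j : Fin r) → Seminorm ℝ (Fin (n j) → ℝ))
    (η : Fin k → ℝ) (ε : ℝ) (θ : Matrix (BlockIndex m) (BlockIndex n) ℝ)
    (p : BlockIndex m → ℤ) (q : BlockIndex n → ℤ) : Prop where
  le_eta : ∀ i, NM i (blockProj i (linForm θ p q)) ≤ η i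
  prod_le : (∏ i, NM i (blockProj i (linForm θ p q)) ^ m i) *
    (∏ j, NN j (blockProj j (toReal q)) ^ n j) ≤ ε
  ne_zero : ∀ j, NN j (blockProj j (toReal q)) ≠ 0

/-- The set of `ε^*`-approximates `(p, q)` of `θ` with `‖q‖ ≤ e^T` and `s ∣ gcd(p, q)`. -/
def starApproxSet {k r : ℕ} {m : Fin k → ℕ} {n : Fin r → ℕ}
    (NM : (i : Fin k) → Seminorm ℝ (Fin (m i) → ℝ))
    (NN : (j : Fin r) → Seminorm ℝ (Fin (n j) → ℝ))
    (η : Fin k → ℝ) (ε : ℝ) (T : ℝ) (θ : Matrix (BlockIndex m) (BlockIndex n) ℝ) (s : ℕ) :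
    Set ((BlockIndex m → ℤ) × (BlockIndex n → ℤ)) :=
  {v | IsStarApprox NM NN η ε θ v.1 v.2 ∧
    blockNorm NN (toReal v.2) ≤ Real.exp T ∧
    (s : ℤ) ∣ Finset.univ.gcd (Sum.elim v.1 v.2)}

/-- The closed unit ball of `ℝ^d = ℝ^m × ℝ^n` for the norm `max (‖x‖, ‖y‖)`. -/
def unitBall {k r : ℕ} {m : Fin k → ℕ} {n : Fin r → ℕ}
    (NM : (i : Fin k) → Seminorm ℝ (Fin (m i) → ℝ))
    (NN : (j : Fin r) → Seminorm ℝ (Fin (n j) → ℝ)) :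
    Set ((BlockIndex m → ℝ) × (BlockIndex n → ℝ)) :=
  {v | max (blockNorm NM v.1) (blockNorm NN v.2) ≤ 1}

/-- `c_l(n_1, …, n_r) = ∑_{x ∈ {0,1}^r} (-1)^{r - (x_1 + ⋯ + x_r)} (n_1 x_1 + ⋯ + n_r x_r)^l`. -/
def cConst {r : ℕ} (l : ℕ) (n : Fin r → ℕ) : ℝ :=
  ∑ x : Fin r → Fin 2,
    (-1 : ℝ) ^ (r - ∑ j, (x j : ℕ)) * (∑ j, (n j : ℝ) * ((x j : ℕ) : ℝ)) ^ l

end MultDioph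

end

/-! Let P(q) be the product of the block norms of q raised to the block dimensions, and take s = 1
first. A solution of height at most e^T is a pair (p, q) such that every block of q has norm in (0,
e^T] and p + θq lies in the region of ℝ^m with parameter ε/P(q), where block norms are bounded by η
and their weighted product is at most ε/P(q). The proof is a first and second moment argument over
unit cubes of matrices θ.

First moment. For q ≠ 0 the point θq is uniform modulo 1, so the expected number of solutions is
M(T), the sum over q of the volumes of the regions. The region is a hyperbolic region in a box, of
volume asymptotic to V δ log(1/δ)^(k-1)/(k-1)! with V the product of the volumes of the unit balls.
Abel summation in each block, combined by the multinomial formula, turns the sum over q into the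
stated constant times T^(k+r-1); the alternating sum `cConst` appears because inclusion-exclusion
keeps only positive exponents (`tendsto_firstMoment`).

Second moment. If q and q' are linearly independent, θq and θq' are independent modulo 1 and the
correlation is exactly a product of volumes. If q = a w and q' = b w with a, b coprime, a unimodular
change of variables rewrites the number of pairs with b p ≠ a p' as a lattice point count in a
region dilated by a; lattice point estimates then give the product of volumes plus an error, and all
errors together are O(T^(2(k+r-1)-1)) (`exists_sum_pairSum_le`). The remaining pairs are
proportional vectors. Discarding the vectors divisible by an integer above C leaves each vector at
most (2C+1)^2 proportional partners, and the discarded vectors number O(T^(k+r-1)/C) on average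
(`exists_lintegral_bigContent_le`). With C^3 ≤ T the truncated count has mean square distance
O(T^(2(k+r-1))/C) from M(T) (`exists_lintegral_truncCount_le`).

Almost sure convergence. Along values of T for which T^(k+r-1) grows geometrically and C is about
T^(1/3), these bounds are summable, so the normalized count converges almost everywhere. Since the
count is monotone in T, ratios tending to 1 give the full limit. Finally, dividing a solution by s
changes η to η/s, ε to ε/s^d and T to T - log s, and the limit does not depend on η, which yields
every s. -/

namespace MultDioph
open Set
open scoped ENNReal

/-! ### Averages over θ through endomorphism-type maps of tori. -/

section TorusMoments

variable {ι κ K : Type} [Fintype ι] [Fintype κ] [Fintype K]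

/-- Lebesgue measure on the unit cube of `ℝ^ι` with lower corner `t`. -/
noncomputable def unitBox (t : ι → ℝ) : Measure (ι → ℝ) :=
  Measure.pi fun i => volume.restrict (Ioc (t i) (t i + 1))

/-- Lebesgue measure on the unit cube of the space of `ι × κ` matrices with lower corner `t`. -/
noncomputable def unitCube (t : ι → κ → ℝ) : Measure (ι → κ → ℝ) :=
  Measure.pi fun i => unitBox (t i)

instance isProbabilityMeasure_unitBox (t : ι → ℝ) : IsProbabilityMeasure (unitBox t) := by
  have (i : ι) : IsProbabilityMeasure (volume.restrict (Ioc (t i) (t i + 1))) :=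
    ⟨by simp⟩
  unfold unitBox; infer_instance

instance isProbabilityMeasure_unitCube (t : ι → κ → ℝ) : IsProbabilityMeasure (unitCube t) := by
  unfold unitCube; infer_instance

lemma unitBox_eq_restrict (t : ι → ℝ) :
    unitBox t = volume.restrict (Set.pi univ fun i => Ioc (t i) (t i + 1)) := by
  rw [unitBox, volume_pi, Measure.restrict_pi_pi]

lemma unitCube_eq_restrict (t : ι → κ → ℝ) :
    unitCube t = volume.restrict
      (Set.pi univ fun i => Set.pi univ fun j => Ioc (t i j) (t i j + 1)) := by
  rw [volume_pi, Measure.restrict_pi_pi, unitCube]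
  simp_rw [unitBox_eq_restrict]

/-- The projection of the matrix space to the torus. -/
def toTorus (x : ι → κ → ℝ) : ι → κ → UnitAddCircle := fun i j => (x i j : UnitAddCircle)

lemma measurePreserving_toTorus (t : ι → κ → ℝ) :
    MeasurePreserving (toTorus (ι := ι) (κ := κ)) (unitCube t) volume :=
  measurePreserving_pi _ _ fun i => measurePreserving_pi _ _ fun j =>
    UnitAddCircle.measurePreserving_mk (t i j)

/-- The homomorphism of tori given by rows of integers. -/
noncomputable def torusHom (Q : K → κ → ℤ) :
    (ι → κ → UnitAddCircle) →+ (K → ι → UnitAddCircle) where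
  toFun x := fun a i => ∑ j, Q a j • x i j
  map_zero' := by ext; simp
  map_add' x y := by ext; simp [Finset.sum_add_distrib]

/-- Independent rows mean full row rank, hence a surjective linear map. Lifting torus points to the
reals then gives surjectivity of `torusHom`. -/
lemma exists_real_preimage (Q : K → κ → ℤ)
    (hQ : LinearIndependent ℝ fun (a : K) (j : κ) => (Q a j : ℝ)) (y : K → ℝ) :
    ∃ x : κ → ℝ, ∀ a, ∑ j, (Q a j : ℝ) * x j = y a := by
  classical
  let M : Matrix K κ ℝ := Matrix.of fun a j => (Q a j : ℝ)
  have h1 : Function.Injective M.vecMul := Matrix.vecMul_injective_iff.2 hQ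
  have h2 : Function.Surjective M.mulVecLin := by
    rw [← LinearMap.range_eq_top]
    apply Submodule.eq_top_of_finrank_eq
    have := hQ.rank_matrix (M := M)
    rw [Matrix.rank] at this
    rw [this]; simp
  obtain ⟨x, hx⟩ := h2 y
  exact ⟨x, fun a => by simpa [M, Matrix.mulVec, dotProduct] using congrFun hx a⟩

lemma coe_unitAddCircle_sum {σ : Type} (s : Finset σ) (f : σ → ℝ) :
    ((∑ j ∈ s, f j : ℝ) : UnitAddCircle) = ∑ j ∈ s, (f j : UnitAddCircle) :=
  map_sum (QuotientAddGroup.mk' (AddSubgroup.zmultiples (1 : ℝ))) f s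

/-- A continuous surjective homomorphism of compact groups carries Haar measure to Haar measure, and
both measures here have total mass 1. -/
lemma measurePreserving_torusHom (Q : K → κ → ℤ)
    (hQ : LinearIndependent ℝ fun (a : K) (j : κ) => (Q a j : ℝ)) :
    MeasurePreserving (torusHom (ι := ι) Q) volume volume := by
  have h1 (σ : Type) [Fintype σ] : (volume : Measure (σ → UnitAddCircle)).IsAddHaarMeasure :=
    inferInstanceAs (Measure.pi fun _ : σ => (volume : Measure UnitAddCircle)).IsAddHaarMeasure
  have h2 (σ τ : Type) [Fintype σ] [Fintype τ] :
      (volume : Measure (σ → τ → UnitAddCircle)).IsAddHaarMeasure := by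
    have := h1 τ
    have : MeasurableAdd (τ → UnitAddCircle) := inferInstance
    exact Measure.pi.isAddHaarMeasure fun _ : σ => (volume : Measure (τ → UnitAddCircle))
  have := h2 ι κ
  have := h2 K ι
  apply AddMonoidHom.measurePreserving
  · change Continuous fun (x : ι → κ → UnitAddCircle) => fun a i => ∑ j, Q a j • x i j
    fun_prop
  · intro y
    choose z hz using fun (a : K) (i : ι) => QuotientAddGroup.mk_surjective (y a i)
    choose x hx using fun i : ι => exists_real_preimage Q hQ (fun a => z a i)
    refine ⟨toTorus x, ?_⟩
    ext a i
    rw [← hz a i, ← hx i a]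
    change ∑ j, Q a j • ((x i j : ℝ) : UnitAddCircle) = ((∑ j, (Q a j : ℝ) * x i j : ℝ) : UnitAddCircle)
    rw [coe_unitAddCircle_sum]
    refine Finset.sum_congr rfl fun j _ => ?_
    rw [← zsmul_eq_mul]
    rfl
  · simp [volume_pi, Measure.pi_univ]

/-- Averages over a unit cube of matrices of a periodic function of the images of linearly
independent integer vectors. -/
lemma lintegral_periodic_comp (Q : K → κ → ℤ)
    (hQ : LinearIndependent ℝ fun (a : K) (j : κ) => (Q a j : ℝ)) (t : ι → κ → ℝ)
    (t' : K → ι → ℝ)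
    (f : (K → ι → ℝ) → ℝ≥0∞) (hf : Measurable f)
    (hper : ∀ x (l : K → ι → ℤ), f (fun a i => x a i + l a i) = f x) :
    ∫⁻ θ, f (fun a i => ∑ j, θ i j * (Q a j : ℝ)) ∂(unitCube t) = ∫⁻ x, f x ∂(unitCube t') := by
  -- Representatives in (0, 1] give a measurable section of the torus, through which the periodic
  -- function `f` descends.
  let sec : (K → ι → UnitAddCircle) → (K → ι → ℝ) :=
    fun u a i => (AddCircle.equivIoc 1 0 (u a i) : ℝ)
  have hsec : Measurable sec := by
    refine measurable_pi_lambda _ fun a => measurable_pi_lambda _ fun i => ?_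
    exact measurable_subtype_coe.comp
      ((AddCircle.measurableEquivIoc 1 0).measurable.comp
        ((measurable_pi_apply i).comp (measurable_pi_apply a)))
  have hfs (x : K → ι → ℝ) : f (sec (toTorus x)) = f x := by
    have h (a : K) (i : ι) : ∃ l : ℤ, sec (toTorus x) a i = x a i + l := by
      have h1 : ((sec (toTorus x) a i : ℝ) : UnitAddCircle) = (x a i : UnitAddCircle) :=
        (AddCircle.equivIoc 1 0).symm_apply_apply _
      rw [eq_comm, QuotientAddGroup.eq] at h1
      obtain ⟨l, hl⟩ := AddSubgroup.mem_zmultiples_iff.1 h1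
      refine ⟨l, ?_⟩
      simp at hl
      linarith
    choose l hl using h
    have : sec (toTorus x) = fun a i => x a i + l a i := by
      ext a i; exact hl a i
    rw [this, hper]
  have hg : Measurable (f ∘ sec) := hf.comp hsec
  have h1 (θ : ι → κ → ℝ) : f (fun a i => ∑ j, θ i j * (Q a j : ℝ)) =
      (f ∘ sec) (torusHom Q (toTorus θ)) := by
    rw [← hfs]
    simp only [Function.comp]
    congr 2
    ext a i
    change ((∑ j, θ i j * (Q a j : ℝ) : ℝ) : UnitAddCircle) =
      ∑ j, Q a j • ((θ i j : ℝ) : UnitAddCircle)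
    rw [coe_unitAddCircle_sum]
    refine Finset.sum_congr rfl fun j _ => ?_
    rw [mul_comm, ← zsmul_eq_mul]
    rfl
  simp_rw [h1]
  have h2 := ((measurePreserving_torusHom Q hQ).comp (measurePreserving_toTorus t)).lintegral_comp hg
  simp only [Function.comp_def] at h2 hg ⊢
  rw [h2,
    ← (measurePreserving_toTorus t').lintegral_comp hg]
  simp [hfs]

lemma measurePreserving_unitCube_unique [Unique K] (t : K → ι → ℝ) :
    MeasurePreserving (fun x : K → ι → ℝ => x default) (unitCube t) (unitBox (t default)) := by
  have := measurePreserving_piUnique (fun a : K => unitBox (t a))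
  exact this

lemma lintegral_periodic_mulVec (w : κ → ℤ) (hw : w ≠ 0) (t : ι → κ → ℝ)
    (f : (ι → ℝ) → ℝ≥0∞) (hf : Measurable f)
    (hper : ∀ x (l : ι → ℤ), f (fun i => x i + l i) = f x) :
    ∫⁻ θ, f (fun i => ∑ j, θ i j * (w j : ℝ)) ∂(unitCube t) = ∫⁻ x, f x ∂(unitBox 0) := by
  have hQ : LinearIndependent ℝ fun (_ : Unit) (j : κ) => (w j : ℝ) := by
    rw [linearIndependent_unique_iff]
    intro h
    apply hw
    ext j
    simpa using congrFun h j
  have := lintegral_periodic_comp (fun _ : Unit => w) hQ t 0 (fun x => f (x default))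
    (hf.comp (measurable_pi_apply _)) (fun x l => hper _ _)
  rw [this, (measurePreserving_unitCube_unique (ι := ι) (0 : Unit → ι → ℝ)).lintegral_comp hf]
  rfl

/-- The images of two independent vectors are jointly uniform on the product torus, so Tonelli
separates the two factors. This is the source of exact decorrelation in the second moment. -/
lemma lintegral_periodic_mulVec_mul (q q' : κ → ℤ)
    (hQ : LinearIndependent ℝ ![fun j => (q j : ℝ), fun j => (q' j : ℝ)]) (t : ι → κ → ℝ)
    (f g : (ι → ℝ) → ℝ≥0∞) (hf : Measurable f) (hg : Measurable g)
    (hperf : ∀ x (l : ι → ℤ), f (fun i => x i + l i) = f x)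
    (hperg : ∀ x (l : ι → ℤ), g (fun i => x i + l i) = g x) :
    ∫⁻ θ, f (fun i => ∑ j, θ i j * (q j : ℝ)) * g (fun i => ∑ j, θ i j * (q' j : ℝ))
      ∂(unitCube t) = (∫⁻ x, f x ∂(unitBox 0)) * ∫⁻ x, g x ∂(unitBox 0) := by
  have hQ' : LinearIndependent ℝ fun (a : Fin 2) (j : κ) => ((![q, q'] a j : ℤ) : ℝ) := by
    convert! hQ using 1
    ext a j
    fin_cases a <;> rfl
  have := lintegral_periodic_comp ![q, q'] hQ' t 0 (fun x => f (x 0) * g (x 1))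
    ((hf.comp (measurable_pi_apply _)).mul (hg.comp (measurable_pi_apply _)))
    (fun x l => by rw [hperf, hperg])
  simp only [Matrix.cons_val_zero, Matrix.cons_val_one] at this
  rw [this]
  have h2 := measurePreserving_piFinTwo (fun a : Fin 2 => unitBox (0 : ι → ℝ))
  have h3 : (unitCube (0 : Fin 2 → ι → ℝ)) = Measure.pi fun a : Fin 2 => unitBox (0 : ι → ℝ) := rfl
  rw [h3]
  have h4 := h2.lintegral_comp (f := fun p => f p.1 * g p.2)
    ((hf.comp measurable_fst).mul (hg.comp measurable_snd))
  simp only [MeasurableEquiv.piFinTwo_apply] at h4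
  rw [h4, lintegral_prod_mul hf.aemeasurable hg.aemeasurable]

/-- Unfolding: integrating the periodization over a unit box gives the full integral. -/
lemma lintegral_unitBox_tsum (h : (ι → ℝ) → ℝ≥0∞) (hh : Measurable h) :
    ∫⁻ x, ∑' p : ι → ℤ, h (fun i => x i + p i) ∂(unitBox 0) = ∫⁻ x, h x := by
  have hm (p : ι → ℤ) : Measurable fun x : ι → ℝ => h fun i => x i + (p i : ℝ) :=
    hh.comp (f := fun (x : ι → ℝ) i => x i + (p i : ℝ)) (by fun_prop)
  rw [lintegral_tsum fun p => (hm p).aemeasurable]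
  let S : (ι → ℤ) → Set (ι → ℝ) := fun p => Set.pi univ fun i => Ioc ((p i : ℝ)) (p i + 1)
  have hS (p : ι → ℤ) : MeasurableSet (S p) := MeasurableSet.univ_pi fun i => measurableSet_Ioc
  have hdisj : Pairwise (Function.onFun Disjoint S) := by
    intro p p' hpp
    rw [Function.onFun, Set.disjoint_left]
    intro x hx hx'
    apply hpp
    ext i
    have h1 := hx i (mem_univ _)
    have h2 := hx' i (mem_univ _)
    simp only [mem_Ioc] at h1 h2
    have h3 : (p i : ℝ) < p' i + 1 := by linarith
    have h4 : (p' i : ℝ) < p i + 1 := by linarith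
    norm_cast at h3 h4
    omega
  have hun : ⋃ p, S p = univ := by
    -- The cubes are open on the left, so the corner is the ceiling minus one rather than the floor.
    refine eq_univ_of_forall fun x => mem_iUnion.2 ⟨fun i => ⌈x i⌉ - 1, fun i _ => ?_⟩
    simp only [mem_Ioc]
    push_cast
    constructor
    · linarith [Int.ceil_lt_add_one (x i)]
    · linarith [Int.le_ceil (x i)]
  rw [← setLIntegral_univ h, ← hun, lintegral_iUnion hS hdisj]
  refine tsum_congr fun p => ?_
  have hmp := measurePreserving_add_right (volume : Measure (ι → ℝ)) (fun i => (p i : ℝ))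
  have := hmp.setLIntegral_comp_preimage (hS p) hh
  rw [← this, unitBox_eq_restrict]
  have hset : (fun x : ι → ℝ => x + fun i => (p i : ℝ)) ⁻¹' S p =
      Set.pi univ fun i => Ioc ((0 : ι → ℝ) i) ((0 : ι → ℝ) i + 1) := by
    ext x
    simp only [S, mem_preimage, Set.mem_pi, mem_univ, true_implies, mem_Ioc, Pi.add_apply, Pi.zero_apply]
    refine forall_congr' fun i => ⟨fun h => ⟨by linarith [h.1], by linarith [h.2]⟩,
      fun h => ⟨by linarith [h.1], by linarith [h.2]⟩⟩
  rw [hset]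
  rfl

end TorusMoments

/-! ### First moments and pair correlations of integer translates. -/

section Moments

variable {ι κ : Type} [Fintype κ]

lemma linForm_of_apply (θ : ι → κ → ℝ) (p : ι → ℤ) (q : κ → ℤ) :
    linForm (Matrix.of θ) p q = fun i => (∑ j, θ i j * (q j : ℝ)) + (p i : ℝ) := by
  ext i
  simp [linForm, toReal, Matrix.mulVec, dotProduct, add_comm]

/-- The number of integer translates of `x` that lie in `A`. -/
noncomputable def hitSum (A : Set (ι → ℝ)) (x : ι → ℝ) : ℝ≥0∞ :=
  ∑' p : ι → ℤ, A.indicator 1 (fun i => x i + p i)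

lemma measurable_indicator_shift {A : Set (ι → ℝ)} (hA : MeasurableSet A) (p : ι → ℤ) :
    Measurable fun x : ι → ℝ => (A.indicator 1 (fun i => x i + p i) : ℝ≥0∞) :=
  (measurable_one.indicator hA).comp (f := fun (x : ι → ℝ) i => x i + (p i : ℝ)) (by fun_prop)

lemma hitSum_add_int (A : Set (ι → ℝ)) (x : ι → ℝ) (l : ι → ℤ) :
    hitSum A (fun i => x i + l i) = hitSum A x := by
  unfold hitSum
  symm
  rw [← (Equiv.addLeft l).tsum_eq]
  refine tsum_congr fun p => ?_
  congr 1
  ext i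
  simp [add_assoc]

variable [Fintype ι]

lemma measurable_hitSum {A : Set (ι → ℝ)} (hA : MeasurableSet A) : Measurable (hitSum A) :=
  Measurable.tsum fun p => measurable_indicator_shift hA p

lemma lintegral_hitSum {A : Set (ι → ℝ)} (hA : MeasurableSet A) :
    ∫⁻ x, hitSum A x ∂(unitBox 0) = volume A := by
  unfold hitSum
  rw [lintegral_unitBox_tsum _ (measurable_one.indicator hA), lintegral_indicator_one hA]

/-- First moment of the number of integer points `p` with `p + θ q ∈ A`. -/
lemma lintegral_tsum_linForm {A : Set (ι → ℝ)} (hA : MeasurableSet A) (q : κ → ℤ) (hq : q ≠ 0)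
    (t : ι → κ → ℝ) :
    ∫⁻ θ, ∑' p : ι → ℤ, A.indicator 1 (linForm (Matrix.of θ) p q) ∂(unitCube t) = volume A := by
  simp_rw [linForm_of_apply]
  rw [← lintegral_hitSum hA, ← lintegral_periodic_mulVec q hq t (hitSum A) (measurable_hitSum hA)
    (hitSum_add_int A)]
  rfl

/-- Pair correlation for independent integer vectors `q`, `q'`. -/
lemma lintegral_tsum_linForm_mul {A B : Set (ι → ℝ)} (hA : MeasurableSet A) (hB : MeasurableSet B)
    (q q' : κ → ℤ) (hQ : LinearIndependent ℝ ![fun j => (q j : ℝ), fun j => (q' j : ℝ)])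
    (t : ι → κ → ℝ) :
    ∫⁻ θ, ∑' pp : (ι → ℤ) × (ι → ℤ), A.indicator 1 (linForm (Matrix.of θ) pp.1 q) *
      B.indicator 1 (linForm (Matrix.of θ) pp.2 q') ∂(unitCube t) = volume A * volume B := by
  simp_rw [linForm_of_apply]
  rw [← lintegral_hitSum hA, ← lintegral_hitSum hB,
    ← lintegral_periodic_mulVec_mul q q' hQ t (hitSum A) (hitSum B) (measurable_hitSum hA)
    (measurable_hitSum hB) (hitSum_add_int A) (hitSum_add_int B)]
  refine lintegral_congr fun θ => ?_
  rw [ENNReal.summable.tsum_prod' fun _ => ENNReal.summable]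
  simp_rw [ENNReal.tsum_mul_left, ENNReal.tsum_mul_right]
  rfl

/-- The unimodular change of variables `(l, c) ↦ (a l - v c, b l + u c)` for `u a + v b = 1`. -/
def bezoutEquiv {a b u v : ℤ} (h : u * a + v * b = 1) :
    (ι → ℤ) × (ι → ℤ) ≃ (ι → ℤ) × (ι → ℤ) where
  toFun x := (fun i => a * x.2 i - v * x.1 i, fun i => b * x.2 i + u * x.1 i)
  invFun x := (fun i => a * x.2 i - b * x.1 i, fun i => u * x.1 i + v * x.2 i)
  left_inv x := by
    ext i
    · simp only; linear_combination (x.1 i) * h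
    · simp only; linear_combination (x.2 i) * h
  right_inv x := by
    ext i
    · simp only; linear_combination (x.1 i) * h
    · simp only; linear_combination (x.2 i) * h

open Classical in
/-- Pair correlation for parallel integer vectors `a w`, `b w`. -/
lemma lintegral_tsum_linForm_parallel {A B : Set (ι → ℝ)} (hA : MeasurableSet A)
    (hB : MeasurableSet B) (w : κ → ℤ) (hw : w ≠ 0) (a b : ℤ) (ha : 0 < a) (hab : IsCoprime a b)
    (t : ι → κ → ℝ) :
    ∫⁻ θ, ∑' pp : (ι → ℤ) × (ι → ℤ), (if b • pp.1 = a • pp.2 then 0 else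
      A.indicator 1 (linForm (Matrix.of θ) pp.1 (a • w)) *
      B.indicator 1 (linForm (Matrix.of θ) pp.2 (b • w))) ∂(unitCube t) =
    ENNReal.ofReal (((a : ℝ) ^ Fintype.card ι)⁻¹) * ∫⁻ x in A, ∑' c : ι → ℤ,
      (if c = 0 then 0 else B.indicator 1 (fun i => ((b : ℝ) * x i + c i) / a)) := by
  obtain ⟨u, v, huv⟩ := hab
  have huvR : (u : ℝ) * a + v * b = 1 := by exact_mod_cast huv
  have haR : (0 : ℝ) < a := by exact_mod_cast ha
  let F : (ι → ℤ) × (ι → ℤ) → (ι → ℝ) → ℝ≥0∞ := fun pp x =>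
    if b • pp.1 = a • pp.2 then 0 else
      A.indicator 1 (fun i => a * x i + pp.1 i) * B.indicator 1 (fun i => b * x i + pp.2 i)
  have hF (pp) : Measurable (F pp) := by
    by_cases h : b • pp.1 = a • pp.2
    · simp only [F, h, if_true]; exact measurable_const
    · simp only [F, h, if_false]
      exact ((measurable_one.indicator hA).comp
        (f := fun (x : ι → ℝ) i => a * x i + (pp.1 i : ℝ)) (by fun_prop)).mul
        ((measurable_one.indicator hB).comp
        (f := fun (x : ι → ℝ) i => b * x i + (pp.2 i : ℝ)) (by fun_prop))
  -- As a function of x = θw the whole sum is periodic, because shifting x by l moves (p, p') by (a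
  -- l, b l) and keeps the condition b p ≠ a p'.
  let f : (ι → ℝ) → ℝ≥0∞ := fun x => ∑' pp, F pp x
  have hf : Measurable f := Measurable.tsum hF
  have hper (x : ι → ℝ) (l : ι → ℤ) : f (fun i => x i + l i) = f x := by
    simp only [f]
    symm
    rw [← ((Equiv.addLeft (a • l)).prodCongr (Equiv.addLeft (b • l))).tsum_eq]
    refine tsum_congr fun pp => ?_
    have h1 : b • (a • l + pp.1) = a • (b • l + pp.2) ↔ b • pp.1 = a • pp.2 := by
      rw [smul_add, smul_add, smul_comm b a l, add_right_inj]
    simp only [F, Equiv.prodCongr_apply, Prod.map, Equiv.coe_addLeft, h1]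
    congr 3
    · ext i; simp; ring
    · ext i; simp; ring
  have hstep1 : ∀ θ : ι → κ → ℝ, (∑' pp : (ι → ℤ) × (ι → ℤ), (if b • pp.1 = a • pp.2 then 0 else
      A.indicator 1 (linForm (Matrix.of θ) pp.1 (a • w)) *
      B.indicator 1 (linForm (Matrix.of θ) pp.2 (b • w))) : ℝ≥0∞) =
      f (fun i => ∑ j, θ i j * (w j : ℝ)) := by
    intro θ
    refine tsum_congr fun pp => ?_
    simp only [F, linForm_of_apply]
    congr 3
    · ext i; simp [Finset.mul_sum]; exact Finset.sum_congr rfl fun j _ => by ring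
    · ext i; simp [Finset.mul_sum]; exact Finset.sum_congr rfl fun j _ => by ring
  simp_rw [hstep1]
  rw [lintegral_periodic_mulVec w hw t f hf hper]
  -- In the coordinates (c, l) of `bezoutEquiv` one has b p - a p' = -c, so the excluded pairs are
  -- those with c = 0, while l only translates x and unfolds the box to the whole space.
  let h : (ι → ℤ) → (ι → ℝ) → ℝ≥0∞ := fun c x => if c = 0 then 0 else
    A.indicator 1 (fun i => a * x i - v * c i) * B.indicator 1 (fun i => b * x i + u * c i)
  have hh (c) : Measurable (h c) := by
    by_cases hc : c = 0
    · simp only [h, hc, if_true]; exact measurable_const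
    · simp only [h, hc, if_false]
      exact ((measurable_one.indicator hA).comp
        (f := fun (x : ι → ℝ) i => a * x i - v * (c i : ℝ)) (by fun_prop)).mul
        ((measurable_one.indicator hB).comp
        (f := fun (x : ι → ℝ) i => b * x i + u * (c i : ℝ)) (by fun_prop))
  have hstep2 (x : ι → ℝ) : f x = ∑' c, ∑' l : ι → ℤ, h c (fun i => x i + l i) := by
    simp only [f]
    rw [← (bezoutEquiv huv).tsum_eq, ENNReal.summable.tsum_prod' fun _ => ENNReal.summable]
    refine tsum_congr fun c => tsum_congr fun l => ?_
    have h1 : b • ((bezoutEquiv huv) (c, l)).1 = a • ((bezoutEquiv huv) (c, l)).2 ↔ c = 0 := by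
      constructor
      · intro h
        ext i
        have := congrFun h i
        simp only [bezoutEquiv, Equiv.coe_fn_mk, Pi.smul_apply, smul_eq_mul] at this
        simp only [Pi.zero_apply]
        linear_combination -this - (c i) * huv
      · rintro rfl
        ext i
        simp only [bezoutEquiv, Equiv.coe_fn_mk, Pi.smul_apply, smul_eq_mul, Pi.zero_apply]
        ring
    simp only [F, h, h1]
    congr 3
    · ext i; simp [bezoutEquiv]; ring
    · ext i; simp [bezoutEquiv]; ring
  simp_rw [hstep2]
  have hhs (c : ι → ℤ) : Measurable fun x : ι → ℝ => ∑' l : ι → ℤ, h c (fun i => x i + l i) :=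
    Measurable.tsum fun l => (hh c).comp (f := fun (x : ι → ℝ) i => x i + (l i : ℝ))
      (by fun_prop)
  rw [lintegral_tsum fun c => (hhs c).aemeasurable]
  simp_rw [lintegral_unitBox_tsum (h _) (hh _)]
  have hkm (c : ι → ℤ) : Measurable fun x : ι → ℝ =>
      (if c = 0 then 0 else B.indicator 1 (fun i => ((b : ℝ) * x i + c i) / a) : ℝ≥0∞) := by
    by_cases hc : c = 0
    · simp only [hc, if_true]; exact measurable_const
    · simp only [hc, if_false]
      exact (measurable_one.indicator hB).comp
        (f := fun (x : ι → ℝ) i => ((b : ℝ) * x i + c i) / a) (by fun_prop)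
  rw [lintegral_tsum fun c => (hkm c).aemeasurable, ← ENNReal.tsum_mul_left]
  refine tsum_congr fun c => ?_
  rw [← lintegral_indicator hA]
  set g : (ι → ℝ) → ℝ≥0∞ := A.indicator fun x =>
    (if c = 0 then 0 else B.indicator 1 (fun i => ((b : ℝ) * x i + c i) / a)) with hg
  have hgm : Measurable g := (hkm c).indicator hA
  -- Substituting y = a x - v c gives b x + u c = (b y + c)/a by the Bézout relation; the dilation
  -- by a produces the inverse power of a in front.
  have hcomp (x : ι → ℝ) : h c x = g ((a : ℝ) • x + (fun i => -(v * (c i : ℝ)))) := by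
    by_cases hc : c = 0
    · simp [h, hg, hc]
    · simp only [h, hg, hc, if_false, Set.indicator_apply]
      have e1 : (fun i => (a : ℝ) * x i - v * c i) = (a : ℝ) • x + (fun i => -(v * (c i : ℝ))) := by
        ext i; simp; ring
      have e2 : (fun i => ((b : ℝ) * ((a : ℝ) • x + (fun i => -(v * (c i : ℝ)))) i + c i) / a) =
          fun i => (b : ℝ) * x i + u * c i := by
        ext i
        simp only [Pi.add_apply, Pi.smul_apply, smul_eq_mul]
        field_simp
        linear_combination (-(c i : ℝ)) * huvR
      rw [← e1] at e2 ⊢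
      rw [e2]
      split_ifs <;> simp
  simp_rw [hcomp]
  have h3 : ∫⁻ x : ι → ℝ, g ((a : ℝ) • x + (fun i => -(v * (c i : ℝ)))) =
      ∫⁻ x, g (x + (fun i => -(v * (c i : ℝ)))) ∂(Measure.map (fun x => (a : ℝ) • x) volume) := by
    rw [lintegral_map (f := fun x => g (x + (fun i => -(v * (c i : ℝ)))))
      (hgm.comp (by fun_prop)) (by fun_prop)]
  rw [h3, Measure.map_addHaar_smul _ haR.ne', lintegral_smul_measure,
    lintegral_add_right_eq_self]
  simp only [Module.finrank_fintype_fun_eq_card, smul_eq_mul]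
  rw [abs_of_pos (by positivity)]

end Moments
end MultDioph

namespace MultDioph
open Set
open scoped ENNReal Pointwise

/-! ### Norms on one block: comparison, volume of balls, lattice points in balls. -/

section BlockNorm

variable {n : ℕ} (N : Seminorm ℝ (Fin n → ℝ))

lemma exists_seminorm_le : ∃ K : ℝ, 0 < K ∧ ∀ x, N x ≤ K * ‖x‖ := by
  refine ⟨∑ i, N (Pi.single i 1) + 1, by positivity, fun x => ?_⟩
  have h1 : x = ∑ i, x i • (Pi.single i (1 : ℝ) : Fin n → ℝ) := by
    ext j; simp [Finset.sum_apply, Pi.single_apply]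
  calc N x ≤ ∑ i, N (x i • (Pi.single i (1 : ℝ) : Fin n → ℝ)) := by
        conv_lhs => rw [h1]
        exact Finset.le_sum_of_subadditive N (map_zero N).le (map_add_le_add N) _ _
    _ ≤ ∑ i, ‖x‖ * N (Pi.single i (1 : ℝ)) := by
        refine Finset.sum_le_sum fun i _ => ?_
        rw [map_smul_eq_mul]
        gcongr
        exact norm_le_pi_norm x i
    _ ≤ _ := by rw [← Finset.mul_sum]; nlinarith [norm_nonneg x]

lemma continuous_seminorm : Continuous N := by
  obtain ⟨K, hK, h⟩ := exists_seminorm_le N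
  refine LipschitzWith.continuous (K := ⟨K, hK.le⟩) (LipschitzWith.of_dist_le_mul fun x y => ?_)
  rw [Real.dist_eq, dist_eq_norm]
  exact (abs_sub_map_le_sub N x y).trans (h _)

variable {N} (hN : ∀ x, N x = 0 → x = 0)
include hN

lemma exists_le_seminorm : ∃ c : ℝ, 0 < c ∧ ∀ x, c * ‖x‖ ≤ N x := by
  rcases (Metric.sphere (0 : Fin n → ℝ) 1).eq_empty_or_nonempty with h | h
  · refine ⟨1, one_pos, fun x => ?_⟩
    have : x = 0 := by
      by_contra hx
      have : (‖x‖⁻¹ • x) ∈ Metric.sphere (0 : Fin n → ℝ) 1 := by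
        simp [norm_smul, hx]
      simp [h] at this
    simp [this]
  · obtain ⟨x₀, hx₀, hmin⟩ := (isCompact_sphere (0 : Fin n → ℝ) 1).exists_isMinOn h
      (continuous_seminorm N).continuousOn
    have hx1 : ‖x₀‖ = 1 := by simpa using hx₀
    refine ⟨N x₀, lt_of_le_of_ne (apply_nonneg N _) fun h0 => ?_, fun x => ?_⟩
    · have := hN x₀ h0.symm
      simp [this] at hx1
    · by_cases hx : x = 0
      · simp [hx]
      have h1 : (‖x‖⁻¹ • x) ∈ Metric.sphere (0 : Fin n → ℝ) 1 := by simp [norm_smul, hx]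
      have h2 := hmin h1
      simp only [mem_ofPred_eq, map_smul_eq_mul, norm_inv, norm_norm] at h2
      have h3 : 0 < ‖x‖ := norm_pos_iff.2 hx
      rw [inv_mul_eq_div, le_div_iff₀ h3] at h2
      exact h2

omit hN in
/-- The volume of the unit ball of a norm. -/
noncomputable def ballVol (N : Seminorm ℝ (Fin n → ℝ)) : ℝ := volume.real {x | N x ≤ 1}

omit hN in
lemma measurableSet_seminorm_le (ρ : ℝ) : MeasurableSet {x | N x ≤ ρ} :=
  (isClosed_le (continuous_seminorm N) continuous_const).measurableSet

lemma volume_unitBall_lt_top : volume {x | N x ≤ 1} < ∞ := by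
  obtain ⟨c, hc, h⟩ := exists_le_seminorm hN
  refine lt_of_le_of_lt (measure_mono (t := Metric.closedBall 0 (1 / c)) fun x hx => ?_)
    measure_closedBall_lt_top
  rw [mem_closedBall_zero_iff, le_div_iff₀ hc]
  have := h x
  have hx' : N x ≤ 1 := hx
  linarith

omit hN in
lemma volume_unitBall_pos : 0 < volume {x | N x ≤ 1} := by
  have hopen : IsOpen {x | N x < 1} := isOpen_lt (continuous_seminorm N) continuous_const
  exact lt_of_lt_of_le (hopen.measure_pos volume ⟨0, by simp⟩) (measure_mono fun x hx => (show N x < 1 from hx).le)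

lemma ballVol_pos : 0 < ballVol N :=
  ENNReal.toReal_pos volume_unitBall_pos.ne' (volume_unitBall_lt_top hN).ne

lemma volume_seminorm_le (hn : 0 < n) {ρ : ℝ} (hρ : 0 ≤ ρ) :
    volume {x | N x ≤ ρ} = ENNReal.ofReal (ballVol N * ρ ^ n) := by
  have hV : volume {x | N x ≤ 1} = ENNReal.ofReal (ballVol N) := by
    rw [ballVol, Measure.real, ENNReal.ofReal_toReal (volume_unitBall_lt_top hN).ne]
  rcases hρ.eq_or_lt with rfl | hρ
  · have : {x | N x ≤ 0} = {0} := by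
      ext x
      simp only [mem_ofPred_eq, mem_singleton_iff]
      refine ⟨fun h => hN x (le_antisymm h (apply_nonneg N x)), ?_⟩
      rintro rfl; simp
    have : Nonempty (Fin n) := ⟨⟨0, hn⟩⟩
    rw [‹{x | N x ≤ 0} = {0}›]
    simp [hn.ne']
  · have h1 : {x | N x ≤ ρ} = ρ • {x | N x ≤ 1} := by
      ext x
      rw [Set.mem_smul_set_iff_inv_smul_mem₀ hρ.ne']
      simp only [mem_ofPred_eq, map_smul_eq_mul, norm_inv, Real.norm_of_nonneg hρ.le]
      rw [inv_mul_eq_div, div_le_one hρ]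
    rw [h1, Measure.addHaar_smul, hV, ← ENNReal.ofReal_mul (abs_nonneg _)]
    congr 1
    simp [abs_of_pos hρ, mul_comm]

/-- Counting integer points in translated balls. -/
lemma exists_count_ball_bounds (hn : 0 < n) : ∃ K : ℝ, 0 < K ∧ ∀ (y : Fin n → ℝ) (ρ : ℝ), 0 ≤ ρ →
    Measure.count {c : Fin n → ℤ | N (fun i => y i + c i) ≤ ρ} ≤
      ENNReal.ofReal (ballVol N * (ρ + K) ^ n) ∧
    ENNReal.ofReal (ballVol N * ρ ^ n) ≤
      Measure.count {c : Fin n → ℤ | N (fun i => y i + c i) ≤ ρ + K} := by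
  obtain ⟨K, hK, hle⟩ := exists_seminorm_le N
  have hbox : ∀ᵐ x ∂(unitBox (0 : Fin n → ℝ)), N x ≤ K := by
    rw [unitBox_eq_restrict]
    refine (ae_restrict_mem (MeasurableSet.univ_pi fun i => measurableSet_Ioc)).mono fun x hx => ?_
    refine (hle x).trans ?_
    have : ‖x‖ ≤ 1 := by
      rw [pi_norm_le_iff_of_nonneg zero_le_one]
      intro i
      have := hx i (mem_univ _)
      simp only [mem_Ioc, Pi.zero_apply, zero_add] at this
      rw [Real.norm_eq_abs, abs_le]
      constructor <;> linarith
    nlinarith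
  -- The count is viewed as a constant integrated over the unit box. Moving the centre by a point of
  -- the box changes every norm by at most K, and the average of the moved count is exactly a
  -- volume.
  have hcount (y : Fin n → ℝ) (ρ : ℝ) :
      Measure.count {c : Fin n → ℤ | N (fun i => y i + c i) ≤ ρ} =
      ∫⁻ _ : Fin n → ℝ, ∑' p : Fin n → ℤ,
        ({x | N x ≤ ρ}.indicator 1 (fun i => y i + p i) : ℝ≥0∞) ∂(unitBox 0) := by
    rw [lintegral_const, measure_univ, mul_one, ← lintegral_indicator_one .of_discrete, lintegral_count]
    rfl
  have hvol (y : Fin n → ℝ) (ρ : ℝ) (hρ : 0 ≤ ρ) :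
      ∫⁻ x : Fin n → ℝ, ∑' p : Fin n → ℤ,
        ({x | N x ≤ ρ}.indicator 1 (fun i => x i + p i + y i) : ℝ≥0∞) ∂(unitBox 0) =
      ENNReal.ofReal (ballVol N * ρ ^ n) := by
    have hm : Measurable (({x | N x ≤ ρ}.indicator 1 : (Fin n → ℝ) → ℝ≥0∞)) :=
      measurable_one.indicator (measurableSet_seminorm_le ρ)
    rw [lintegral_unitBox_tsum (fun x => {x | N x ≤ ρ}.indicator 1 (fun i => x i + y i))
      (hm.comp (f := fun (x : Fin n → ℝ) i => x i + y i) (by fun_prop))]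
    rw [← volume_seminorm_le hN hn hρ, ← lintegral_indicator_one (measurableSet_seminorm_le ρ)]
    exact lintegral_add_right_eq_self _ y
  have hmono {x y : Fin n → ℝ} (p : Fin n → ℤ) (hx : N x ≤ K) :
      |N (fun i => y i + p i) - N (fun i => x i + p i + y i)| ≤ K := by
    refine (abs_sub_map_le_sub N _ _).trans ?_
    have : (fun i => y i + (p i : ℝ)) - (fun i => x i + p i + y i) = -x := by
      ext i; simp; ring
    rwa [this, map_neg_eq_map]
  refine ⟨K, hK, fun y ρ hρ => ⟨?_, ?_⟩⟩
  · rw [hcount, ← hvol y (ρ + K) (by positivity)]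
    refine lintegral_mono_ae (hbox.mono fun x hx => ENNReal.tsum_le_tsum fun p => ?_)
    have := abs_le.1 (hmono (y := y) p hx)
    simp only [Set.indicator_apply, mem_ofPred_eq]
    split_ifs with h1 h2
    · exact le_rfl
    · exact absurd (by linarith) h2
    all_goals simp
  · rw [hcount, ← hvol y ρ hρ]
    refine lintegral_mono_ae (hbox.mono fun x hx => ENNReal.tsum_le_tsum fun p => ?_)
    have := abs_le.1 (hmono (y := y) p hx)
    simp only [Set.indicator_apply, mem_ofPred_eq]
    split_ifs with h1 h2
    · exact le_rfl
    · exact absurd (by linarith) h2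
    all_goals simp

end BlockNorm

/-! ### Hyperbolic regions in boxes and their measures. -/

section Hyperbolic

/-- The part of the box `∏ [0, H_i]` where `c ∏ s_i ≤ δ`. -/
def hypSet {k : ℕ} (H : Fin k → ℝ) (c δ : ℝ) : Set (Fin k → ℝ) :=
  {s | (∀ i, s i ∈ Icc 0 (H i)) ∧ c * ∏ i, s i ≤ δ}

lemma measurableSet_hypSet {k : ℕ} (H : Fin k → ℝ) (c δ : ℝ) : MeasurableSet (hypSet H c δ) := by
  have h1 : MeasurableSet (Set.pi univ fun i => Icc 0 (H i)) :=
    MeasurableSet.univ_pi fun i => measurableSet_Icc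
  have h2 : MeasurableSet {s : Fin k → ℝ | c * ∏ i, s i ≤ δ} :=
    measurableSet_le (by fun_prop) measurable_const
  convert! h1.inter h2 using 1
  ext s
  simp only [hypSet, mem_inter_iff, Set.mem_pi, mem_univ, true_implies, mem_ofPred_eq]

/-- `hypSet` in product coordinates. -/
def hypSetProd {k : ℕ} (H : Fin (k + 1) → ℝ) (c δ : ℝ) : Set (ℝ × (Fin k → ℝ)) :=
  {s | s.1 ∈ Icc 0 (H 0) ∧ (∀ i, s.2 i ∈ Icc 0 (H i.succ)) ∧ c * (s.1 * ∏ i, s.2 i) ≤ δ}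

lemma measurableSet_hypSetProd {k : ℕ} (H : Fin (k + 1) → ℝ) (c δ : ℝ) :
    MeasurableSet (hypSetProd H c δ) := by
  have h1 : MeasurableSet (Icc 0 (H 0) ×ˢ (Set.pi univ fun i : Fin k => Icc 0 (H i.succ))) :=
    measurableSet_Icc.prod (MeasurableSet.univ_pi fun i => measurableSet_Icc)
  have h2 : MeasurableSet {s : ℝ × (Fin k → ℝ) | c * (s.1 * ∏ i, s.2 i) ≤ δ} :=
    measurableSet_le (by fun_prop) measurable_const
  convert! h1.inter h2 using 1
  ext s
  simp only [hypSetProd, mem_inter_iff, mem_prod, Set.mem_pi, mem_univ, true_implies,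
    mem_ofPred_eq, and_assoc]

lemma pi_hypSet_succ {k : ℕ} (μ : Fin (k + 1) → Measure ℝ) [∀ i, SigmaFinite (μ i)]
    (H : Fin (k + 1) → ℝ) (c δ : ℝ) :
    Measure.pi μ (hypSet H c δ) =
      (μ 0).prod (Measure.pi fun i : Fin k => μ i.succ) (hypSetProd H c δ) := by
  have := (measurePreserving_piFinSuccAbove μ 0).measure_preimage
    (measurableSet_hypSetProd H c δ).nullMeasurableSet
  simp only [Fin.succAbove_zero] at this
  rw [← this]
  congr 1
  ext s
  simp only [hypSet, hypSetProd, mem_ofPred_eq, mem_preimage, Fin.forall_fin_succ,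
    Fin.prod_univ_succ, and_assoc]
  rfl

/-- Fixing the first coordinate s leaves a region of the same shape with c replaced by c s. The
parameter c is carried along precisely to make inductions on the dimension close. -/
lemma prod_hypSetProd {k : ℕ} (μ : Measure ℝ) (ν : Measure (Fin k → ℝ)) [SigmaFinite μ]
    [SigmaFinite ν] (H : Fin (k + 1) → ℝ) (c δ : ℝ) :
    μ.prod ν (hypSetProd H c δ) =
      ∫⁻ s in Icc 0 (H 0), ν (hypSet (fun i => H i.succ) (c * s) δ) ∂μ := by
  rw [Measure.prod_apply (measurableSet_hypSetProd H c δ), ← lintegral_indicator measurableSet_Icc]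
  refine lintegral_congr fun s => ?_
  by_cases hs : s ∈ Icc 0 (H 0)
  · rw [Set.indicator_of_mem hs]
    congr 1
    ext s'
    simp only [hypSetProd, hypSet, mem_preimage, mem_ofPred_eq, hs, true_and, mul_assoc]
  · rw [Set.indicator_of_notMem hs]
    convert! measure_empty (μ := ν)
    ext s'
    simp only [hypSetProd, mem_preimage, mem_ofPred_eq, hs, false_and, mem_empty_iff_false]

/-- Slicing in the other direction makes the fibres one-dimensional, so that a single factor of the
product measure can be exchanged. -/
lemma prod_hypSetProd_symm {k : ℕ} (μ : Measure ℝ) (ν : Measure (Fin k → ℝ)) [SigmaFinite μ]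
    [SigmaFinite ν] (H : Fin (k + 1) → ℝ) (c δ : ℝ) :
    μ.prod ν (hypSetProd H c δ) =
      ∫⁻ s in Set.pi univ (fun i : Fin k => Icc 0 (H i.succ)),
        μ {t | t ∈ Icc 0 (H 0) ∧ c * (t * ∏ i, s i) ≤ δ} ∂ν := by
  rw [Measure.prod_apply_symm (measurableSet_hypSetProd H c δ),
    ← lintegral_indicator (MeasurableSet.univ_pi fun i => measurableSet_Icc)]
  refine lintegral_congr fun s => ?_
  by_cases hs : ∀ i, s i ∈ Icc 0 (H i.succ)
  · rw [Set.indicator_of_mem (Set.mem_univ_pi.2 hs)]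
    congr 1
    ext t
    simp only [hypSetProd, mem_preimage, mem_ofPred_eq, hs, true_and, implies_true]
  · rw [Set.indicator_of_notMem (fun h => hs (Set.mem_univ_pi.1 h))]
    convert! measure_empty (μ := μ)
    ext t
    simp only [hypSetProd, mem_preimage, mem_ofPred_eq, hs, false_and, and_false,
      mem_empty_iff_false]

/-- Product measures of hyperbolic regions depend in a controlled way on the distribution
functions of the factors. -/
lemma pi_hypSet_le {k : ℕ} (μ ν : Fin k → Measure ℝ) [∀ i, SigmaFinite (μ i)]
    [∀ i, SigmaFinite (ν i)] (H : Fin k → ℝ) (hH : ∀ i, 0 ≤ H i) (M e : ℝ≥0∞) (hM : 1 ≤ M)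
    (hμ : ∀ i, μ i (Icc 0 (H i)) ≤ M) (hν : ∀ i, ν i (Icc 0 (H i)) ≤ M)
    (h : ∀ i t, 0 ≤ t → t ≤ H i → μ i (Icc 0 t) ≤ ν i (Icc 0 t) + e)
    (c δ : ℝ) (hc : 0 ≤ c) (hδ : 0 ≤ δ) :
    Measure.pi μ (hypSet H c δ) ≤ Measure.pi ν (hypSet H c δ) + k * M ^ k * e := by
  induction k generalizing c with
  | zero =>
    have : μ = ν := Subsingleton.elim _ _
    simp [this]
  | succ k ih =>
    rw [pi_hypSet_succ, pi_hypSet_succ]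
    -- The factors are exchanged in two stages: first all but the leading one, by induction on each
    -- slice, then the leading one.
    have step1 : (μ 0).prod (Measure.pi fun i : Fin k => μ i.succ) (hypSetProd H c δ) ≤
        (μ 0).prod (Measure.pi fun i : Fin k => ν i.succ) (hypSetProd H c δ) +
          M * (k * M ^ k * e) := by
      rw [prod_hypSetProd, prod_hypSetProd]
      calc _ ≤ ∫⁻ s in Icc 0 (H 0), (Measure.pi (fun i : Fin k => ν i.succ)
              (hypSet (fun i => H i.succ) (c * s) δ) + k * M ^ k * e) ∂μ 0 := by
            refine setLIntegral_mono' measurableSet_Icc fun s hs => ?_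
            exact ih (fun i => μ i.succ) (fun i => ν i.succ) (fun i => H i.succ)
              (fun i => hH _) (fun i => hμ _) (fun i => hν _) (fun i => h _) (c * s)
              (mul_nonneg hc hs.1)
        _ ≤ _ := by
            rw [lintegral_add_right _ measurable_const, setLIntegral_const, mul_comm M]
            gcongr
            exact hμ 0
    -- Every fibre in the leading coordinate is an initial interval, so only the distribution
    -- function of that factor matters.
    have hslice (P : ℝ) (hP : 0 ≤ P) : ∃ t, 0 ≤ t ∧ t ≤ H 0 ∧
        {t | t ∈ Icc 0 (H 0) ∧ c * (t * P) ≤ δ} = Icc 0 t := by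
      rcases (mul_nonneg hc hP).eq_or_lt with h0 | h0
      · refine ⟨H 0, hH 0, le_rfl, ?_⟩
        ext t
        simp only [mem_ofPred_eq, and_iff_left_iff_imp]
        intro _
        have : c * (t * P) = 0 := by linear_combination -t * h0
        linarith
      · refine ⟨min (H 0) (δ / (c * P)), le_min (hH 0) (by positivity), min_le_left _ _, ?_⟩
        ext t
        simp only [mem_ofPred_eq, mem_Icc, le_min_iff, and_assoc, le_div_iff₀ h0]
        rw [show c * (t * P) = t * (c * P) by ring]
    have step2 : (μ 0).prod (Measure.pi fun i : Fin k => ν i.succ) (hypSetProd H c δ) ≤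
        (ν 0).prod (Measure.pi fun i : Fin k => ν i.succ) (hypSetProd H c δ) + M ^ k * e := by
      rw [prod_hypSetProd_symm, prod_hypSetProd_symm]
      calc _ ≤ ∫⁻ s in Set.pi univ (fun i : Fin k => Icc 0 (H i.succ)),
              (ν 0 {t | t ∈ Icc 0 (H 0) ∧ c * (t * ∏ i, s i) ≤ δ} + e)
                ∂(Measure.pi fun i : Fin k => ν i.succ) := by
            refine setLIntegral_mono' (MeasurableSet.univ_pi fun i => measurableSet_Icc)
              fun s hs => ?_
            obtain ⟨t, ht0, htH, ht⟩ := hslice (∏ i, s i)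
              (Finset.prod_nonneg fun i _ => (hs i (mem_univ _)).1)
            rw [ht]
            exact h 0 t ht0 htH
        _ ≤ _ := by
            rw [lintegral_add_right _ measurable_const, setLIntegral_const, mul_comm (M ^ k)]
            gcongr
            rw [Measure.pi_pi]
            calc _ ≤ ∏ _i : Fin k, M := Finset.prod_le_prod' fun i _ => hν _
              _ = M ^ k := by simp
    refine (step1.trans (add_le_add_left step2 _)).trans ?_
    rw [add_assoc]
    gcongr
    push_cast
    calc M ^ k * e + M * (k * M ^ k * e) ≤ M ^ (k + 1) * e + M * (k * M ^ k * e) := by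
          gcongr
          exact Nat.le_succ k
      _ = _ := by ring

/-- The volume of a hyperbolic region in a box of volume `L`. -/
noncomputable def hypVol (k : ℕ) (L δ : ℝ) : ℝ :=
  if L ≤ δ then L else δ * ∑ l ∈ Finset.range k, Real.log (L / δ) ^ l / l.factorial

/-- For s ≤ δ/L the slice is the full box, and this range contributes δ, the constant term of the
new logarithmic sum. Beyond it, integrating log(sL/δ)^l/(s l!) raises each exponent by one. -/
lemma hypVol_succ_integral (k : ℕ) {L H δ : ℝ} (hL : 0 < L) (hH : 0 < H) (hδ : 0 < δ) :
    ∫⁻ s in Ioc 0 H, ENNReal.ofReal (hypVol k L (δ / s)) =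
      ENNReal.ofReal (hypVol (k + 1) (L * H) δ) := by
  set a := δ / L with ha
  have ha0 : 0 < a := by positivity
  have hcond (s : ℝ) (hs : 0 < s) : L ≤ δ / s ↔ s ≤ a := by
    rw [ha, le_div_iff₀ hs, le_div_iff₀ hL, mul_comm]
  have hlow (b : ℝ) (hb0 : 0 ≤ b) (hb : b ≤ a) :
      ∫⁻ s in Ioc 0 b, ENNReal.ofReal (hypVol k L (δ / s)) = ENNReal.ofReal (L * b) := by
    rw [setLIntegral_congr_fun (g := fun _ => ENNReal.ofReal L) measurableSet_Ioc
      fun s hs => by simp only [hypVol, (hcond s hs.1).2 (hs.2.trans hb), if_true]]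
    rw [setLIntegral_const, Real.volume_Ioc, ← ENNReal.ofReal_mul hL.le, sub_zero]
  by_cases hcase : L * H ≤ δ
  · rw [hlow H hH.le (by rw [ha, le_div_iff₀ hL]; linarith), hypVol, if_pos hcase]
  · have haH : a < H := by
      rw [ha, div_lt_iff₀ hL]; push Not at hcase; linarith
    rw [← Ioc_union_Ioc_eq_Ioc ha0.le haH.le, lintegral_union measurableSet_Ioc
      (Ioc_disjoint_Ioc_of_le le_rfl), hlow a ha0.le le_rfl]
    let G : ℝ → ℝ := fun s => δ * ∑ l ∈ Finset.range k, Real.log (s / a) ^ (l + 1) / (l + 1).factorial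
    let g : ℝ → ℝ := fun s => δ / s * ∑ l ∈ Finset.range k, Real.log (s / a) ^ l / l.factorial
    have hG (s : ℝ) (hs : 0 < s) : HasDerivAt G (g s) s := by
      have hlog : HasDerivAt (fun s => Real.log (s / a)) (1 / s) s := by
        have := ((hasDerivAt_id s).div_const a).log (by simp only [id]; positivity)
        convert! this using 1
        simp only [id]
        field_simp
      have : HasDerivAt G (δ * ∑ l ∈ Finset.range k,
          (((l + 1 : ℕ) : ℝ) * Real.log (s / a) ^ l * (1 / s)) / (l + 1).factorial) s := by
        refine HasDerivAt.const_mul _ (HasDerivAt.fun_sum fun l _ => ?_)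
        simpa using (hlog.fun_pow (l + 1)).div_const ((l + 1).factorial : ℝ)
      convert! this using 1
      simp only [g]
      rw [div_mul_eq_mul_div, mul_div_assoc, Finset.sum_div]
      congr 1
      refine Finset.sum_congr rfl fun l _ => ?_
      rw [Nat.factorial_succ]
      push_cast
      field_simp
    have hgc : ContinuousOn g (Icc a H) := by
      intro s hs
      have hs0 : 0 < s := ha0.trans_le hs.1
      apply ContinuousAt.continuousWithinAt
      have : ContinuousAt (fun s => Real.log (s / a)) s :=
        (continuousAt_id.div_const a).log (by simp only [id]; positivity)
      simp only [g]
      refine (continuousAt_const.div continuousAt_id hs0.ne').mul ?_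
      exact tendsto_finsetSum _ fun l _ => (this.pow l).div_const _
    have hint : IntervalIntegrable g volume a H :=
      ContinuousOn.intervalIntegrable (by rwa [uIcc_of_le haH.le])
    have hFTC : ∫ s in a..H, g s = G H - G a :=
      intervalIntegral.integral_eq_sub_of_hasDerivAt
        (fun s hs => hG s (by rw [uIcc_of_le haH.le] at hs; exact ha0.trans_le hs.1)) hint
    have hGa : G a = 0 := by
      simp [G, div_self ha0.ne']
    have hcongr : ∫⁻ s in Ioc a H, ENNReal.ofReal (hypVol k L (δ / s)) =
        ∫⁻ s in Ioc a H, ENNReal.ofReal (g s) := by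
      refine setLIntegral_congr_fun measurableSet_Ioc fun s hs => ?_
      have hs0 : 0 < s := ha0.trans hs.1
      have : ¬ L ≤ δ / s := by rw [hcond s hs0]; exact not_le.2 hs.1
      simp only [hypVol, if_neg this, g]
      rw [show L / (δ / s) = s / a by rw [ha]; field_simp]
    have hg0 : 0 ≤ᵐ[volume.restrict (Ioc a H)] g := by
      refine (ae_restrict_mem measurableSet_Ioc).mono fun s hs => ?_
      have hs0 : 0 < s := ha0.trans hs.1
      have : 0 ≤ Real.log (s / a) := Real.log_nonneg (by rw [le_div_iff₀ ha0]; linarith [hs.1])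
      simp only [g, Pi.zero_apply]
      positivity
    rw [hcongr, ← ofReal_integral_eq_lintegral_ofReal
      ((intervalIntegrable_iff_integrableOn_Ioc_of_le haH.le).1 hint) hg0,
      ← intervalIntegral.integral_of_le haH.le, hFTC, hGa, sub_zero, ← ENNReal.ofReal_add
      (by positivity)]
    · congr 1
      rw [hypVol, if_neg hcase, Finset.sum_range_succ']
      simp only [G]
      rw [show L * H / δ = H / a by rw [ha]; field_simp]
      rw [ha]
      field_simp
      simp
      ring
    · have : 0 ≤ Real.log (H / a) := Real.log_nonneg (by rw [le_div_iff₀ ha0]; linarith)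
      simp only [G]
      positivity

lemma volume_hypSet {k : ℕ} (H : Fin k → ℝ) (hH : ∀ i, 0 < H i) (c δ : ℝ) (hc : 0 < c)
    (hδ : 0 < δ) :
    volume (hypSet H c δ) = ENNReal.ofReal (hypVol k (∏ i, H i) (δ / c)) := by
  rw [volume_pi]
  induction k generalizing c with
  | zero =>
    rw [Measure.pi_of_empty _ (fun i => i.elim0)]
    by_cases h : c ≤ δ
    · simp [hypSet, hypVol, le_div_iff₀ hc, h]
    · simp [hypSet, hypVol, le_div_iff₀ hc, h]
  | succ k ih =>
    rw [pi_hypSet_succ, prod_hypSetProd, Fin.prod_univ_succ, mul_comm (H 0),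
      ← hypVol_succ_integral k (Finset.prod_pos fun i _ => hH _) (hH 0) (by positivity),
      ← restrict_Ioc_eq_restrict_Icc]
    refine setLIntegral_congr_fun measurableSet_Ioc fun s hs => ?_
    rw [ih (fun i => H i.succ) (fun i => hH _) (c * s) (mul_pos hc hs.1), div_div]

end Hyperbolic

/-! ### The target region: its volume and its lattice points. -/

section Region

/-- Pushing each factor forward along a size function reduces the region to `hypSet`. It is stated
for general measures because both Lebesgue and rescaled counting measure are needed, and
`pi_hypSet_le` compares the two. -/
lemma pi_region_eq {k : ℕ} {X : Fin k → Type} [∀ i, MeasurableSpace (X i)]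
    (μ : (i : Fin k) → Measure (X i)) [∀ i, SigmaFinite (μ i)] (s : (i : Fin k) → X i → ℝ)
    (hs : ∀ i, Measurable (s i)) (hs0 : ∀ i x, 0 ≤ s i x) (H : Fin k → ℝ)
    (hfin : ∀ i, μ i {x | s i x ≤ H i} < ∞) (δ : ℝ) :
    Measure.pi μ {x | (∀ i, s i (x i) ≤ H i) ∧ ∏ i, s i (x i) ≤ δ} =
      Measure.pi (fun i => ((μ i).restrict {x | s i x ≤ H i}).map (s i)) (hypSet H 1 δ) := by
  have hf (i : Fin k) : IsFiniteMeasure ((μ i).restrict {x | s i x ≤ H i}) :=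
    ⟨by simpa using hfin i⟩
  rw [← Measure.pi_map_pi fun i => (hs i).aemeasurable,
    Measure.map_apply (by fun_prop) (measurableSet_hypSet _ _ _), ← Measure.restrict_pi_pi,
    Measure.restrict_apply ((measurableSet_hypSet _ _ _).preimage (by fun_prop))]
  congr 1
  ext x
  simp only [hypSet, mem_inter_iff, mem_preimage, mem_ofPred_eq, Set.mem_pi, mem_univ,
    true_implies, mem_Icc, hs0, true_and, one_mul]
  tauto

lemma map_restrict_Icc {X : Type} [MeasurableSpace X] (μ : Measure X) (s : X → ℝ)
    (hs : Measurable s) (hs0 : ∀ x, 0 ≤ s x) {H t : ℝ} (ht : t ≤ H) :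
    (μ.restrict {x | s x ≤ H}).map s (Icc 0 t) = μ {x | s x ≤ t} := by
  rw [Measure.map_apply hs measurableSet_Icc, Measure.restrict_apply (hs measurableSet_Icc)]
  congr 1
  ext x
  simp only [mem_inter_iff, mem_preimage, mem_Icc, hs0, true_and, mem_ofPred_eq,
    and_iff_left_iff_imp]
  exact fun h => h.trans ht

variable {k : ℕ} {m : Fin k → ℕ}

lemma measurePreserving_blocks (m : Fin k → ℕ) :
    MeasurePreserving (fun (x : BlockIndex m → ℝ) (i : Fin k) => blockProj i x) volume volume := by
  have hsymm : MeasurePreserving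
      (MeasurableEquiv.piCurry (fun (i : Fin k) (_ : Fin (m i)) => ℝ)).symm volume volume := by
    refine ⟨MeasurableEquiv.measurable _, ?_⟩
    symm
    rw [volume_pi]
    refine Measure.pi_eq fun S hS => ?_
    rw [Measure.map_apply (MeasurableEquiv.measurable _) (MeasurableSet.univ_pi hS)]
    have : (MeasurableEquiv.piCurry (fun (i : Fin k) (_ : Fin (m i)) => ℝ)).symm ⁻¹'
        (Set.pi univ S) = Set.pi univ fun i => Set.pi univ fun j => S ⟨i, j⟩ := by
      ext x
      simp only [mem_preimage, Set.mem_pi, mem_univ, true_implies, Sigma.forall]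
      rfl
    rw [this, volume_pi, Measure.pi_pi]
    simp_rw [volume_pi, Measure.pi_pi]
    rw [Fintype.prod_sigma]
  exact hsymm.symm

/-- The target region: norms of the blocks bounded by `η` and product of norms at most `δ`. -/
def region (NM : (i : Fin k) → Seminorm ℝ (Fin (m i) → ℝ)) (η : Fin k → ℝ) (δ : ℝ) :
    Set (BlockIndex m → ℝ) :=
  {x | (∀ i, NM i (blockProj i x) ≤ η i) ∧ ∏ i, NM i (blockProj i x) ^ m i ≤ δ}

lemma continuous_seminorm_blockProj (NM : (i : Fin k) → Seminorm ℝ (Fin (m i) → ℝ)) (i : Fin k) :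
    Continuous fun x : BlockIndex m → ℝ => NM i (blockProj i x) :=
  (continuous_seminorm (NM i)).comp (by unfold blockProj; fun_prop)

lemma measurableSet_region (NM : (i : Fin k) → Seminorm ℝ (Fin (m i) → ℝ)) (η : Fin k → ℝ)
    (δ : ℝ) : MeasurableSet (region NM η δ) := by
  have h1 : MeasurableSet (⋂ i, {x : BlockIndex m → ℝ | NM i (blockProj i x) ≤ η i}) :=
    MeasurableSet.iInter fun i =>
      (isClosed_le (continuous_seminorm_blockProj NM i) continuous_const).measurableSet
  have h2 : MeasurableSet {x : BlockIndex m → ℝ | ∏ i, NM i (blockProj i x) ^ m i ≤ δ} :=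
    (isClosed_le (continuous_finsetProd _ fun i _ => (continuous_seminorm_blockProj NM i).pow _)
      continuous_const).measurableSet
  convert! h1.inter h2 using 1
  ext x
  simp only [region, mem_inter_iff, mem_iInter, mem_ofPred_eq]

lemma pow_le_iff_seminorm_le {n : ℕ} (hn : 0 < n) {V a u : ℝ} (hV : 0 < V) (ha : 0 ≤ a)
    (hu : 0 ≤ u) : V * a ^ n ≤ u ↔ a ≤ (u / V) ^ ((n : ℝ)⁻¹) := by
  have h0 : 0 ≤ (u / V) ^ ((n : ℝ)⁻¹) := by positivity
  rw [← pow_le_pow_iff_left₀ ha h0 hn.ne', Real.rpow_inv_natCast_pow (by positivity) hn.ne',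
    le_div_iff₀ hV, mul_comm]

/-- Weighting by V i normalizes the coordinates: when V i is the volume of the unit ball, V i times
the m i-th power of the norm pushes Lebesgue measure of the block to Lebesgue measure of the
half-line. -/
lemma region_iff {NM : (i : Fin k) → Seminorm ℝ (Fin (m i) → ℝ)} {V : Fin k → ℝ}
    (hV : ∀ i, 0 < V i) (hm : ∀ i, 0 < m i) {η : Fin k → ℝ} (hη : ∀ i, 0 ≤ η i) {δ : ℝ}
    (x : BlockIndex m → ℝ) :
    x ∈ region NM η δ ↔ (∀ i, V i * NM i (blockProj i x) ^ m i ≤ V i * η i ^ m i) ∧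
      ∏ i, V i * NM i (blockProj i x) ^ m i ≤ (∏ i, V i) * δ := by
  rw [Finset.prod_mul_distrib, mul_le_mul_iff_right₀ (Finset.prod_pos fun i _ => hV i)]
  simp only [region, mem_ofPred_eq]
  refine and_congr_left fun _ => forall_congr' fun i => ?_
  rw [mul_le_mul_iff_right₀ (hV i), pow_le_pow_iff_left₀ (apply_nonneg _ _) (hη i) (hm i).ne']

lemma volume_region {NM : (i : Fin k) → Seminorm ℝ (Fin (m i) → ℝ)}
    (hNM : ∀ i x, NM i x = 0 → x = 0) (hm : ∀ i, 0 < m i)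
    {η : Fin k → ℝ} (hη : ∀ i, 0 < η i) {δ : ℝ} (hδ : 0 < δ) :
    volume (region NM η δ) = ENNReal.ofReal
      (hypVol k (∏ i, ballVol (NM i) * η i ^ m i) ((∏ i, ballVol (NM i)) * δ)) := by
  have hV (i) : 0 < ballVol (NM i) := ballVol_pos (hNM i)
  have hVp : 0 < ∏ i, ballVol (NM i) := Finset.prod_pos fun i _ => hV i
  let s : (i : Fin k) → (Fin (m i) → ℝ) → ℝ := fun i x => ballVol (NM i) * NM i x ^ m i
  have hs (i) : Measurable (s i) := ((continuous_seminorm (NM i)).measurable.pow_const _).const_mul _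
  have hs0 (i x) : 0 ≤ s i x := mul_nonneg (hV i).le (pow_nonneg (apply_nonneg _ _) _)
  let H : Fin k → ℝ := fun i => ballVol (NM i) * η i ^ m i
  have hH (i) : 0 < H i := mul_pos (hV i) (pow_pos (hη i) _)
  have hcdf (i) (u : ℝ) (hu : 0 ≤ u) : volume {x | s i x ≤ u} = ENNReal.ofReal u := by
    have : {x | s i x ≤ u} = {x | NM i x ≤ (u / ballVol (NM i)) ^ ((m i : ℝ)⁻¹)} := by
      ext x
      exact pow_le_iff_seminorm_le (hm i) (hV i) (apply_nonneg _ _) hu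
    have hq : 0 ≤ u / ballVol (NM i) := div_nonneg hu (hV i).le
    rw [this, volume_seminorm_le (hNM i) (hm i) (by positivity),
      Real.rpow_inv_natCast_pow hq (hm i).ne', mul_div_cancel₀ _ (hV i).ne']
  have hset : region NM η δ = (fun (x : BlockIndex m → ℝ) (i : Fin k) => blockProj i x) ⁻¹'
      {x | (∀ i, s i (x i) ≤ H i) ∧ ∏ i, s i (x i) ≤ (∏ i, ballVol (NM i)) * δ} := by
    ext x
    exact region_iff hV hm (fun i => (hη i).le) x
  have hmeas : MeasurableSet {x : (i : Fin k) → Fin (m i) → ℝ | (∀ i, s i (x i) ≤ H i) ∧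
      ∏ i, s i (x i) ≤ (∏ i, ballVol (NM i)) * δ} := by
    have h1 : MeasurableSet (⋂ i, {x : (i : Fin k) → Fin (m i) → ℝ | s i (x i) ≤ H i}) :=
      MeasurableSet.iInter fun i =>
        measurableSet_le ((hs i).comp (measurable_pi_apply i)) measurable_const
    have h2 : MeasurableSet {x : (i : Fin k) → Fin (m i) → ℝ |
        ∏ i, s i (x i) ≤ (∏ i, ballVol (NM i)) * δ} :=
      measurableSet_le (Finset.univ.measurable_prod fun i _ => (hs i).comp (measurable_pi_apply i))
        measurable_const
    convert! h1.inter h2 using 1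
    ext x
    simp only [mem_inter_iff, mem_iInter, mem_ofPred_eq]
  have hmeas' (i) (t : ℝ) (h0 : 0 ≤ t) (ht : t ≤ H i) :
      (volume.restrict {x | s i x ≤ H i}).map (s i) (Icc 0 t) = volume (Icc 0 t) := by
    rw [map_restrict_Icc _ _ (hs i) (hs0 i) ht, hcdf i t h0, Real.volume_Icc, sub_zero]
  have hf (i) : IsFiniteMeasure (volume.restrict {x | s i x ≤ H i}) :=
    ⟨by rw [Measure.restrict_apply_univ, hcdf i _ (hH i).le]; exact ENNReal.ofReal_lt_top⟩
  have hMle (i) : volume (Icc 0 (H i)) ≤ 1 + ∑ i, ENNReal.ofReal (H i) := by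
    rw [Real.volume_Icc, sub_zero]
    exact (Finset.single_le_sum (f := fun i => ENNReal.ofReal (H i))
      (fun _ _ => zero_le) (Finset.mem_univ i)).trans le_add_self
  rw [hset, (measurePreserving_blocks m).measure_preimage hmeas.nullMeasurableSet, volume_pi,
    pi_region_eq _ s hs hs0 H (fun i => by rw [hcdf i _ (hH i).le]; exact ENNReal.ofReal_lt_top)]
  have hfin := volume_hypSet H hH 1 ((∏ i, ballVol (NM i)) * δ) one_pos (by positivity)
  rw [div_one] at hfin
  rw [← hfin, volume_pi]
  -- The pushed-forward measures agree with Lebesgue measure on all initial intervals, so the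
  -- comparison lemma with error 0 is used in both directions.
  apply le_antisymm
  · have := pi_hypSet_le (fun i => (volume.restrict {x | s i x ≤ H i}).map (s i))
      (fun _ => (volume : Measure ℝ)) H (fun i => (hH i).le) (1 + ∑ i, ENNReal.ofReal (H i)) 0
      (le_add_right le_rfl) (fun i => by rw [hmeas' i _ (hH i).le le_rfl]; exact hMle i) hMle
      (fun i t h0 ht => by rw [hmeas' i t h0 ht, add_zero]) 1 ((∏ i, ballVol (NM i)) * δ) zero_le_one
      (by positivity)
    simpa using this
  · have := pi_hypSet_le (fun _ => (volume : Measure ℝ))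
      (fun i => (volume.restrict {x | s i x ≤ H i}).map (s i)) H (fun i => (hH i).le)
      (1 + ∑ i, ENNReal.ofReal (H i)) 0
      (le_add_right le_rfl) hMle (fun i => by rw [hmeas' i _ (hH i).le le_rfl]; exact hMle i)
      (fun i t h0 ht => by rw [hmeas' i t h0 ht, add_zero]) 1 ((∏ i, ballVol (NM i)) * δ) zero_le_one
      (by positivity)
    simpa using this

lemma volume_unitBall {r : ℕ} {n : Fin r → ℕ} (hk : 0 < k) (hr : 0 < r)
    (NM : (i : Fin k) → Seminorm ℝ (Fin (m i) → ℝ)) (NN : (j : Fin r) → Seminorm ℝ (Fin (n j) → ℝ)) :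
    volume.real (unitBall NM NN) = (∏ i, ballVol (NM i)) * ∏ j, ballVol (NN j) := by
  have hball {k : ℕ} (hk : 0 < k) {m : Fin k → ℕ} (NM : (i : Fin k) → Seminorm ℝ (Fin (m i) → ℝ)) :
      volume {x : BlockIndex m → ℝ | blockNorm NM x ≤ 1} = ∏ i, volume {x | NM i x ≤ 1} := by
    have : Nonempty (Fin k) := ⟨⟨0, hk⟩⟩
    have h1 : {x : BlockIndex m → ℝ | blockNorm NM x ≤ 1} =
        (fun (x : BlockIndex m → ℝ) (i : Fin k) => blockProj i x) ⁻¹'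
          (Set.pi univ fun i => {x | NM i x ≤ 1}) := by
      ext x
      simp only [mem_ofPred_eq, mem_preimage, Set.mem_pi, mem_univ, true_implies, blockNorm]
      exact ciSup_le_iff (Set.finite_range _).bddAbove
    rw [h1, (measurePreserving_blocks m).measure_preimage
      (MeasurableSet.univ_pi fun i => measurableSet_seminorm_le 1).nullMeasurableSet, volume_pi,
      Measure.pi_pi]
  have h2 : unitBall NM NN = {x : BlockIndex m → ℝ | blockNorm NM x ≤ 1} ×ˢ
      {x : BlockIndex n → ℝ | blockNorm NN x ≤ 1} := by
    ext x
    simp only [unitBall, mem_ofPred_eq, mem_prod, max_le_iff]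
  rw [Measure.real, h2, Measure.volume_eq_prod, Measure.prod_prod, hball hk, hball hr]
  simp [ballVol, Measure.real, ENNReal.toReal_prod]

lemma add_pow_le_add_mul (n : ℕ) {x h : ℝ} (hx : 0 ≤ x) (hh : 0 ≤ h) :
    (x + h) ^ n ≤ x ^ n + h * (n * (x + h) ^ (n - 1)) := by
  induction n with
  | zero => simp
  | succ n ih =>
    rcases n with _ | n
    · simp
    · simp only [Nat.add_sub_cancel] at ih ⊢
      calc (x + h) ^ (n + 1 + 1) = (x + h) ^ (n + 1) * x + h * (x + h) ^ (n + 1) := by ring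
        _ ≤ (x ^ (n + 1) + h * (((n + 1 : ℕ) : ℝ) * (x + h) ^ n)) * x + h * (x + h) ^ (n + 1) := by
          gcongr
        _ ≤ (x ^ (n + 1)) * x + h * (((n + 1 : ℕ) : ℝ) * (x + h) ^ n) * (x + h)
            + h * (x + h) ^ (n + 1) := by
          rw [add_mul]
          gcongr
          linarith
        _ = _ := by push_cast; ring

lemma pi_smul_count {k : ℕ} {X : Fin k → Type} [∀ i, MeasurableSpace (X i)]
    [∀ i, MeasurableSingletonClass (X i)] [∀ i, Countable (X i)] (c : Fin k → ℝ≥0∞)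
    [∀ i, SigmaFinite (c i • (Measure.count : Measure (X i)))] :
    Measure.pi (fun i => c i • (Measure.count : Measure (X i))) = (∏ i, c i) • Measure.count := by
  refine Measure.ext_of_singleton fun x => ?_
  rw [Measure.pi_singleton]
  simp

/-- Counting integer translates in dilated regions. -/
lemma exists_count_region_le {NM : (i : Fin k) → Seminorm ℝ (Fin (m i) → ℝ)}
    (hNM : ∀ i x, NM i x = 0 → x = 0) (hm : ∀ i, 0 < m i)
    {η : Fin k → ℝ} (hη : ∀ i, 0 < η i) :
    ∃ K : ℝ, 0 < K ∧ ∀ (a : ℝ), 1 ≤ a → ∀ (y : BlockIndex m → ℝ) (δ : ℝ), 0 < δ →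
      ENNReal.ofReal ((a ^ Fintype.card (BlockIndex m))⁻¹) *
        Measure.count {c : BlockIndex m → ℤ | (fun i => (y i + c i) / a) ∈ region NM η δ} ≤
      volume (region NM η δ) + ENNReal.ofReal (K / a) := by
  have hV (i) : 0 < ballVol (NM i) := ballVol_pos (hNM i)
  have hVp : 0 < ∏ i, ballVol (NM i) := Finset.prod_pos fun i _ => hV i
  choose K hK hcount using fun i => exists_count_ball_bounds (hNM i) (hm i)
  -- A mean value bound: enlarging a radius ρ ≤ η i by K i / a, with a ≥ 1, increases the volume of
  -- the ball by at most e i / a.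
  let e : Fin k → ℝ := fun i => ballVol (NM i) * (K i * (m i * (η i + K i) ^ (m i - 1)))
  have he (i) : 0 ≤ e i := by
    have := hV i; have := hK i; have := hη i
    simp only [e]; positivity
  let H : Fin k → ℝ := fun i => ballVol (NM i) * η i ^ m i
  have hH (i) : 0 < H i := mul_pos (hV i) (pow_pos (hη i) _)
  let E := 1 + ∑ i, e i
  have hE : 0 < E := by have := Finset.sum_nonneg fun i (_ : i ∈ Finset.univ) => he i; positivity
  let M := 1 + ∑ i, H i + E
  have hMp : 0 < M := by
    have := Finset.sum_nonneg fun i (_ : i ∈ Finset.univ) => (hH i).le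
    positivity
  have hHM (i) : H i + E ≤ M := by
    have := Finset.single_le_sum (f := H) (fun i _ => (hH i).le) (Finset.mem_univ i)
    simp only [M]; linarith
  refine ⟨(k + 1) * M ^ k * E, by positivity, fun a ha y δ hδ => ?_⟩
  have ha0 : 0 < a := by linarith
  let s : (i : Fin k) → (Fin (m i) → ℤ) → ℝ := fun i c =>
    ballVol (NM i) * NM i (fun j => (y ⟨i, j⟩ + c j) / a) ^ m i
  have hs (i) : Measurable (s i) := .of_discrete
  have hs0 (i x) : 0 ≤ s i x := mul_nonneg (hV i).le (pow_nonneg (apply_nonneg _ _) _)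
  let w : Fin k → ℝ≥0∞ := fun i => ENNReal.ofReal ((a ^ m i)⁻¹)
  have hsf (i) : SigmaFinite (w i • (Measure.count : Measure (Fin (m i) → ℤ))) :=
    inferInstanceAs (SigmaFinite (Real.toNNReal ((a ^ m i)⁻¹) •
      (Measure.count : Measure (Fin (m i) → ℤ))))
  let μ : (i : Fin k) → Measure (Fin (m i) → ℤ) := fun i => w i • Measure.count
  -- The rescaled counting measure of one block has distribution function at most u + O(1/a),
  -- uniformly in the translation; `pi_hypSet_le` transfers this to the product region.
  have hcdf (i) (u : ℝ) (hu : 0 ≤ u) (huH : u ≤ H i) :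
      μ i {c | s i c ≤ u} ≤ ENNReal.ofReal u + ENNReal.ofReal (E / a) := by
    set ρ := (u / ballVol (NM i)) ^ ((m i : ℝ)⁻¹) with hρ
    have hq : 0 ≤ u / ballVol (NM i) := div_nonneg hu (hV i).le
    have hρ0 : 0 ≤ ρ := by positivity
    have hρη : ρ ≤ η i := by
      rw [← pow_le_pow_iff_left₀ hρ0 (hη i).le (hm i).ne', hρ,
        Real.rpow_inv_natCast_pow hq (hm i).ne', div_le_iff₀ (hV i), mul_comm]
      exact huH
    have hρm : ballVol (NM i) * ρ ^ m i = u := by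
      rw [hρ, Real.rpow_inv_natCast_pow hq (hm i).ne', mul_div_cancel₀ _ (hV i).ne']
    have hset : {c | s i c ≤ u} = {c | NM i (fun j => y ⟨i, j⟩ + c j) ≤ a * ρ} := by
      ext c
      refine (pow_le_iff_seminorm_le (hm i) (hV i) (apply_nonneg _ _) hu).trans ?_
      have : (fun j => (y ⟨i, j⟩ + (c j : ℝ)) / a) = a⁻¹ • fun j => y ⟨i, j⟩ + (c j : ℝ) := by
        ext j; simp [div_eq_inv_mul]
      rw [this, map_smul_eq_mul, norm_inv, Real.norm_of_nonneg ha0.le, inv_mul_le_iff₀ ha0]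
      rfl
    rw [hset]
    have := (hcount i (fun j => y ⟨i, j⟩) (a * ρ) (by positivity)).1
    simp only [μ, w, Measure.smul_apply, smul_eq_mul]
    refine (mul_le_mul_right this _).trans ?_
    rw [← ENNReal.ofReal_mul (by positivity), ← ENNReal.ofReal_add hu (by positivity)]
    refine ENNReal.ofReal_le_ofReal ?_
    have h1 : (a ^ m i)⁻¹ * (ballVol (NM i) * (a * ρ + K i) ^ m i) =
        ballVol (NM i) * (ρ + K i / a) ^ m i := by
      rw [show a * ρ + K i = a * (ρ + K i / a) by field_simp, mul_pow]
      field_simp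
    rw [h1]
    have hKa : 0 ≤ K i / a := div_nonneg (hK i).le ha0.le
    have hKa' : K i / a ≤ K i := div_le_self (hK i).le ha
    have hVi := (hV i).le
    calc ballVol (NM i) * (ρ + K i / a) ^ m i ≤ ballVol (NM i) * (ρ ^ m i +
          K i / a * (m i * (ρ + K i / a) ^ (m i - 1))) := by
          gcongr; exact add_pow_le_add_mul _ hρ0 hKa
      _ ≤ ballVol (NM i) * (ρ ^ m i + K i / a * (m i * (η i + K i) ^ (m i - 1))) := by
          gcongr
      _ = u + e i / a := by rw [mul_add, hρm]; simp only [e]; ring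
      _ ≤ _ := by
          gcongr
          have := Finset.single_le_sum (f := e) (fun i _ => he i) (Finset.mem_univ i)
          simp only [E]; linarith
  have hfin (i) : μ i {c | s i c ≤ H i} < ∞ :=
    (hcdf i _ (hH i).le le_rfl).trans_lt (by simp)
  have hf (i) : IsFiniteMeasure ((μ i).restrict {x | s i x ≤ H i}) :=
    ⟨by rw [Measure.restrict_apply_univ]; exact hfin i⟩
  have hsfμ (i) : SigmaFinite (μ i) := hsf i
  have hpi := pi_region_eq μ s hs hs0 H hfin ((∏ i, ballVol (NM i)) * δ)
  have hEa : E / a ≤ E := div_le_self hE.le ha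
  have hle := pi_hypSet_le (fun i => ((μ i).restrict {x | s i x ≤ H i}).map (s i))
      (fun _ => (volume : Measure ℝ)) H (fun i => (hH i).le) (ENNReal.ofReal M)
      (ENNReal.ofReal (E / a))
      (by
        rw [← ENNReal.ofReal_one]
        refine ENNReal.ofReal_le_ofReal ?_
        have := Finset.sum_nonneg fun i (_ : i ∈ Finset.univ) => (hH i).le
        simp only [M]; linarith)
      (fun i => by
        rw [map_restrict_Icc _ _ (hs i) (hs0 i) le_rfl]
        refine (hcdf i _ (hH i).le le_rfl).trans ?_
        rw [← ENNReal.ofReal_add (hH i).le (by positivity)]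
        exact ENNReal.ofReal_le_ofReal (by linarith [hHM i]))
      (fun i => by
        rw [Real.volume_Icc, sub_zero]
        exact ENNReal.ofReal_le_ofReal (by linarith [hHM i]))
      (fun i t h0 ht => by
        rw [map_restrict_Icc _ _ (hs i) (hs0 i) ht, Real.volume_Icc, sub_zero]
        exact hcdf i t h0 ht) 1 ((∏ i, ballVol (NM i)) * δ) zero_le_one
      (by positivity)
  rw [← volume_pi, volume_hypSet H hH 1 _ one_pos (by positivity), div_one, ← hpi,
    pi_smul_count w] at hle
  rw [volume_region hNM hm hη hδ]
  have hw : ∏ i, w i = ENNReal.ofReal ((a ^ Fintype.card (BlockIndex m))⁻¹) := by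
    simp only [w]
    rw [← ENNReal.ofReal_prod_of_nonneg fun i _ => by positivity, Finset.prod_inv_distrib,
      Finset.prod_pow_eq_pow_sum, Fintype.card_sigma]
    simp
  have hcs : Measure.count {c : BlockIndex m → ℤ | (fun i => (y i + c i) / a) ∈ region NM η δ} =
      Measure.count {c : (i : Fin k) → Fin (m i) → ℤ | (∀ i, s i (c i) ≤ H i) ∧
        ∏ i, s i (c i) ≤ (∏ i, ballVol (NM i)) * δ} := by
    rw [← Measure.count_injective_image (Equiv.piCurry fun (i : Fin k) (_ : Fin (m i)) => ℤ).injective]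
    congr 1
    ext c
    simp only [Equiv.image_eq_preimage_symm, mem_preimage, mem_ofPred_eq]
    rw [region_iff hV hm (fun i => (hη i).le)]
    rfl
  rw [hcs, ← hw]
  simp only [Measure.smul_apply, smul_eq_mul] at hle
  refine hle.trans ?_
  gcongr
  rw [← ENNReal.ofReal_pow hMp.le, ← ENNReal.ofReal_natCast, ← ENNReal.ofReal_mul (by positivity),
    ← ENNReal.ofReal_mul (by positivity)]
  refine ENNReal.ofReal_le_ofReal ?_
  rw [mul_div_assoc]
  gcongr
  linarith

end Region

/-! ### Abel summation and a Cesàro lemma for integrals. -/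

section Abel

/-- Abel summation over a finite set of points. -/
lemma sum_eq_sub_integral_card {α : Type} (S : Finset α) (τ : α → ℝ) {f f' : ℝ → ℝ} {t₀ T : ℝ}
    (h0 : ∀ c ∈ S, t₀ ≤ τ c) (h1 : ∀ c ∈ S, τ c ≤ T) (hf : ∀ t, HasDerivAt f (f' t) t)
    (hf' : Continuous f') :
    ∑ c ∈ S, f (τ c) = f T * S.card -
      ∫ t in t₀..T, f' t * ((S.filter fun c => τ c ≤ t).card : ℝ) := by
  have hind (c : α) (hc : c ∈ S) :
      ∫ t in t₀..T, f' t * (if τ c ≤ t then 1 else 0) = f T - f (τ c) := by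
    rw [intervalIntegral.integral_of_le ((h0 c hc).trans (h1 c hc))]
    have : (fun t => f' t * (if τ c ≤ t then (1 : ℝ) else 0)) = (Ici (τ c)).indicator f' := by
      ext t
      by_cases h : τ c ≤ t <;> simp [h]
    rw [this, setIntegral_indicator measurableSet_Ici]
    have h2 : (Ioc t₀ T ∩ Ici (τ c) : Set ℝ) =ᵐ[volume] Ioc (τ c) T := by
      have h3 : (Ioc t₀ T ∩ Ici (τ c) : Set ℝ) =ᵐ[volume] (Ioc t₀ T ∩ Ioi (τ c) : Set ℝ) :=
        (ae_eq_refl _).inter Ioi_ae_eq_Ici.symm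
      refine h3.trans (Eventually.of_forall fun t => ?_)
      apply propext
      change (t ∈ Ioc t₀ T ∩ Ioi (τ c)) ↔ t ∈ Ioc (τ c) T
      simp only [mem_inter_iff, mem_Ioc, mem_Ioi]
      have := h0 c hc
      constructor
      · rintro ⟨⟨_, h⟩, h'⟩; exact ⟨h', h⟩
      · rintro ⟨h, h'⟩; exact ⟨⟨by linarith, h'⟩, h⟩
    rw [setIntegral_congr_set h2, ← intervalIntegral.integral_of_le (h1 c hc)]
    exact intervalIntegral.integral_eq_sub_of_hasDerivAt (fun t _ => hf t)
      (hf'.intervalIntegrable _ _)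
  have hint (c : α) : IntervalIntegrable (fun t => f' t * (if τ c ≤ t then (1 : ℝ) else 0))
      volume t₀ T := by
    have : (fun t => f' t * (if τ c ≤ t then (1 : ℝ) else 0)) = (Ici (τ c)).indicator f' := by
      ext t
      by_cases h : τ c ≤ t <;> simp [h]
    rw [this, intervalIntegrable_iff]
    exact (intervalIntegrable_iff.1 (hf'.intervalIntegrable t₀ T)).indicator measurableSet_Ici
  have hcard (t : ℝ) : f' t * ((S.filter fun c => τ c ≤ t).card : ℝ) =
      ∑ c ∈ S, f' t * (if τ c ≤ t then 1 else 0) := by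
    rw [← Finset.mul_sum, Finset.sum_boole]
  simp_rw [hcard]
  rw [intervalIntegral.integral_finsetSum fun c _ => hint c, Finset.sum_congr rfl hind,
    Finset.sum_sub_distrib]
  simp [mul_comm]

/-- Cesàro-type lemma for integrals of functions asymptotic to `A t^l`. -/
lemma tendsto_integral_div_pow {φ : ℝ → ℝ} {t₀ A : ℝ} {l : ℕ}
    (hint : ∀ a b, IntervalIntegrable φ volume a b)
    (hφ : Tendsto (fun t => φ t / t ^ l) atTop (𝓝 A)) :
    Tendsto (fun T => (∫ t in t₀..T, φ t) / T ^ (l + 1)) atTop (𝓝 (A / (l + 1))) := by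
  rw [Metric.tendsto_atTop]
  intro ε hε
  obtain ⟨T₁, hT₁⟩ := Metric.tendsto_atTop.1 hφ (ε / 2) (by positivity)
  set T₂ := max T₁ 1 with hT₂
  have hT₂1 : 1 ≤ T₂ := le_max_right _ _
  set C := |∫ t in t₀..T₂, φ t| + |A| * T₂ ^ (l + 1) with hC
  have hlim : Tendsto (fun T : ℝ => C / T ^ (l + 1)) atTop (𝓝 0) :=
    tendsto_const_nhds.div_atTop (tendsto_pow_atTop (Nat.succ_ne_zero l))
  obtain ⟨T₃, hT₃⟩ := Metric.tendsto_atTop.1 hlim (ε / 2) (by positivity)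
  refine ⟨max T₂ T₃, fun T hT => ?_⟩
  have hT2 : T₂ ≤ T := (le_max_left _ _).trans hT
  have hT0 : 0 < T := by linarith
  have hTp : 0 < T ^ (l + 1) := by positivity
  have hsplit : ∫ t in t₀..T, φ t = (∫ t in t₀..T₂, φ t) + ∫ t in T₂..T, φ t :=
    (intervalIntegral.integral_add_adjacent_intervals (hint _ _) (hint _ _)).symm
  have hpow : ∫ t in T₂..T, A * t ^ l = A * ((T ^ (l + 1) - T₂ ^ (l + 1)) / (l + 1)) := by
    rw [intervalIntegral.integral_const_mul, integral_pow]
  have hbound : |(∫ t in T₂..T, φ t) - ∫ t in T₂..T, A * t ^ l| ≤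
      ∫ t in T₂..T, (ε / 2) * t ^ l := by
    have hc : Continuous fun t : ℝ => A * t ^ l := by fun_prop
    have hc' : Continuous fun t : ℝ => (ε / 2) * t ^ l := by fun_prop
    rw [← intervalIntegral.integral_sub (hint _ _) (hc.intervalIntegrable _ _)]
    rw [← Real.norm_eq_abs]
    refine intervalIntegral.norm_integral_le_of_norm_le hT2 (Eventually.of_forall fun t ht => ?_)
      (hc'.intervalIntegrable (μ := volume) _ _)
    have ht1 : T₁ ≤ t := (le_max_left T₁ 1).trans ht.1.le
    have ht0 : 0 < t := by linarith [ht.1]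
    have := (hT₁ t ht1).le
    rw [Real.dist_eq] at this
    have htl : 0 < t ^ l := by positivity
    rw [Real.norm_eq_abs, show φ t - A * t ^ l = (φ t / t ^ l - A) * t ^ l by field_simp, abs_mul,
      abs_of_pos htl]
    gcongr
  rw [hpow, intervalIntegral.integral_const_mul, integral_pow] at hbound
  have h3 := hT₃ T ((le_max_right _ _).trans hT)
  rw [Real.dist_eq, sub_zero, abs_lt, div_lt_iff₀ hTp] at h3
  rw [Real.dist_eq, show (∫ t in t₀..T, φ t) / T ^ (l + 1) - A / (l + 1) =
    ((∫ t in t₀..T, φ t) - A * (T ^ (l + 1) / (l + 1))) / T ^ (l + 1) by field_simp, abs_div,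
    abs_of_pos hTp, div_lt_iff₀ hTp, hsplit]
  have hl1 : (1 : ℝ) ≤ l + 1 := by linarith [(Nat.cast_nonneg l : (0 : ℝ) ≤ l)]
  have h4 : (T ^ (l + 1) - T₂ ^ (l + 1)) / ((l : ℝ) + 1) ≤ T ^ (l + 1) := by
    rw [div_le_iff₀ (by linarith)]
    have : 0 ≤ T₂ ^ (l + 1) := by positivity
    nlinarith
  have h5 : |A * (T₂ ^ (l + 1) / ((l : ℝ) + 1))| ≤ |A| * T₂ ^ (l + 1) := by
    rw [abs_mul]
    gcongr
    rw [abs_of_nonneg (by positivity)]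
    exact div_le_self (by positivity) hl1
  calc |(∫ t in t₀..T₂, φ t) + (∫ t in T₂..T, φ t) - A * (T ^ (l + 1) / (l + 1))|
      = |(∫ t in t₀..T₂, φ t) + ((∫ t in T₂..T, φ t) -
          A * ((T ^ (l + 1) - T₂ ^ (l + 1)) / (l + 1))) - A * (T₂ ^ (l + 1) / (l + 1))| := by
        congr 1; ring
    _ ≤ |∫ t in t₀..T₂, φ t| + |(∫ t in T₂..T, φ t) -
          A * ((T ^ (l + 1) - T₂ ^ (l + 1)) / (l + 1))| + |A * (T₂ ^ (l + 1) / (l + 1))| := by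
        refine (abs_sub _ _).trans ?_
        gcongr
        exact abs_add_le _ _
    _ ≤ C + ε / 2 * T ^ (l + 1) := by
        have h6 : ε / 2 * ((T ^ (l + 1) - T₂ ^ (l + 1)) / (l + 1)) ≤ ε / 2 * T ^ (l + 1) := by
          gcongr
        rw [hC]; linarith
    _ < ε * T ^ (l + 1) := by linarith [h3.2]

end Abel

/-! ### Sums over integer vectors in a single block. -/

section BlockSums

variable {n : ℕ} {N : Seminorm ℝ (Fin n → ℝ)} (hN : ∀ x, N x = 0 → x = 0)

include hN in
lemma finite_seminorm_le (ρ : ℝ) : {c : Fin n → ℤ | N (toReal c) ≤ ρ}.Finite := by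
  obtain ⟨c₀, hc₀, h⟩ := exists_le_seminorm hN
  refine (Set.finite_Icc (fun _ : Fin n => -⌈ρ / c₀⌉) (fun _ => ⌈ρ / c₀⌉)).subset fun c hc => ?_
  have hc' : N (toReal c) ≤ ρ := hc
  have h1 (i : Fin n) : |(c i : ℝ)| ≤ ρ / c₀ := by
    rw [le_div_iff₀ hc₀, mul_comm]
    refine le_trans ?_ ((h _).trans hc')
    gcongr
    exact norm_le_pi_norm (toReal c) i
  have h2 (i : Fin n) : |c i| ≤ ⌈ρ / c₀⌉ := by
    have := (h1 i).trans (Int.le_ceil _)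
    exact_mod_cast this
  exact ⟨fun i => (abs_le.1 (h2 i)).1, fun i => (abs_le.1 (h2 i)).2⟩

include hN in
lemma finite_block (T : ℝ) : {c : Fin n → ℤ | N (toReal c) ≠ 0 ∧ N (toReal c) ≤ Real.exp T}.Finite :=
  (finite_seminorm_le hN (Real.exp T)).subset fun _ hc => hc.2

open Classical in
/-- The integer vectors of norm in `(0, e^T]`. -/
noncomputable def blockFinset (N : Seminorm ℝ (Fin n → ℝ)) (T : ℝ) : Finset (Fin n → ℤ) :=
  if h : {c : Fin n → ℤ | N (toReal c) ≠ 0 ∧ N (toReal c) ≤ Real.exp T}.Finite then h.toFinset else ∅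

include hN

lemma mem_blockFinset {T : ℝ} {c : Fin n → ℤ} :
    c ∈ blockFinset N T ↔ N (toReal c) ≠ 0 ∧ N (toReal c) ≤ Real.exp T := by
  rw [blockFinset, dif_pos (finite_block hN T)]
  simp

omit hN in
lemma one_le_norm_toReal {c : Fin n → ℤ} (hc : c ≠ 0) : 1 ≤ ‖toReal c‖ := by
  obtain ⟨i, hi⟩ := Function.ne_iff.1 hc
  have h1 : 1 ≤ |c i| := Int.one_le_abs hi
  have h2 : (1 : ℝ) ≤ |(c i : ℝ)| := by exact_mod_cast h1
  exact h2.trans (norm_le_pi_norm (toReal c) i)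

omit hN in
lemma seminorm_toReal_zero : N (toReal (0 : Fin n → ℤ)) = 0 := by
  have : toReal (0 : Fin n → ℤ) = 0 := by ext; simp [toReal]
  rw [this, map_zero]

/-- Nonzero integer vectors are bounded away from 0, so their logarithmic norms have a lower bound,
used below as the lower limit of integration in Abel summation. For a general norm it may be
negative. -/
lemma exists_exp_le_seminorm : ∃ t₀ : ℝ, t₀ ≤ 0 ∧ ∀ c : Fin n → ℤ, N (toReal c) ≠ 0 →
    Real.exp t₀ ≤ N (toReal c) := by
  obtain ⟨c₀, hc₀, h⟩ := exists_le_seminorm hN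
  refine ⟨min 0 (Real.log c₀), min_le_left _ _, fun c hc => ?_⟩
  have hc0 : c ≠ 0 := by rintro rfl; exact hc seminorm_toReal_zero
  have h1 := one_le_norm_toReal hc0
  calc Real.exp (min 0 (Real.log c₀)) ≤ Real.exp (Real.log c₀) := Real.exp_le_exp.2 (min_le_right _ _)
    _ = c₀ := Real.exp_log hc₀
    _ ≤ c₀ * ‖toReal c‖ := by nlinarith
    _ ≤ _ := h _

lemma card_blockFinset_mono {S T : ℝ} (h : S ≤ T) : (blockFinset N S).card ≤ (blockFinset N T).card :=
  Finset.card_le_card fun c hc => by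
    rw [mem_blockFinset hN] at hc ⊢
    exact ⟨hc.1, hc.2.trans (Real.exp_le_exp.2 h)⟩

/-- The additional 1 is the zero vector, which `blockFinset` omits. -/
lemma count_eq_card_add_one (T : ℝ) :
    Measure.count {c : Fin n → ℤ | N (fun i => (0 : Fin n → ℝ) i + c i) ≤ Real.exp T} =
      ENNReal.ofReal ((blockFinset N T).card + 1) := by
  classical
  have : {c : Fin n → ℤ | N (fun i => (0 : Fin n → ℝ) i + c i) ≤ Real.exp T} =
      (insert 0 (blockFinset N T) : Finset (Fin n → ℤ)) := by
    ext c
    simp only [mem_ofPred_eq, Pi.zero_apply, zero_add, Finset.coe_insert, Set.mem_insert_iff,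
      Finset.mem_coe, mem_blockFinset hN]
    change N (toReal c) ≤ _ ↔ _
    constructor
    · intro h
      by_cases hc : N (toReal c) = 0
      · left
        have := hN _ hc
        ext i
        simpa [toReal] using congrFun this i
      · exact Or.inr ⟨hc, h⟩
    · rintro (rfl | h)
      · rw [seminorm_toReal_zero]; positivity
      · exact h.2
  rw [this, Measure.count_apply_finset, Finset.card_insert_of_notMem]
  · rw [ENNReal.ofReal_add (by positivity) zero_le_one]; simp
  · rw [mem_blockFinset hN]
    exact fun h => h.1 seminorm_toReal_zero

lemma exists_card_bounds (hn : 0 < n) : ∃ K : ℝ, 0 < K ∧ ∀ T : ℝ,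
    ((blockFinset N T).card : ℝ) + 1 ≤ ballVol N * (Real.exp T + K) ^ n ∧
    (K ≤ Real.exp T → ballVol N * (Real.exp T - K) ^ n ≤ (blockFinset N T).card + 1) := by
  obtain ⟨K, hK, h⟩ := exists_count_ball_bounds hN hn
  have hV := ballVol_pos hN
  refine ⟨K, hK, fun T => ⟨?_, fun hT => ?_⟩⟩
  · have := (h 0 (Real.exp T) (Real.exp_pos T).le).1
    rw [count_eq_card_add_one hN, ENNReal.ofReal_le_ofReal_iff (by positivity)] at this
    exact this
  · have := (h 0 (Real.exp T - K) (by linarith)).2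
    rw [sub_add_cancel, count_eq_card_add_one hN, ENNReal.ofReal_le_ofReal_iff (by positivity)] at this
    exact this

lemma tendsto_card_mul_exp (hn : 0 < n) :
    Tendsto (fun t => Real.exp (-(n * t)) * ((blockFinset N t).card : ℝ)) atTop (𝓝 (ballVol N)) := by
  obtain ⟨K, hK, h⟩ := exists_card_bounds hN hn
  have he : Tendsto (fun t : ℝ => Real.exp (-t)) atTop (𝓝 0) := Real.tendsto_exp_neg_atTop_nhds_zero
  have hlow : Tendsto (fun t : ℝ => ballVol N * (1 - K * Real.exp (-t)) ^ n - Real.exp (-t) ^ n) atTop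
      (𝓝 (ballVol N * (1 - K * 0) ^ n - 0 ^ n)) :=
    (((tendsto_const_nhds.sub (he.const_mul K)).pow n).const_mul _).sub (he.pow n)
  have hup : Tendsto (fun t : ℝ => ballVol N * (1 + K * Real.exp (-t)) ^ n) atTop
      (𝓝 (ballVol N * (1 + K * 0) ^ n)) :=
    ((tendsto_const_nhds.add (he.const_mul K)).pow n).const_mul _
  simp only [mul_zero, sub_zero, add_zero, one_pow, mul_one, zero_pow hn.ne'] at hlow hup
  have hexp (t : ℝ) : Real.exp (-(n * t)) = Real.exp (-t) ^ n := by
    rw [← Real.exp_nat_mul]; ring_nf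
  have hone (t : ℝ) : Real.exp (-t) * Real.exp t = 1 := by rw [← Real.exp_add]; simp
  refine tendsto_of_tendsto_of_tendsto_of_le_of_le' hlow hup ?_ ?_
  · filter_upwards [Real.tendsto_exp_atTop.eventually_ge_atTop K] with t ht
    have := (h t).2 ht
    rw [hexp]
    have h1 : ballVol N * (1 - K * Real.exp (-t)) ^ n =
        Real.exp (-t) ^ n * (ballVol N * (Real.exp t - K) ^ n) := by
      rw [mul_left_comm, ← mul_pow, mul_sub, hone, mul_comm K]
    rw [h1]
    have h2 : 0 ≤ Real.exp (-t) ^ n := by positivity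
    nlinarith
  · refine Eventually.of_forall fun t => ?_
    have := (h t).1
    rw [hexp]
    have h1 : ballVol N * (1 + K * Real.exp (-t)) ^ n =
        Real.exp (-t) ^ n * (ballVol N * (Real.exp t + K) ^ n) := by
      rw [mul_left_comm, ← mul_pow, mul_add, hone, mul_comm K]
    rw [h1]
    have h2 : 0 ≤ Real.exp (-t) ^ n := by positivity
    gcongr
    linarith

/-- Below t₀ there are no vectors, and above it the additive radius error is absorbed by the
exponential. Hence the bound is uniform in t, including negative t. -/
lemma exists_card_le (hn : 0 < n) : ∃ K : ℝ, 0 < K ∧ ∀ t : ℝ,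
    ((blockFinset N t).card : ℝ) ≤ K * Real.exp (n * t) := by
  obtain ⟨K, hK, h⟩ := exists_card_bounds hN hn
  obtain ⟨t₀, ht₀, hle⟩ := exists_exp_le_seminorm hN
  have hV := ballVol_pos hN
  refine ⟨ballVol N * (1 + K * Real.exp (-t₀)) ^ n, by positivity, fun t => ?_⟩
  by_cases ht : t < t₀
  · have : blockFinset N t = ∅ := by
      ext c
      simp only [mem_blockFinset hN, Finset.notMem_empty, iff_false, not_and, not_le]
      intro hc
      exact (Real.exp_lt_exp.2 ht).trans_le (hle c hc)
    rw [this]; simp; positivity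
  · push Not at ht
    have h1 : K ≤ K * Real.exp (-t₀) * Real.exp t := by
      rw [mul_assoc, ← Real.exp_add]
      have : 1 ≤ Real.exp (-t₀ + t) := Real.one_le_exp (by linarith)
      nlinarith
    calc ((blockFinset N t).card : ℝ) ≤ ballVol N * (Real.exp t + K) ^ n := by linarith [(h t).1]
      _ ≤ ballVol N * (Real.exp t + K * Real.exp (-t₀) * Real.exp t) ^ n := by gcongr
      _ = ballVol N * (1 + K * Real.exp (-t₀)) ^ n * Real.exp (n * t) := by
          rw [Real.exp_nat_mul, mul_assoc (ballVol N), ← mul_pow, add_mul, one_mul]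

lemma sum_blockFinset_eq {f f' : ℝ → ℝ} (hf : ∀ t, HasDerivAt f (f' t) t) (hf' : Continuous f') :
    ∃ t₀ ≤ 0, ∀ T : ℝ, ∑ c ∈ blockFinset N T, f (Real.log (N (toReal c))) =
      f T * (blockFinset N T).card - ∫ t in t₀..T, f' t * ((blockFinset N t).card : ℝ) := by
  obtain ⟨t₀, ht₀, hle⟩ := exists_exp_le_seminorm hN
  refine ⟨t₀, ht₀, fun T => ?_⟩
  have hpos (c : Fin n → ℤ) (hc : N (toReal c) ≠ 0) : 0 < N (toReal c) :=
    lt_of_le_of_ne (apply_nonneg _ _) hc.symm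
  have hempty (t : ℝ) (ht : t < t₀) : blockFinset N t = ∅ := by
    ext c
    simp only [mem_blockFinset hN, Finset.notMem_empty, iff_false, not_and, not_le]
    intro hc
    exact (Real.exp_lt_exp.2 ht).trans_le (hle c hc)
  by_cases hT : T < t₀
  · have h1 : ∫ t in t₀..T, f' t * ((blockFinset N t).card : ℝ) = 0 := by
      rw [intervalIntegral.integral_symm, intervalIntegral.integral_of_le hT.le,
        integral_Ioc_eq_integral_Ioo, setIntegral_congr_fun (g := fun _ => (0 : ℝ)) measurableSet_Ioo]
      · simp
      · intro t ht
        simp [hempty t ht.2]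
    rw [h1, hempty T hT]; simp
  push Not at hT
  have hmem {c : Fin n → ℤ} (hc : c ∈ blockFinset N T) := (mem_blockFinset hN).1 hc
  rw [sum_eq_sub_integral_card (t₀ := t₀) (T := T) _ _ (fun c hc => ?_) (fun c hc => ?_) hf hf']
  · congr 1
    refine intervalIntegral.integral_congr fun t ht => ?_
    rw [uIcc_of_le hT] at ht
    congr 3
    ext c
    simp only [Finset.mem_filter, mem_blockFinset hN]
    constructor
    · rintro ⟨⟨h1, h2⟩, h3⟩
      exact ⟨h1, (Real.log_le_iff_le_exp (hpos c h1)).1 h3⟩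
    · rintro ⟨h1, h2⟩
      exact ⟨⟨h1, h2.trans (Real.exp_le_exp.2 ht.2)⟩, (Real.log_le_iff_le_exp (hpos c h1)).2 h2⟩
  · rw [Real.le_log_iff_exp_le (hpos c (hmem hc).1)]; exact hle c (hmem hc).1
  · rw [Real.log_le_iff_le_exp (hpos c (hmem hc).1)]; exact (hmem hc).2

lemma intervalIntegrable_card {g : ℝ → ℝ} (hg : Continuous g) (a b : ℝ) :
    IntervalIntegrable (fun t => g t * ((blockFinset N t).card : ℝ)) volume a b := by
  have hmono : Monotone fun t => ((blockFinset N t).card : ℝ) := fun s t h =>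
    Nat.cast_le.2 (card_blockFinset_mono hN h)
  exact (hmono.intervalIntegrable).continuousOn_mul hg.continuousOn

omit hN in
lemma inv_pow_eq_exp {c : Fin n → ℤ} (hc : N (toReal c) ≠ 0) :
    (N (toReal c) ^ n)⁻¹ = Real.exp (-(n * Real.log (N (toReal c)))) := by
  have hpos : 0 < N (toReal c) := lt_of_le_of_ne (apply_nonneg _ _) hc.symm
  rw [Real.exp_neg, Real.exp_nat_mul, Real.exp_log hpos]

/-- Asymptotics of `∑ N(c)^{-n} (log N(c))^l` over integer vectors with `0 < N(c) ≤ e^T`. -/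
lemma tendsto_blockSum (hn : 0 < n) (l : ℕ) :
    Tendsto (fun T => (∑ c ∈ blockFinset N T, (N (toReal c) ^ n)⁻¹ * Real.log (N (toReal c)) ^ l) /
      T ^ (l + 1)) atTop (𝓝 (n * ballVol N / (l + 1))) := by
  -- The number of vectors of norm at most e^t is asymptotic to `ballVol N` times e^(nt). After Abel
  -- summation the boundary term has order T^l and is negligible, while the integrand is asymptotic
  -- to n `ballVol N` t^l.
  let f : ℝ → ℝ := fun t => Real.exp (-(n * t)) * t ^ l
  let f' : ℝ → ℝ := fun t => -((n * t ^ l - l * t ^ (l - 1)) * Real.exp (-(n * t)))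
  have hf (t : ℝ) : HasDerivAt f (f' t) t := by
    have h1 : HasDerivAt (fun t : ℝ => Real.exp (-(n * t))) (Real.exp (-(n * t)) * -(n * 1)) t :=
      ((hasDerivAt_id t).const_mul (n : ℝ)).neg.exp
    have := h1.mul (hasDerivAt_pow l t)
    convert! this using 1
    simp only [f']; ring
  have hf' : Continuous f' := by fun_prop
  obtain ⟨t₀, -, hsum⟩ := sum_blockFinset_eq hN hf hf'
  have heq (T : ℝ) : (∑ c ∈ blockFinset N T,
      (N (toReal c) ^ n)⁻¹ * Real.log (N (toReal c)) ^ l) / T ^ (l + 1) =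
      T ^ l * (Real.exp (-(n * T)) * (blockFinset N T).card) / T ^ (l + 1) +
      (∫ t in t₀..T, ((n * t ^ l - l * t ^ (l - 1)) * Real.exp (-(n * t))) *
        ((blockFinset N t).card : ℝ)) / T ^ (l + 1) := by
    rw [← add_div]
    congr 1
    rw [Finset.sum_congr rfl fun c hc => by
      rw [inv_pow_eq_exp ((mem_blockFinset hN).1 hc).1]]
    refine (hsum T).trans ?_
    simp only [f, f', neg_mul, intervalIntegral.integral_neg, sub_neg_eq_add]
    ring
  simp_rw [heq]
  have hcard := tendsto_card_mul_exp hN hn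
  rw [← zero_add ((n : ℝ) * ballVol N / (l + 1))]
  refine Tendsto.add ?_ ?_
  · have : Tendsto (fun T : ℝ => (Real.exp (-(n * T)) * (blockFinset N T).card) / T) atTop (𝓝 0) :=
      hcard.div_atTop tendsto_id
    refine this.congr' ?_
    filter_upwards [eventually_gt_atTop 0] with T hT
    rw [pow_succ, mul_div_mul_left _ _ (by positivity)]
  · refine tendsto_integral_div_pow (fun a b => intervalIntegrable_card hN (by fun_prop) a b) ?_
    have h1 : Tendsto (fun t : ℝ => ((n : ℝ) - l / t) *
        (Real.exp (-(n * t)) * (blockFinset N t).card)) atTop (𝓝 ((n - 0) * ballVol N)) :=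
      (tendsto_const_nhds.sub (tendsto_const_nhds.div_atTop tendsto_id)).mul hcard
    rw [sub_zero] at h1
    refine h1.congr' ?_
    filter_upwards [eventually_gt_atTop 0] with t ht
    rcases l with _ | l
    · simp; ring
    · simp only [Nat.add_sub_cancel]
      field_simp
      ring

/-- The sums of `N(c)^{-3n/2}` are bounded. -/
lemma exists_blockSum_rpow_le (hn : 0 < n) : ∃ K : ℝ, 0 < K ∧ ∀ T : ℝ,
    ∑ c ∈ blockFinset N T, (N (toReal c) ^ n)⁻¹ * √((N (toReal c) ^ n)⁻¹) ≤ K := by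
  obtain ⟨K, hK, hcard⟩ := exists_card_le hN hn
  have hn0 : (0 : ℝ) < n := by exact_mod_cast hn
  let f : ℝ → ℝ := fun t => Real.exp (-(3 / 2 * n * t))
  let f' : ℝ → ℝ := fun t => Real.exp (-(3 / 2 * n * t)) * -(3 / 2 * n)
  have hf (t : ℝ) : HasDerivAt f (f' t) t := by
    have h1 := ((hasDerivAt_id t).const_mul (3 / 2 * (n : ℝ))).neg.exp
    simpa [f, f'] using h1
  have hf' : Continuous f' := by fun_prop
  obtain ⟨t₀, ht₀, hsum⟩ := sum_blockFinset_eq hN hf hf'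
  -- For T ≥ 0 the boundary term is at most K. The integral of (3/2) n K e^(-nt/2) from t₀ onwards
  -- is the second summand.
  refine ⟨K + 3 * K * Real.exp (-(n / 2 * t₀)), by positivity, ?_⟩
  suffices hmain : ∀ T : ℝ, 0 ≤ T →
      ∑ c ∈ blockFinset N T, (N (toReal c) ^ n)⁻¹ * √((N (toReal c) ^ n)⁻¹) ≤
        K + 3 * K * Real.exp (-(n / 2 * t₀)) by
    intro T
    refine le_trans (Finset.sum_le_sum_of_subset_of_nonneg (t := blockFinset N (max T 0))
      (fun c hc => ?_) fun c _ _ => ?_) (hmain _ (le_max_right _ _))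
    · rw [mem_blockFinset hN] at hc ⊢
      exact ⟨hc.1, hc.2.trans (Real.exp_le_exp.2 (le_max_left _ _))⟩
    · have := apply_nonneg N (toReal c)
      positivity
  intro T hT
  have heq : ∑ c ∈ blockFinset N T, (N (toReal c) ^ n)⁻¹ * √((N (toReal c) ^ n)⁻¹) =
      ∑ c ∈ blockFinset N T, f (Real.log (N (toReal c))) := by
    refine Finset.sum_congr rfl fun c hc => ?_
    rw [inv_pow_eq_exp ((mem_blockFinset hN).1 hc).1, ← Real.exp_half, ← Real.exp_add]
    simp only [f]; ring_nf
  rw [heq]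
  rw [hsum T]
  have h1 : f T * (blockFinset N T).card ≤ K := by
    calc f T * (blockFinset N T).card ≤ f T * (K * Real.exp (n * T)) := by
          gcongr
          exact hcard T
      _ = K * Real.exp (-(n / 2 * T)) := by
          simp only [f]; rw [mul_left_comm, ← Real.exp_add]; ring_nf
      _ ≤ K * 1 := by
          gcongr
          rw [Real.exp_le_one_iff]
          have : 0 ≤ n / 2 * T := by positivity
          linarith
      _ = K := mul_one K
  have h2 : -∫ t in t₀..T, f' t * ((blockFinset N t).card : ℝ) ≤
      3 * K * Real.exp (-(n / 2 * t₀)) := by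
    rw [← intervalIntegral.integral_neg]
    have hle : ∫ t in t₀..T, -(f' t * ((blockFinset N t).card : ℝ)) ≤
        ∫ t in t₀..T, (3 / 2 * n * K) * Real.exp (-(n / 2) * t) := by
      refine intervalIntegral.integral_mono_on (ht₀.trans hT)
        (intervalIntegrable_card hN hf' _ _).neg
        (Continuous.intervalIntegrable (by fun_prop) _ _) fun t _ => ?_
      have := hcard t
      calc -(f' t * ((blockFinset N t).card : ℝ)) = (3 / 2 * n) * Real.exp (-(3 / 2 * n * t)) *
            ((blockFinset N t).card : ℝ) := by simp only [f']; ring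
        _ ≤ (3 / 2 * n) * Real.exp (-(3 / 2 * n * t)) * (K * Real.exp (n * t)) := by gcongr
        _ = (3 / 2 * n * K) * (Real.exp (-(3 / 2 * n * t)) * Real.exp (n * t)) := by ring
        _ = _ := by rw [← Real.exp_add]; ring_nf
    refine hle.trans ?_
    have hFTC : ∫ t in t₀..T, (3 / 2 * n * K) * Real.exp (-(n / 2) * t) =
        -(3 * K) * Real.exp (-(n / 2) * T) - -(3 * K) * Real.exp (-(n / 2) * t₀) := by
      refine intervalIntegral.integral_eq_sub_of_hasDerivAt
        (f := fun t => -(3 * K) * Real.exp (-(n / 2) * t)) (fun t _ => ?_)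
        (Continuous.intervalIntegrable (by fun_prop) _ _)
      have := ((hasDerivAt_id t).const_mul (-((n : ℝ) / 2))).exp.const_mul (-(3 * K))
      convert! this using 1
      simp only [id]; ring
    rw [hFTC, show -((n : ℝ) / 2 * t₀) = -(n / 2) * t₀ by ring]
    have : 0 < Real.exp (-(n / 2) * T) := Real.exp_pos _
    nlinarith
  linarith

end BlockSums

/-! ### Transferring asymptotics from terms to sums. -/

section Asymptotics

lemma exists_le_mul_pow_of_tendsto {f : ℝ → ℝ} (hf : Monotone f) {e : ℕ} {A : ℝ}
    (h : Tendsto (fun T => f T / T ^ e) atTop (𝓝 A)) :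
    ∃ K : ℝ, 0 < K ∧ ∀ T, 1 ≤ T → f T ≤ K * T ^ e := by
  obtain ⟨T₁, hT₁⟩ := eventually_atTop.1 (h.eventually_lt_const (lt_add_one A))
  set T₂ := max T₁ 1
  refine ⟨|A + 1| + |f T₂| + 1, by positivity, fun T hT => ?_⟩
  have hp : 1 ≤ T ^ e := one_le_pow₀ hT
  rcases le_total T T₂ with h1 | h1
  · have h2 := hf h1
    have h3 := le_abs_self (f T₂)
    have h4 := abs_nonneg (A + 1)
    have h5 := abs_nonneg (f T₂)
    nlinarith
  · have h2 := (hT₁ T ((le_max_left _ _).trans h1)).le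
    rw [div_le_iff₀ (by positivity)] at h2
    have h3 := le_abs_self (A + 1)
    have h5 := abs_nonneg (f T₂)
    nlinarith

/-- For each δ the terms differ by at most δ u outside a finite set. The finite set contributes a
constant, killed by T^e, and the rest at most δ times the total weight O(T^e). -/
lemma tendsto_sum_sub_div {X : Type} (F : ℝ → Finset X) (g h u : X → ℝ) (K : ℝ)
    {e : ℕ} (he : 0 < e) (hu : ∀ T, 1 ≤ T → ∑ q ∈ F T, u q ≤ K * T ^ e) (hu0 : ∀ q, 0 ≤ u q)
    (hgh : ∀ δ > 0, {q | (∃ T, q ∈ F T) ∧ ¬ |g q - h q| ≤ δ * u q}.Finite) :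
    Tendsto (fun T => (∑ q ∈ F T, (g q - h q)) / T ^ e) atTop (𝓝 0) := by
  classical
  have hK : 0 ≤ K := by
    have := hu 1 le_rfl
    have h0 := Finset.sum_nonneg fun q (_ : q ∈ F 1) => hu0 q
    simp at this; linarith
  rw [Metric.tendsto_atTop]
  intro ε hε
  set δ := ε / (2 * (K + 1)) with hδ
  have hδ0 : 0 < δ := by positivity
  have hfin := hgh δ hδ0
  set S := hfin.toFinset
  set C := ∑ q ∈ S, |g q - h q|
  have hlim : Tendsto (fun T : ℝ => C / T ^ e) atTop (𝓝 0) :=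
    tendsto_const_nhds.div_atTop (tendsto_pow_atTop he.ne')
  obtain ⟨T₁, hT₁⟩ := Metric.tendsto_atTop.1 hlim (ε / 2) (by positivity)
  refine ⟨max T₁ 1, fun T hT => ?_⟩
  have hT1 : 1 ≤ T := (le_max_right _ _).trans hT
  have hp : 0 < T ^ e := by positivity
  have h1 := hT₁ T ((le_max_left _ _).trans hT)
  rw [Real.dist_eq, sub_zero, abs_lt, div_lt_iff₀ hp] at h1
  rw [Real.dist_eq, sub_zero, abs_div, abs_of_pos hp, div_lt_iff₀ hp]
  have hbound : |∑ q ∈ F T, (g q - h q)| ≤ C + δ * (K * T ^ e) := by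
    calc |∑ q ∈ F T, (g q - h q)| ≤ ∑ q ∈ F T, |g q - h q| := Finset.abs_sum_le_sum_abs _ _
      _ ≤ ∑ q ∈ F T, ((if q ∈ S then |g q - h q| else 0) + δ * u q) := by
          refine Finset.sum_le_sum fun q hq => ?_
          by_cases hqS : q ∈ S
          · simp only [hqS, if_true]
            have := mul_nonneg hδ0.le (hu0 q)
            linarith
          · simp only [hqS, if_false, zero_add]
            by_contra hcon
            exact hqS (hfin.mem_toFinset.2 ⟨⟨T, hq⟩, hcon⟩)
      _ ≤ C + δ * (K * T ^ e) := by
          rw [Finset.sum_add_distrib, ← Finset.mul_sum, ← Finset.sum_filter]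
          gcongr
          · refine Finset.sum_le_sum_of_subset_of_nonneg (fun q hq => ?_) fun _ _ _ => abs_nonneg _
            exact (Finset.mem_filter.1 hq).2
          · exact hu T hT1
  have h2 : δ * (K * T ^ e) ≤ ε / 2 * T ^ e := by
    have : δ * K ≤ ε / 2 := by
      rw [hδ, div_mul_eq_mul_div, div_le_iff₀ (by positivity)]
      nlinarith
    rw [← mul_assoc]
    gcongr
  linarith [h1.2]

end Asymptotics

/-! ### Sums over denominators q with all blocks nonzero. -/

section QSums

variable {r : ℕ} {n : Fin r → ℕ} (NN : (j : Fin r) → Seminorm ℝ (Fin (n j) → ℝ))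

/-- The product of the norms of the blocks of `q`, raised to the block dimensions. -/
noncomputable def qProd (q : BlockIndex n → ℤ) : ℝ :=
  ∏ j, NN j (blockProj j (toReal q)) ^ n j

/-- The integer vectors all of whose blocks have norm in `(0, e^T]`. -/
noncomputable def qFinset (T : ℝ) : Finset (BlockIndex n → ℤ) :=
  (Fintype.piFinset fun j => blockFinset (NN j) T).map
    (Equiv.piCurry fun (j : Fin r) (_ : Fin (n j)) => ℤ).symm.toEmbedding

lemma sum_qFinset_prod (T : ℝ) (f : (j : Fin r) → (Fin (n j) → ℤ) → ℝ) :
    ∑ q ∈ qFinset NN T, ∏ j, f j (fun a => q ⟨j, a⟩) = ∏ j, ∑ c ∈ blockFinset (NN j) T, f j c := by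
  rw [qFinset, Finset.sum_map, Finset.prod_univ_sum]
  rfl

variable {NN} (hNN : ∀ j y, NN j y = 0 → y = 0)
include hNN

lemma mem_qFinset {T : ℝ} {q : BlockIndex n → ℤ} :
    q ∈ qFinset NN T ↔ ∀ j, NN j (blockProj j (toReal q)) ≠ 0 ∧
      NN j (blockProj j (toReal q)) ≤ Real.exp T := by
  rw [qFinset, Finset.mem_map_equiv]
  simp only [Fintype.mem_piFinset, mem_blockFinset (hNN _)]
  rfl

lemma qFinset_mono : Monotone (qFinset NN) := fun S T h q hq => by
  rw [mem_qFinset hNN] at hq ⊢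
  exact fun j => ⟨(hq j).1, (hq j).2.trans (Real.exp_le_exp.2 h)⟩

lemma block_pos {T : ℝ} {q : BlockIndex n → ℤ} (hq : q ∈ qFinset NN T) (j : Fin r) :
    0 < NN j (blockProj j (toReal q)) :=
  lt_of_le_of_ne (apply_nonneg _ _) ((mem_qFinset hNN).1 hq j).1.symm

lemma qProd_pos {T : ℝ} {q : BlockIndex n → ℤ} (hq : q ∈ qFinset NN T) : 0 < qProd NN q :=
  Finset.prod_pos fun j _ => pow_pos (block_pos hNN hq j) _

lemma log_qProd {T : ℝ} {q : BlockIndex n → ℤ} (hq : q ∈ qFinset NN T) :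
    Real.log (qProd NN q) = ∑ j, n j * Real.log (NN j (blockProj j (toReal q))) := by
  rw [qProd, Real.log_prod fun j _ => (pow_pos (block_pos hNN hq j) _).ne']
  simp_rw [Real.log_pow]

lemma exists_abs_log_le : ∃ K : ℝ, 0 < K ∧ ∀ T, 1 ≤ T → ∀ q ∈ qFinset NN T, ∀ j,
    |Real.log (NN j (blockProj j (toReal q)))| ≤ K * T := by
  choose t₀ ht₀ hle using fun j => exists_exp_le_seminorm (hNN j)
  refine ⟨1 + ∑ j, -t₀ j, ?_, fun T hT q hq j => ?_⟩
  · have := Finset.sum_nonneg fun j (_ : j ∈ Finset.univ) => neg_nonneg.2 (ht₀ j)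
    linarith
  · have h0 := Finset.sum_nonneg fun j (_ : j ∈ Finset.univ) => neg_nonneg.2 (ht₀ j)
    have h1 := Finset.single_le_sum (f := fun j => -t₀ j) (fun j _ => neg_nonneg.2 (ht₀ j))
      (Finset.mem_univ j)
    have hp := block_pos hNN hq j
    have h2 : t₀ j ≤ Real.log (NN j (blockProj j (toReal q))) := by
      rw [Real.le_log_iff_exp_le hp]
      exact hle j (fun a => q ⟨j, a⟩) hp.ne'
    have h3 : Real.log (NN j (blockProj j (toReal q))) ≤ T := by
      rw [Real.log_le_iff_le_exp hp]
      exact ((mem_qFinset hNN).1 hq j).2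
    rw [abs_le]
    constructor <;> nlinarith

lemma exists_abs_log_qProd_le : ∃ K : ℝ, 0 < K ∧ ∀ T, 1 ≤ T → ∀ q ∈ qFinset NN T,
    |Real.log (qProd NN q)| ≤ K * T := by
  obtain ⟨K, hK, h⟩ := exists_abs_log_le hNN
  refine ⟨(∑ j, (n j : ℝ)) * K + 1, by positivity, fun T hT q hq => ?_⟩
  rw [log_qProd hNN hq]
  calc |∑ j, n j * Real.log (NN j (blockProj j (toReal q)))|
      ≤ ∑ j, |n j * Real.log (NN j (blockProj j (toReal q)))| := Finset.abs_sum_le_sum_abs _ _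
    _ ≤ ∑ j, (n j : ℝ) * (K * T) := by
        refine Finset.sum_le_sum fun j _ => ?_
        rw [abs_mul, abs_of_nonneg (Nat.cast_nonneg _)]
        gcongr
        exact h T hT q hq j
    _ = (∑ j, (n j : ℝ)) * K * T := by rw [← Finset.sum_mul, mul_assoc]
    _ ≤ _ := by nlinarith

/-- Only finitely many integer vectors with nonzero blocks have bounded norm product. -/
lemma finite_qProd_le (hn : ∀ j, 0 < n j) (B : ℝ) :
    {q | (∃ T, q ∈ qFinset NN T) ∧ Real.log (qProd NN q) ≤ B}.Finite := by
  choose t₀ ht₀ hle using fun j => exists_exp_le_seminorm (hNN j)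
  -- Each block has logarithmic norm at least t₀ j, so an upper bound B on the weighted sum of all
  -- of them bounds each one by S.
  set S := |B| + ∑ j, (n j : ℝ) * -t₀ j
  refine (qFinset NN S).finite_toSet.subset fun q hq => ?_
  obtain ⟨⟨T, hT⟩, hB⟩ := hq
  rw [Finset.mem_coe, mem_qFinset hNN]
  intro j
  have hp := block_pos hNN hT
  refine ⟨(hp j).ne', ?_⟩
  rw [← Real.log_le_iff_le_exp (hp j)]
  have hlow (i) : t₀ i ≤ Real.log (NN i (blockProj i (toReal q))) := by
    rw [Real.le_log_iff_exp_le (hp i)]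
    exact hle i (fun a => q ⟨i, a⟩) (hp i).ne'
  rw [log_qProd hNN hT] at hB
  have h1 : ∑ i, (n i : ℝ) * (Real.log (NN i (blockProj i (toReal q))) - t₀ i) ≤ S := by
    simp only [mul_sub, Finset.sum_sub_distrib]
    simp only [S, mul_neg, Finset.sum_neg_distrib]
    linarith [le_abs_self B]
  have h2 := Finset.single_le_sum
    (f := fun i => (n i : ℝ) * (Real.log (NN i (blockProj i (toReal q))) - t₀ i))
    (fun i _ => mul_nonneg (Nat.cast_nonneg _) (sub_nonneg.2 (hlow i))) (Finset.mem_univ j)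
  have h3 : (1 : ℝ) ≤ n j := by exact_mod_cast hn j
  have h4 := ht₀ j
  have h5 := hlow j
  nlinarith

/-- Asymptotics of `∑ P(q)^{-1} (log P(q))^e`. -/
lemma tendsto_qSum (hn : ∀ j, 0 < n j) (e : ℕ) :
    Tendsto (fun T => (∑ q ∈ qFinset NN T, (qProd NN q)⁻¹ * Real.log (qProd NN q) ^ e) / T ^ (e + r))
      atTop (𝓝 (∑ l ∈ Finset.piAntidiag Finset.univ e, (Nat.multinomial Finset.univ l : ℝ) *
        ∏ j, ((n j : ℝ) ^ l j * (n j * ballVol (NN j) / (l j + 1))))) := by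
  have heq (T : ℝ) : (∑ q ∈ qFinset NN T, (qProd NN q)⁻¹ * Real.log (qProd NN q) ^ e) / T ^ (e + r) =
      ∑ l ∈ Finset.piAntidiag Finset.univ e, (Nat.multinomial Finset.univ l : ℝ) *
        ∏ j, ((n j : ℝ) ^ l j * ((∑ c ∈ blockFinset (NN j) T,
          (NN j (toReal c) ^ n j)⁻¹ * Real.log (NN j (toReal c)) ^ l j) / T ^ (l j + 1))) := by
    -- The logarithm of the product is a sum over blocks, so the multinomial theorem makes each term
    -- a product over blocks. The sum over q then factors, and T^(e+r) splits accordingly as the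
    -- product of the T^(l j + 1).
    have h1 (q) (hq : q ∈ qFinset NN T) : (qProd NN q)⁻¹ * Real.log (qProd NN q) ^ e =
        ∑ l ∈ Finset.piAntidiag Finset.univ e, (Nat.multinomial Finset.univ l : ℝ) *
          ∏ j, ((n j : ℝ) ^ l j * ((NN j (toReal fun a => q ⟨j, a⟩) ^ n j)⁻¹ *
            Real.log (NN j (toReal fun a => q ⟨j, a⟩)) ^ l j)) := by
      rw [log_qProd hNN hq, Finset.sum_pow_eq_sum_piAntidiag, Finset.mul_sum]
      refine Finset.sum_congr rfl fun l _ => ?_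
      rw [mul_left_comm, qProd, ← Finset.prod_inv_distrib, ← Finset.prod_mul_distrib]
      congr 1
      refine Finset.prod_congr rfl fun j _ => ?_
      rw [mul_pow, mul_left_comm]
      rfl
    rw [Finset.sum_congr rfl h1, Finset.sum_comm, Finset.sum_div]
    refine Finset.sum_congr rfl fun l hl => ?_
    rw [← Finset.mul_sum, mul_div_assoc]
    congr 1
    rw [sum_qFinset_prod NN T (fun j c => (n j : ℝ) ^ l j * ((NN j (toReal c) ^ n j)⁻¹ *
            Real.log (NN j (toReal c)) ^ l j))]
    have hT : T ^ (e + r) = ∏ j, T ^ (l j + 1) := by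
      rw [Finset.prod_pow_eq_pow_sum, Finset.sum_add_distrib, (Finset.mem_piAntidiag.1 hl).1]
      simp
    rw [hT, ← Finset.prod_div_distrib]
    refine Finset.prod_congr rfl fun j _ => ?_
    rw [← Finset.mul_sum, mul_div_assoc]
  simp_rw [heq]
  refine tendsto_finsetSum _ fun l _ => Tendsto.const_mul _ ?_
  exact tendsto_finsetProd _ fun j _ => (tendsto_blockSum (hNN j) (hn j) (l j)).const_mul _

lemma exists_qSum_inv_le (hn : ∀ j, 0 < n j) : ∃ K : ℝ, 0 < K ∧ ∀ T, 1 ≤ T →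
    ∑ q ∈ qFinset NN T, (qProd NN q)⁻¹ ≤ K * T ^ r := by
  have h := tendsto_qSum hNN hn 0
  simp only [pow_zero, mul_one, zero_add] at h
  refine exists_le_mul_pow_of_tendsto (fun S T hST => ?_) h
  exact Finset.sum_le_sum_of_subset_of_nonneg (qFinset_mono hNN hST) fun q hq _ =>
    inv_nonneg.2 (qProd_pos hNN hq).le

end QSums

/-! ### Identification of the constant `cConst`. -/

section Constant

/-- After the multinomial expansion the sum over x factors by coordinates. A coordinate with
exponent 0 gives 1 - 1 = 0, and any other keeps only its x = 1 term. -/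
lemma cConst_eq {r : ℕ} (κ : ℕ) (n : Fin r → ℕ) :
    cConst κ n = ∑ l ∈ Finset.piAntidiag Finset.univ κ, (Nat.multinomial Finset.univ l : ℝ) *
      ∏ j, (if l j = 0 then 0 else (n j : ℝ) ^ l j) := by
  have h1 (x : Fin r → Fin 2) : (-1 : ℝ) ^ (r - ∑ j, (x j : ℕ)) *
      (∑ j, (n j : ℝ) * ((x j : ℕ) : ℝ)) ^ κ =
      ∑ l ∈ Finset.piAntidiag Finset.univ κ, (Nat.multinomial Finset.univ l : ℝ) *
        ∏ j, ((-1 : ℝ) ^ (1 - (x j : ℕ)) * ((n j : ℝ) * ((x j : ℕ) : ℝ)) ^ l j) := by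
    have h2 : (-1 : ℝ) ^ (r - ∑ j, (x j : ℕ)) = ∏ j, (-1 : ℝ) ^ (1 - (x j : ℕ)) := by
      rw [Finset.prod_pow_eq_pow_sum]
      congr 1
      have h3 : ∑ j, (1 - (x j : ℕ)) + ∑ j, (x j : ℕ) = r := by
        rw [← Finset.sum_add_distrib, Finset.sum_congr rfl fun j _ =>
          Nat.sub_add_cancel (by omega : (x j : ℕ) ≤ 1)]
        simp
      omega
    rw [h2, Finset.sum_pow_eq_sum_piAntidiag, Finset.mul_sum]
    refine Finset.sum_congr rfl fun l _ => ?_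
    rw [mul_left_comm, ← Finset.prod_mul_distrib]
  rw [cConst, Finset.sum_congr rfl fun x _ => h1 x, Finset.sum_comm]
  refine Finset.sum_congr rfl fun l _ => ?_
  rw [← Finset.mul_sum]
  congr 1
  have h4 := Finset.prod_univ_sum (fun _ : Fin r => (Finset.univ : Finset (Fin 2)))
    (fun j x => (-1 : ℝ) ^ (1 - (x : ℕ)) * ((n j : ℝ) * ((x : ℕ) : ℝ)) ^ l j)
  rw [Fintype.piFinset_univ] at h4
  rw [← h4]
  refine Finset.prod_congr rfl fun j _ => ?_
  rw [Fin.sum_univ_two]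
  by_cases h : l j = 0 <;> simp [h]

/-- Raising every exponent by one maps the compositions of e onto the compositions of e + r with
positive parts. The factors 1/(l j + 1) convert the factorials l j ! into (l j + 1)!, leaving the
ratio e!/(e+r)!. -/
lemma sum_piAntidiag_eq_cConst {r : ℕ} (e : ℕ) (n : Fin r → ℕ) (V : Fin r → ℝ) :
    ∑ l ∈ Finset.piAntidiag Finset.univ e, (Nat.multinomial Finset.univ l : ℝ) *
        ∏ j, ((n j : ℝ) ^ l j * (n j * V j / (l j + 1))) =
      e.factorial / (e + r).factorial * (∏ j, V j) * cConst (e + r) n := by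
  have hfilter := Finset.sum_filter_of_ne (s := Finset.piAntidiag Finset.univ (e + r))
    (f := fun l : Fin r → ℕ => (Nat.multinomial Finset.univ l : ℝ) *
      ∏ j, (if l j = 0 then 0 else (n j : ℝ) ^ l j)) (p := fun l => ∀ j, l j ≠ 0) ?_
  · rw [cConst_eq, ← hfilter, Finset.mul_sum]
    symm
    refine Finset.sum_nbij' (fun l j => l j - 1) (fun l j => l j + 1) ?_ ?_ ?_ ?_ ?_
    · intro l hl
      simp only [Finset.mem_filter, Finset.mem_piAntidiag] at hl ⊢
      refine ⟨?_, by simp⟩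
      have h3 : ∑ j, (l j - 1) + r = ∑ j, l j := by
        conv_rhs => rw [← Finset.sum_congr rfl fun j _ =>
          Nat.sub_add_cancel (Nat.one_le_iff_ne_zero.2 (hl.2 j))]
        rw [Finset.sum_add_distrib]; simp
      have h4 : ∑ j, l j = e + r := hl.1.1
      change ∑ j, (l j - 1) = e
      omega
    · intro l hl
      simp only [Finset.mem_filter, Finset.mem_piAntidiag] at hl ⊢
      refine ⟨⟨?_, by simp⟩, by simp⟩
      rw [Finset.sum_add_distrib, hl.1]; simp
    · intro l hl
      simp only [Finset.mem_filter] at hl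
      ext j
      have := hl.2 j
      change l j - 1 + 1 = l j
      omega
    · intro l _
      ext j; simp
    · intro l hl
      simp only [Finset.mem_filter, Finset.mem_piAntidiag] at hl
      obtain ⟨⟨hsum, -⟩, hne⟩ := hl
      obtain ⟨l', rfl⟩ : ∃ l' : Fin r → ℕ, l = fun j => l' j + 1 :=
        ⟨fun j => l j - 1, by ext j; have := hne j; simp only; omega⟩
      have hsum' : ∑ j, l' j = e := by
        rw [Finset.sum_add_distrib] at hsum; simp at hsum; omega
      have hm1 : (Nat.multinomial Finset.univ (fun j => l' j + 1) : ℝ) =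
          (e + r).factorial / ∏ j, ((l' j + 1).factorial : ℝ) := by
        rw [eq_div_iff (by positivity), ← hsum, mul_comm]
        exact_mod_cast Nat.multinomial_spec (Finset.univ) (fun j => l' j + 1)
      have hm2 : (Nat.multinomial Finset.univ l' : ℝ) =
          e.factorial / ∏ j, ((l' j).factorial : ℝ) := by
        rw [eq_div_iff (by positivity), ← hsum', mul_comm]
        exact_mod_cast Nat.multinomial_spec (Finset.univ) l'
      simp only [Nat.add_sub_cancel]
      rw [hm1, hm2]
      simp only [Nat.add_eq_zero_iff, one_ne_zero, and_false, if_false]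
      have hprod : ∏ j, ((n j : ℝ) ^ l' j * (n j * V j / (l' j + 1))) =
          (∏ j, V j) * (∏ j, (n j : ℝ) ^ (l' j + 1)) / ∏ j, ((l' j : ℝ) + 1) := by
        rw [← Finset.prod_mul_distrib, ← Finset.prod_div_distrib]
        refine Finset.prod_congr rfl fun j _ => ?_
        ring
      have hfac : ∏ j, ((l' j + 1).factorial : ℝ) =
          (∏ j, ((l' j : ℝ) + 1)) * ∏ j, ((l' j).factorial : ℝ) := by
        rw [← Finset.prod_mul_distrib]
        refine Finset.prod_congr rfl fun j _ => ?_
        rw [Nat.factorial_succ]; push_cast; ring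
      rw [hprod, hfac]
      have h1 : ∏ j, ((l' j : ℝ) + 1) ≠ 0 := Finset.prod_ne_zero_iff.2 fun j _ => by positivity
      have h2 : ∏ j, ((l' j).factorial : ℝ) ≠ 0 := Finset.prod_ne_zero_iff.2 fun j _ => by positivity
      field_simp
  · intro l _ hne j hj
    apply hne
    rw [Finset.prod_eq_zero (Finset.mem_univ j) (by simp [hj]), mul_zero]

end Constant

/-! ### Asymptotics of the expected count. -/

section FirstMoment

lemma hypVol_nonneg (k : ℕ) {L δ : ℝ} (hL : 0 ≤ L) (hδ : 0 < δ) : 0 ≤ hypVol k L δ := by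
  unfold hypVol
  split_ifs with h
  · exact hL
  · push Not at h
    have : 0 ≤ Real.log (L / δ) := Real.log_nonneg (by rw [le_div_iff₀ hδ]; linarith)
    positivity

/-- With parameter δ e^(-t) the logarithm is t + log(L/δ), so for large t the normalized volume is a
polynomial in t and only its top term survives division by t^k. -/
lemma tendsto_hypVol (k : ℕ) {L δ : ℝ} (hL : 0 < L) (hδ : 0 < δ) :
    Tendsto (fun t => hypVol (k + 1) L (δ * Real.exp (-t)) * Real.exp t / t ^ k) atTop
      (𝓝 (δ / k.factorial)) := by
  set c := Real.log (L / δ)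
  have hterm (l : ℕ) : Tendsto (fun t : ℝ => (t + c) ^ l / t ^ l) atTop (𝓝 1) := by
    have h1 : Tendsto (fun t : ℝ => (1 + c / t) ^ l) atTop (𝓝 ((1 + 0) ^ l)) :=
      (tendsto_const_nhds.add (tendsto_const_nhds.div_atTop tendsto_id)).pow l
    rw [add_zero, one_pow] at h1
    refine h1.congr' ?_
    filter_upwards [eventually_gt_atTop 0] with t ht
    rw [← div_pow, add_div, div_self ht.ne']
  have hlow (l : ℕ) (hl : l < k) : Tendsto (fun t : ℝ => (t + c) ^ l / l.factorial / t ^ k) atTop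
      (𝓝 0) := by
    have h1 : Tendsto (fun t : ℝ => (t + c) ^ l / t ^ l / l.factorial / t ^ (k - l)) atTop (𝓝 0) :=
      ((hterm l).div_const _).div_atTop (tendsto_pow_atTop (Nat.sub_ne_zero_of_lt hl))
    refine h1.congr' ?_
    filter_upwards [eventually_gt_atTop 0] with t ht
    have : t ^ k = t ^ l * t ^ (k - l) := by rw [← pow_add]; congr 1; omega
    rw [this]
    field_simp
  have hsum : Tendsto (fun t : ℝ => δ * (∑ l ∈ Finset.range k, (t + c) ^ l / l.factorial / t ^ k +
      (t + c) ^ k / t ^ k / k.factorial)) atTop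
      (𝓝 (δ * (∑ l ∈ Finset.range k, 0 + 1 / k.factorial))) :=
    ((tendsto_finsetSum _ fun l hl => hlow l (Finset.mem_range.1 hl)).add
      ((hterm k).div_const _)).const_mul _
  rw [Finset.sum_const_zero, zero_add, mul_one_div] at hsum
  refine hsum.congr' ?_
  filter_upwards [eventually_gt_atTop 0, eventually_gt_atTop (-c)] with t ht htc
  have hlog : Real.log (L / (δ * Real.exp (-t))) = t + c := by
    rw [← div_div, Real.log_div (by positivity) (by positivity), Real.log_exp]
    simp only [c]; ring
  have hnot : ¬ L ≤ δ * Real.exp (-t) := by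
    intro h
    have : Real.log (L / (δ * Real.exp (-t))) ≤ 0 :=
      Real.log_nonpos (by positivity) (by rw [div_le_one (by positivity)]; exact h)
    rw [hlog] at this
    linarith
  have hee : Real.exp (-t) * Real.exp t = 1 := by rw [← Real.exp_add]; simp
  rw [hypVol, if_neg hnot, hlog, Finset.sum_range_succ, mul_right_comm, mul_assoc δ, hee, mul_one,
    mul_div_assoc, add_div, Finset.sum_div, div_right_comm]

/-- If the box is small its volume is itself at most δ/P; otherwise log(LP/δ) = O(T) bounds every
term of the sum. The bound is uniform in P, as needed for error sums over q. -/
lemma exists_hypVol_le (k : ℕ) {L δ : ℝ} (hL : 0 < L) (hδ : 0 < δ) (B : ℝ) :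
    ∃ K : ℝ, 0 < K ∧ ∀ T, 1 ≤ T → ∀ P, 0 < P → Real.log P ≤ B * T →
      hypVol (k + 1) L (δ / P) ≤ K * T ^ k / P := by
  set c := |Real.log (L / δ)| + |B| + 1 with hc
  have hc1 : 1 ≤ c := by
    have := abs_nonneg (Real.log (L / δ)); have := abs_nonneg B; linarith
  refine ⟨δ * ((k + 1) * c ^ k), by positivity, fun T hT P hP hPB => ?_⟩
  have hT0 : 0 < T := by linarith
  have hone : 1 ≤ (k + 1) * c ^ k * T ^ k := by
    have h1 : 1 ≤ c ^ k := one_le_pow₀ hc1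
    have h2 : 1 ≤ T ^ k := one_le_pow₀ hT
    have h3 : (1 : ℝ) ≤ k + 1 := by linarith [(Nat.cast_nonneg k : (0 : ℝ) ≤ k)]
    exact one_le_mul_of_one_le_of_one_le (one_le_mul_of_one_le_of_one_le h3 h1) h2
  rw [hypVol]
  split_ifs with h
  · refine h.trans ?_
    gcongr
    nlinarith
  · push Not at h
    rw [mul_assoc δ, ← div_mul_eq_mul_div]
    gcongr
    have hlog0 : 0 ≤ Real.log (L / (δ / P)) :=
      Real.log_nonneg (by rw [le_div_iff₀ (by positivity)]; linarith)
    have hlog : Real.log (L / (δ / P)) ≤ c * T := by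
      rw [div_div_eq_mul_div, mul_div_right_comm, Real.log_mul (by positivity) hP.ne']
      have h1 := le_abs_self (Real.log (L / δ))
      have h2 := le_abs_self B
      have h3 := abs_nonneg (Real.log (L / δ))
      have h4 : B * T ≤ |B| * T := by gcongr
      rw [hc]
      nlinarith
    have hcT : 1 ≤ c * T := one_le_mul_of_one_le_of_one_le hc1 hT
    calc ∑ l ∈ Finset.range (k + 1), Real.log (L / (δ / P)) ^ l / l.factorial
        ≤ ∑ l ∈ Finset.range (k + 1), (c * T) ^ k := by
          refine Finset.sum_le_sum fun l hl => ?_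
          have hlk : l ≤ k := by rw [Finset.mem_range] at hl; omega
          calc Real.log (L / (δ / P)) ^ l / l.factorial ≤ Real.log (L / (δ / P)) ^ l :=
                div_le_self (by positivity) (by exact_mod_cast Nat.one_le_iff_ne_zero.2 l.factorial_ne_zero)
            _ ≤ (c * T) ^ l := by gcongr
            _ ≤ (c * T) ^ k := pow_le_pow_right₀ hcT hlk
      _ = (k + 1) * c ^ k * T ^ k := by
          rw [Finset.sum_const, Finset.card_range, nsmul_eq_mul, mul_pow]; push_cast; ring

variable {k r : ℕ} {m : Fin k → ℕ} {n : Fin r → ℕ}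
  {NM : (i : Fin k) → Seminorm ℝ (Fin (m i) → ℝ)} {NN : (j : Fin r) → Seminorm ℝ (Fin (n j) → ℝ)}
  (hNM : ∀ i x, NM i x = 0 → x = 0) (hNN : ∀ j y, NN j y = 0 → y = 0)
  (hm : ∀ i, 0 < m i) (hn : ∀ j, 0 < n j) {η : Fin k → ℝ} (hη : ∀ i, 0 < η i)

/-- The volume of the target region, as a real number. -/
noncomputable def regVol (NM : (i : Fin k) → Seminorm ℝ (Fin (m i) → ℝ)) (η : Fin k → ℝ) (δ : ℝ) : ℝ :=
  hypVol k (∏ i, ballVol (NM i) * η i ^ m i) ((∏ i, ballVol (NM i)) * δ)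

include hNM

lemma prod_ballVol_pos : 0 < ∏ i, ballVol (NM i) := Finset.prod_pos fun i _ => ballVol_pos (hNM i)

include hη

lemma prod_box_pos : 0 < ∏ i, ballVol (NM i) * η i ^ m i :=
  Finset.prod_pos fun i _ => mul_pos (ballVol_pos (hNM i)) (pow_pos (hη i) _)

lemma regVol_nonneg {δ : ℝ} (hδ : 0 < δ) : 0 ≤ regVol NM η δ :=
  hypVol_nonneg k (prod_box_pos hNM hη).le (mul_pos (prod_ballVol_pos hNM) hδ)

lemma exists_regVol_le (hk : 0 < k) {ε : ℝ} (hε : 0 < ε) (B : ℝ) :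
    ∃ K : ℝ, 0 < K ∧ ∀ T, 1 ≤ T → ∀ P, 0 < P → Real.log P ≤ B * T →
      regVol NM η (ε / P) ≤ K * T ^ (k - 1) / P := by
  obtain ⟨K, hK, h⟩ := exists_hypVol_le (k - 1) (prod_box_pos hNM hη)
    (mul_pos (prod_ballVol_pos hNM) hε) B
  refine ⟨K, hK, fun T hT P hP hB => ?_⟩
  have := h T hT P hP hB
  rwa [Nat.sub_add_cancel hk, mul_div_assoc] at this

include hNN hn

/-- Asymptotics of the expected number of solutions. -/
lemma tendsto_firstMoment (hk : 0 < k) (hr : 0 < r) {ε : ℝ} (hε : 0 < ε) :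
    Tendsto (fun T => (∑ q ∈ qFinset NN T, regVol NM η (ε / qProd NN q)) / T ^ (k + r - 1)) atTop
      (𝓝 (ε * (1 / ((k + r - 1).factorial : ℝ)) *
        ((∏ i, ballVol (NM i)) * ∏ j, ballVol (NN j)) * cConst (k + r - 1) n)) := by
  obtain ⟨k, rfl⟩ : ∃ k', k = k' + 1 := ⟨k - 1, by omega⟩
  have hκ : k + 1 + r - 1 = k + r := by omega
  rw [hκ]
  set V := ∏ i, ballVol (NM i) with hV
  have hVp : 0 < V := prod_ballVol_pos hNM
  set C := V * ε / k.factorial with hC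
  -- `h` is the leading term of the volume of the region as the norm product of q tends to infinity;
  -- `u` is the weight against which the discrepancy is measured. The exponent k is one less than
  -- the original number of blocks.
  set h : (BlockIndex n → ℤ) → ℝ := fun q => C * ((qProd NN q)⁻¹ * Real.log (qProd NN q) ^ k)
  set u : (BlockIndex n → ℤ) → ℝ := fun q => (qProd NN q)⁻¹ * |Real.log (qProd NN q)| ^ k
  have hq0 (q) : 0 ≤ qProd NN q := Finset.prod_nonneg fun j _ => pow_nonneg (apply_nonneg _ _) _
  obtain ⟨K₁, hK₁, hlog⟩ := exists_abs_log_qProd_le hNN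
  obtain ⟨K₂, hK₂, hinv⟩ := exists_qSum_inv_le hNN hn
  have hu (T : ℝ) (hT : 1 ≤ T) : ∑ q ∈ qFinset NN T, u q ≤ K₁ ^ k * K₂ * T ^ (k + r) := by
    calc ∑ q ∈ qFinset NN T, u q ≤ ∑ q ∈ qFinset NN T, (qProd NN q)⁻¹ * (K₁ * T) ^ k := by
          refine Finset.sum_le_sum fun q hq => ?_
          have := hlog T hT q hq
          have := hq0 q
          simp only [u]
          gcongr
      _ ≤ (K₂ * T ^ r) * (K₁ * T) ^ k := by
          rw [← Finset.sum_mul]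
          gcongr
          exact hinv T hT
      _ = _ := by ring
  have hdiff := tendsto_sum_sub_div (qFinset NN) (fun q => regVol NM η (ε / qProd NN q)) h u
    (K₁ ^ k * K₂) (by omega : 0 < k + r) hu
    (fun q => mul_nonneg (inv_nonneg.2 (hq0 q)) (by positivity)) (fun δ hδ => by
      have hlim := tendsto_hypVol k (prod_box_pos hNM hη) (mul_pos hVp hε)
      obtain ⟨B, hB⟩ := eventually_atTop.1
        ((Metric.tendsto_nhds.1 hlim δ hδ).and (eventually_gt_atTop 0))
      -- The volume asymptotics are applied at t = log of the norm product, so they can fail only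
      -- for norm products below a fixed bound, that is, for finitely many q.
      refine (finite_qProd_le hNN hn B).subset fun q hq => ⟨hq.1, ?_⟩
      obtain ⟨⟨T, hT⟩, hcon⟩ := hq
      by_contra hlt
      push Not at hlt
      apply hcon
      have hP := qProd_pos hNN hT
      set t := Real.log (qProd NN q) with ht
      obtain ⟨h1, h2⟩ := hB t hlt.le
      have htk : 0 < t ^ k := by positivity
      rw [Real.dist_eq, ht, Real.exp_log hP, Real.exp_neg, Real.exp_log hP, ← ht] at h1
      have h3 : regVol NM η (ε / qProd NN q) - h q =
          (hypVol (k + 1) (∏ i, ballVol (NM i) * η i ^ m i) (V * ε * (qProd NN q)⁻¹) * qProd NN q /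
            t ^ k - V * ε / k.factorial) * ((qProd NN q)⁻¹ * t ^ k) := by
        simp only [h, regVol, hC]
        rw [← hV, ← ht, div_eq_mul_inv ε, mul_assoc V ε]
        field_simp
      rw [h3, abs_mul, abs_of_pos (by positivity : 0 < (qProd NN q)⁻¹ * t ^ k)]
      simp only [u]
      rw [← ht, abs_of_pos h2]
      gcongr)
  have hmain : Tendsto (fun T => (∑ q ∈ qFinset NN T, h q) / T ^ (k + r)) atTop
      (𝓝 (C * (k.factorial / (k + r).factorial * (∏ j, ballVol (NN j)) * cConst (k + r) n))) := by
    have h1 := (tendsto_qSum hNN hn k).const_mul C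
    rw [sum_piAntidiag_eq_cConst] at h1
    refine h1.congr fun T => ?_
    simp only [h]
    rw [← Finset.mul_sum, mul_div_assoc]
  have := hdiff.add hmain
  rw [zero_add] at this
  convert! this using 2
  · rw [← add_div, Finset.sum_sub_distrib, sub_add_cancel]
  · rw [hC]
    have : (k.factorial : ℝ) ≠ 0 := by positivity
    field_simp

end FirstMoment

/-! ### A sharper lattice point count for a single ball. -/

section RefinedCount

/-- Counting nonzero integer translates in a dilated ball. -/
lemma exists_count_ball_refined {n : ℕ} {N : Seminorm ℝ (Fin n → ℝ)} (hN : ∀ x, N x = 0 → x = 0)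
    (hn : 0 < n) {η : ℝ} (hη : 0 < η) :
    ∃ K : ℝ, 0 < K ∧ ∀ a b : ℝ, 1 ≤ a → |b| ≤ a → ∀ (x : Fin n → ℝ) (ρ δ : ℝ), 0 ≤ ρ → ρ ≤ η →
      ρ ^ n ≤ δ → N x ≤ ρ →
      ENNReal.ofReal ((a ^ n)⁻¹) *
        Measure.count {c : Fin n → ℤ | c ≠ 0 ∧ N (fun i => b * x i + c i) ≤ a * ρ} ≤
      ENNReal.ofReal (ballVol N * ρ ^ n) + ENNReal.ofReal (K * √(δ / a)) := by
  obtain ⟨c₀, hc₀, hle⟩ := exists_le_seminorm hN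
  obtain ⟨K, hK, hcount⟩ := exists_count_ball_bounds hN hn
  have hV := ballVol_pos hN
  -- A nonzero c that is counted satisfies N(c) ≤ aρ + |b|ρ ≤ 2aρ, while N(c) ≥ c₀. So the set is
  -- empty unless aρ ≥ c₁, and then the error radius K/a is at most a multiple of ρ.
  set c₁ := c₀ / 2 with hc₁
  have hc₁0 : 0 < c₁ := by positivity
  set D := ballVol N * (K * (n * (1 + K / c₁) ^ (n - 1))) with hD
  have hD0 : 0 ≤ D := by positivity
  refine ⟨D * √(η ^ (n - 1) / c₁) + 1, by positivity, fun a b ha hb x ρ δ hρ0 hρη hδ hx => ?_⟩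
  have ha0 : 0 < a := by linarith
  rcases Set.eq_empty_or_nonempty {c : Fin n → ℤ | c ≠ 0 ∧ N (fun i => b * x i + c i) ≤ a * ρ} with
    hemp | ⟨c, hc0, hc⟩
  · rw [hemp]; simp
  have hρ1 : c₁ ≤ a * ρ := by
    have h1 : (toReal c : Fin n → ℝ) = (fun i => b * x i + c i) - b • x := by
      ext i; simp [toReal]
    have h2 : N (toReal c) ≤ a * ρ + |b| * ρ := by
      rw [h1]
      refine (map_sub_le_add N _ _).trans ?_
      rw [map_smul_eq_mul, Real.norm_eq_abs]
      gcongr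
    have h3 : c₀ ≤ N (toReal c) := by
      have := one_le_norm_toReal hc0
      have := hle (toReal c)
      nlinarith
    have h4 : |b| * ρ ≤ a * ρ := by gcongr
    rw [hc₁]; linarith
  have hinva : 1 / a ≤ ρ / c₁ := by
    rw [div_le_div_iff₀ ha0 hc₁0]; linarith
  have hcard : ENNReal.ofReal ((a ^ n)⁻¹) *
      Measure.count {c : Fin n → ℤ | c ≠ 0 ∧ N (fun i => b * x i + c i) ≤ a * ρ} ≤
      ENNReal.ofReal (ballVol N * (ρ + K / a) ^ n) := by
    calc _ ≤ ENNReal.ofReal ((a ^ n)⁻¹) * ENNReal.ofReal (ballVol N * (a * ρ + K) ^ n) := by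
          gcongr
          exact (measure_mono fun c hc => hc.2).trans
            (hcount (fun i => b * x i) (a * ρ) (by positivity)).1
      _ = _ := by
          rw [← ENNReal.ofReal_mul (by positivity)]
          congr 1
          rw [show a * ρ + K = a * (ρ + K / a) by field_simp, mul_pow]
          field_simp
  refine hcard.trans ?_
  rw [← ENNReal.ofReal_add (by positivity) (by positivity)]
  refine ENNReal.ofReal_le_ofReal ?_
  have hKa : K / a ≤ ρ * (K / c₁) := by
    calc K / a = K * (1 / a) := by ring
      _ ≤ K * (ρ / c₁) := by gcongr
      _ = _ := by ring
  -- Of the two factors 1/a in the square, one is kept and the other is bounded by ρ/c₁. This trades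
  -- decay in a for decay in δ.
  have herr : 1 / a * ρ ^ (n - 1) ≤ √(δ / a) * √(η ^ (n - 1) / c₁) := by
    rw [← Real.sqrt_mul' _ (by positivity)]
    refine Real.le_sqrt_of_sq_le ?_
    calc (1 / a * ρ ^ (n - 1)) ^ 2 = 1 / a * (1 / a * ρ ^ (n - 1)) * ρ ^ (n - 1) := by ring
      _ ≤ 1 / a * (ρ / c₁ * ρ ^ (n - 1)) * η ^ (n - 1) := by gcongr
      _ = ρ ^ n / a * (η ^ (n - 1) / c₁) := by
          obtain ⟨n, rfl⟩ : ∃ n', n = n' + 1 := ⟨n - 1, by omega⟩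
          simp only [Nat.add_sub_cancel]
          rw [pow_succ]
          field_simp
      _ ≤ _ := by gcongr
  calc ballVol N * (ρ + K / a) ^ n
      ≤ ballVol N * (ρ ^ n + K / a * (n * (ρ + K / a) ^ (n - 1))) := by
        gcongr
        exact add_pow_le_add_mul n hρ0 (by positivity)
    _ ≤ ballVol N * (ρ ^ n + K / a * (n * (ρ + ρ * (K / c₁)) ^ (n - 1))) := by gcongr
    _ = ballVol N * ρ ^ n + D * (1 / a * ρ ^ (n - 1)) := by
        rw [show ρ + ρ * (K / c₁) = ρ * (1 + K / c₁) by ring, mul_pow, hD]; ring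
    _ ≤ ballVol N * ρ ^ n + D * (√(δ / a) * √(η ^ (n - 1) / c₁)) := by gcongr
    _ ≤ _ := by
        have : 0 ≤ √(δ / a) := Real.sqrt_nonneg _
        nlinarith

variable {k : ℕ} {m : Fin k → ℕ}

/-- With one block the region is a ball of radius ρ = min(η, δ^(1/m)), so the ball estimate applies
directly. It is needed only when k = r = 1. -/
lemma exists_count_region_refined {NM : (i : Fin k) → Seminorm ℝ (Fin (m i) → ℝ)} (hk : k = 1)
    (hNM : ∀ i x, NM i x = 0 → x = 0) (hm : ∀ i, 0 < m i)
    {η : Fin k → ℝ} (hη : ∀ i, 0 < η i) :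
    ∃ K : ℝ, 0 < K ∧ ∀ (a b : ℝ), 1 ≤ a → |b| ≤ a → ∀ (x : BlockIndex m → ℝ) (δ : ℝ), 0 < δ →
      x ∈ region NM η δ →
      ENNReal.ofReal ((a ^ Fintype.card (BlockIndex m))⁻¹) *
        Measure.count {c : BlockIndex m → ℤ | c ≠ 0 ∧ (fun i => (b * x i + c i) / a) ∈ region NM η δ} ≤
      ENNReal.ofReal (regVol NM η δ) + ENNReal.ofReal (K * √(δ / a)) := by
  subst hk
  obtain ⟨K, hK, hcount⟩ := exists_count_ball_refined (hNM 0) (hm 0) (hη 0)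
  refine ⟨K, hK, fun a b ha hb x δ hδ hx => ?_⟩
  have ha0 : 0 < a := by linarith
  have hV := ballVol_pos (hNM 0)
  have hm0 := (hm 0).ne'
  set ρ := min (η 0) (δ ^ ((m 0 : ℝ)⁻¹)) with hρ
  have hρ0 : 0 ≤ ρ := le_min (hη 0).le (by positivity)
  have hδm : (δ ^ ((m 0 : ℝ)⁻¹)) ^ m 0 = δ := Real.rpow_inv_natCast_pow hδ.le hm0
  have hρm : ρ ^ m 0 = min (η 0 ^ m 0) δ := by
    rw [hρ]
    rcases le_total (η 0) (δ ^ ((m 0 : ℝ)⁻¹)) with h | h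
    · have h' : η 0 ^ m 0 ≤ δ := by
        rw [← hδm]; exact pow_le_pow_left₀ (hη 0).le h _
      rw [min_eq_left h, min_eq_left h']
    · have h' : δ ≤ η 0 ^ m 0 := by
        conv_lhs => rw [← hδm]
        exact pow_le_pow_left₀ (by positivity) h _
      rw [min_eq_right h, min_eq_right h', hδm]
  have hmem (z : BlockIndex m → ℝ) : z ∈ region NM η δ ↔ NM 0 (blockProj 0 z) ≤ ρ := by
    simp only [region, mem_ofPred_eq, Fin.forall_fin_one, Fin.prod_univ_one, hρ, le_min_iff]
    refine and_congr_right fun _ => ?_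
    rw [← pow_le_pow_iff_left₀ (apply_nonneg _ _) (by positivity : 0 ≤ δ ^ ((m 0 : ℝ)⁻¹)) hm0, hδm]
  have hvol : regVol NM η δ = ballVol (NM 0) * ρ ^ m 0 := by
    simp only [regVol, hypVol, Fin.prod_univ_one, Finset.sum_range_one, pow_zero, Nat.factorial_zero,
      Nat.cast_one, div_one, mul_one, hρm]
    split_ifs with h
    · rw [mul_le_mul_iff_right₀ hV] at h
      rw [min_eq_left h]
    · rw [mul_le_mul_iff_right₀ hV] at h
      rw [min_eq_right (le_of_not_ge h)]
  have hcard : Fintype.card (BlockIndex m) = m 0 := by simp [Fintype.card_sigma]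
  rw [hvol, hcard]
  refine le_trans ?_ (hcount a b ha hb (blockProj 0 x) ρ δ hρ0 (min_le_left _ _)
    (by rw [hρm]; exact min_le_right _ _) ((hmem x).1 hx))
  gcongr
  rw [← Measure.count_injective_image (f := fun (c : BlockIndex m → ℤ) (j : Fin (m 0)) => c ⟨0, j⟩)]
  · refine measure_mono ?_
    rintro _ ⟨c, ⟨hc0, hc⟩, rfl⟩
    constructor
    · intro h
      apply hc0
      ext ⟨i, j⟩
      obtain rfl : i = 0 := Subsingleton.elim _ _
      exact congrFun h j
    · rw [hmem] at hc
      have h1 : blockProj 0 (fun i => (b * x i + (c i : ℝ)) / a) =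
          a⁻¹ • fun j : Fin (m 0) => b * blockProj 0 x j + (c ⟨0, j⟩ : ℝ) := by
        ext j; simp [blockProj, div_eq_inv_mul]
      rw [h1, map_smul_eq_mul, norm_inv, Real.norm_of_nonneg ha0.le, inv_mul_le_iff₀ ha0] at hc
      exact hc
  · intro c c' h
    ext ⟨i, j⟩
    obtain rfl : i = 0 := Subsingleton.elim _ _
    exact congrFun h j

end RefinedCount

/-! ### Integral proportionality. -/

section IntDep

/-- Two elements of a `ℤ`-module are proportional with coprime coefficients. -/
def IntDep {M : Type} [AddCommGroup M] (v w : M) : Prop := ∃ a b : ℤ, IsCoprime a b ∧ b • v = a • w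

lemma IntDep.symm {M : Type} [AddCommGroup M] {v w : M} (h : IntDep v w) : IntDep w v := by
  obtain ⟨a, b, hab, h⟩ := h
  exact ⟨b, a, hab.symm, h.symm⟩

/-- A real relation between the vectors can be read off at a coordinate where q is nonzero; dividing
that pair of entries by its gcd gives coprime integer coefficients. -/
lemma linearIndependent_of_not_intDep {κ : Type} {q q' : κ → ℤ} (hq : q ≠ 0) (h : ¬ IntDep q q') :
    LinearIndependent ℝ ![fun j => (q j : ℝ), fun j => (q' j : ℝ)] := by
  have hq' : (fun j => (q j : ℝ)) ≠ 0 := fun h0 => hq (by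
    ext j; simpa using congrFun h0 j)
  rw [LinearIndependent.pair_iff' hq']
  intro t ht
  apply h
  obtain ⟨j, hj⟩ := Function.ne_iff.1 hq
  have hj0 : q j ≠ 0 := hj
  set g := Int.gcd (q j) (q' j) with hg
  have hgpos : 0 < g := Int.gcd_pos_of_ne_zero_left _ hj0
  have hg0 : (g : ℤ) ≠ 0 := by exact_mod_cast hgpos.ne'
  refine ⟨q j / g, q' j / g, Int.isCoprime_iff_gcd_eq_one.2 (Int.gcd_div_gcd_div_gcd hgpos), ?_⟩
  obtain ⟨a, ha⟩ : (g : ℤ) ∣ q j := Int.gcd_dvd_left _ _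
  obtain ⟨b, hb⟩ : (g : ℤ) ∣ q' j := Int.gcd_dvd_right _ _
  have hda : q j / g = a := by rw [ha, Int.mul_ediv_cancel_left _ hg0]
  have hdb : q' j / g = b := by rw [hb, Int.mul_ediv_cancel_left _ hg0]
  rw [hda, hdb]
  ext i
  simp only [Pi.smul_apply, smul_eq_mul]
  have h1 : t * q j = q' j := by simpa using congrFun ht j
  have h2 : t * q i = q' i := by simpa using congrFun ht i
  have h3 : (q' j * q i : ℤ) = q j * q' i := by
    have : (q' j * q i : ℝ) = q j * q' i := by rw [← h1, ← h2]; ring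
    exact_mod_cast this
  rw [ha, hb] at h3
  have h4 : (g : ℤ) * (b * q i) = g * (a * q' i) := by linear_combination h3
  exact mul_left_cancel₀ hg0 h4

/-- From b q = a q' with a, b coprime, a divides every coordinate of q, and the quotient is the
common vector w. Changing both signs makes a positive. -/
lemma IntDep.exists_eq_smul {κ : Type} {q q' : κ → ℤ} (hq : q ≠ 0) (hq' : q' ≠ 0) (h : IntDep q q') :
    ∃ (w : κ → ℤ) (a b : ℤ), IsCoprime a b ∧ 0 < a ∧ b ≠ 0 ∧ q = a • w ∧ q' = b • w := by
  have key : ∀ a b : ℤ, IsCoprime a b → 0 < a → b • q = a • q' →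
      ∃ (w : κ → ℤ) (a b : ℤ), IsCoprime a b ∧ 0 < a ∧ b ≠ 0 ∧ q = a • w ∧ q' = b • w := by
    intro a b hab ha hb
    have hdvd (j : κ) : a ∣ q j := by
      have : a ∣ b * q j := ⟨q' j, by simpa using congrFun hb j⟩
      exact hab.dvd_of_dvd_mul_left this
    choose w hw using hdvd
    refine ⟨w, a, b, hab, ha, ?_, funext hw, ?_⟩
    · rintro rfl
      apply hq'
      ext j
      have := congrFun hb j
      simp at this
      rcases this with h | h
      · omega
      · simp [h]
    · ext j
      have := congrFun hb j
      simp only [Pi.smul_apply, smul_eq_mul, hw j] at this ⊢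
      have h2 : a * (b * w j) = a * q' j := by linear_combination this
      exact (mul_left_cancel₀ ha.ne' h2).symm
  obtain ⟨a, b, hab, h⟩ := h
  rcases lt_trichotomy a 0 with ha | ha | ha
  · exact key (-a) (-b) hab.neg_neg (by omega) (by rw [neg_smul, neg_smul, h])
  · exfalso
    subst ha
    have hb : b ≠ 0 := by
      rintro rfl
      exact not_isCoprime_zero_zero hab
    apply hq
    ext j
    have := congrFun h j
    simpa [hb] using this
  · exact key a b hab ha h

end IntDep

/-! ### Pair correlations of solutions with given denominators. -/

section Correlation

variable {k r : ℕ} {m : Fin k → ℕ} {n : Fin r → ℕ}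
  {NM : (i : Fin k) → Seminorm ℝ (Fin (m i) → ℝ)} {NN : (j : Fin r) → Seminorm ℝ (Fin (n j) → ℝ)}
  {η : Fin k → ℝ} {ε : ℝ}

lemma toReal_smul_block (j : Fin r) (a : ℤ) (w : BlockIndex n → ℤ) :
    blockProj j (toReal (a • w)) = (a : ℝ) • blockProj j (toReal w) := by
  ext i; simp [blockProj, toReal]

lemma seminorm_smul_block (j : Fin r) (a : ℤ) (w : BlockIndex n → ℤ) :
    NN j (blockProj j (toReal (a • w))) = |(a : ℝ)| * NN j (blockProj j (toReal w)) := by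
  rw [toReal_smul_block, map_smul_eq_mul, Real.norm_eq_abs]

lemma qProd_smul (a : ℤ) (w : BlockIndex n → ℤ) :
    qProd NN (a • w) = |(a : ℝ)| ^ (∑ j, n j) * qProd NN w := by
  simp only [qProd, seminorm_smul_block, mul_pow, Finset.prod_mul_distrib, Finset.prod_pow_eq_pow_sum]

lemma region_mono {δ δ' : ℝ} (h : δ ≤ δ') : region NM η δ ⊆ region NM η δ' :=
  fun _ hx => ⟨hx.1, hx.2.trans h⟩

open Classical in
/-- The number of pairs of non-proportional solutions with given denominators. -/
noncomputable def pairSum (NM : (i : Fin k) → Seminorm ℝ (Fin (m i) → ℝ))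
    (NN : (j : Fin r) → Seminorm ℝ (Fin (n j) → ℝ)) (η : Fin k → ℝ) (ε : ℝ)
    (θ : BlockIndex m → BlockIndex n → ℝ) (q q' : BlockIndex n → ℤ) : ℝ≥0∞ :=
  ∑' pp : (BlockIndex m → ℤ) × (BlockIndex m → ℤ), if IntDep (pp.1, q) (pp.2, q') then 0 else
    (region NM η (ε / qProd NN q)).indicator 1 (linForm (Matrix.of θ) pp.1 q) *
    (region NM η (ε / qProd NN q')).indicator 1 (linForm (Matrix.of θ) pp.2 q')

lemma pairSum_comm (θ : BlockIndex m → BlockIndex n → ℝ) (q q' : BlockIndex n → ℤ) :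
    pairSum NM NN η ε θ q q' = pairSum NM NN η ε θ q' q := by
  unfold pairSum
  rw [← (Equiv.prodComm _ _).tsum_eq]
  refine tsum_congr fun pp => ?_
  have : IntDep ((Equiv.prodComm _ _ pp).1, q) ((Equiv.prodComm _ _ pp).2, q') ↔
      IntDep (pp.1, q') (pp.2, q) := ⟨IntDep.symm, IntDep.symm⟩
  by_cases h : IntDep (pp.1, q') (pp.2, q)
  · rw [if_pos h, if_pos (this.2 h)]
  · rw [if_neg h, if_neg (mt this.1 h), mul_comm]; rfl

lemma lintegral_pairSum_le_of_not_intDep (q q' : BlockIndex n → ℤ) (hq : q ≠ 0) (h : ¬ IntDep q q')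
    (t : BlockIndex m → BlockIndex n → ℝ) :
    ∫⁻ θ, pairSum NM NN η ε θ q q' ∂(unitCube t) ≤
      volume (region NM η (ε / qProd NN q)) * volume (region NM η (ε / qProd NN q')) := by
  rw [← lintegral_tsum_linForm_mul (measurableSet_region NM η _) (measurableSet_region NM η _) q q'
    (linearIndependent_of_not_intDep hq h) t]
  refine lintegral_mono fun θ => ENNReal.tsum_le_tsum fun pp => ?_
  split_ifs
  · exact zero_le
  · exact le_rfl

/-- `E a δ` bounds the discrepancy in counting nonzero integer translates in the dilation by `a`
of the region with parameter `δ`. -/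
def CountError (NM : (i : Fin k) → Seminorm ℝ (Fin (m i) → ℝ)) (η : Fin k → ℝ) (E : ℝ → ℝ → ℝ) : Prop :=
  ∀ a b : ℝ, 1 ≤ a → |b| ≤ a → ∀ (x : BlockIndex m → ℝ) (δ : ℝ), 0 < δ → x ∈ region NM η δ →
    ENNReal.ofReal ((a ^ Fintype.card (BlockIndex m))⁻¹) *
      Measure.count {c : BlockIndex m → ℤ | c ≠ 0 ∧ (fun i => (b * x i + c i) / a) ∈ region NM η δ} ≤
    ENNReal.ofReal (regVol NM η δ) + ENNReal.ofReal (E a δ)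

/-- Pairs with b p = a p' are proportional and hence not counted in `pairSum`, so the parallel
correlation formula bounds it. Since |b| ≤ a, the region of a w lies inside that of b w, which
supplies the membership hypothesis of `CountError`; integrating that bound over the smaller region
gives the claim. -/
lemma lintegral_pairSum_smul_le (hNM : ∀ i x, NM i x = 0 → x = 0) (hm : ∀ i, 0 < m i)
    (hη : ∀ i, 0 < η i) (hε : 0 < ε)
    {E : ℝ → ℝ → ℝ} (hE : CountError NM η E) (w : BlockIndex n → ℤ) (hw : w ≠ 0) (a b : ℤ)
    (ha : 0 < a) (hba : |b| ≤ a) (hab : IsCoprime a b) (hqa : 0 < qProd NN (a • w))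
    (hqb : 0 < qProd NN (b • w)) (t : BlockIndex m → BlockIndex n → ℝ) :
    ∫⁻ θ, pairSum NM NN η ε θ (a • w) (b • w) ∂(unitCube t) ≤
      ENNReal.ofReal (regVol NM η (ε / qProd NN (a • w))) *
        (ENNReal.ofReal (regVol NM η (ε / qProd NN (b • w))) +
          ENNReal.ofReal (E a (ε / qProd NN (b • w)))) := by
  classical
  set A := region NM η (ε / qProd NN (a • w)) with hA
  set B := region NM η (ε / qProd NN (b • w)) with hB
  have haR : (1 : ℝ) ≤ a := by exact_mod_cast ha
  have hbR : |(b : ℝ)| ≤ a := by exact_mod_cast hba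
  have hAB : A ⊆ B := by
    refine region_mono ?_
    gcongr
    have hw0 : 0 ≤ qProd NN w :=
      Finset.prod_nonneg fun j _ => pow_nonneg (apply_nonneg _ _) _
    rw [qProd_smul, qProd_smul, abs_of_pos (by linarith : (0 : ℝ) < a)]
    gcongr
  calc ∫⁻ θ, pairSum NM NN η ε θ (a • w) (b • w) ∂(unitCube t)
      ≤ ∫⁻ θ, ∑' pp : (BlockIndex m → ℤ) × (BlockIndex m → ℤ), (if b • pp.1 = a • pp.2 then 0 else
      A.indicator 1 (linForm (Matrix.of θ) pp.1 (a • w)) *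
      B.indicator 1 (linForm (Matrix.of θ) pp.2 (b • w))) ∂(unitCube t) := by
        refine lintegral_mono fun θ => ENNReal.tsum_le_tsum fun pp => ?_
        by_cases h : b • pp.1 = a • pp.2
        · have : IntDep (pp.1, a • w) (pp.2, b • w) :=
            ⟨a, b, hab, Prod.ext h (smul_comm b a w)⟩
          rw [if_pos this]
          exact zero_le
        · simp only [h, if_false]
          split_ifs
          · exact zero_le
          · exact le_rfl
    _ = ENNReal.ofReal (((a : ℝ) ^ Fintype.card (BlockIndex m))⁻¹) * ∫⁻ x in A, ∑' c : BlockIndex m → ℤ,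
          (if c = 0 then 0 else B.indicator 1 (fun i => ((b : ℝ) * x i + c i) / a)) :=
        lintegral_tsum_linForm_parallel (measurableSet_region NM η _) (measurableSet_region NM η _)
          w hw a b ha hab t
    _ = ∫⁻ x in A, ENNReal.ofReal (((a : ℝ) ^ Fintype.card (BlockIndex m))⁻¹) *
          Measure.count {c : BlockIndex m → ℤ | c ≠ 0 ∧ (fun i => (b * x i + c i) / a) ∈ B} := by
        rw [← lintegral_const_mul' _ _ ENNReal.ofReal_ne_top]
        refine lintegral_congr fun x => ?_
        congr 1
        rw [← lintegral_indicator_one .of_discrete, lintegral_count]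
        refine tsum_congr fun c => ?_
        by_cases hc : c = 0
        · simp [hc]
        · simp [hc, Set.indicator_apply]
    _ ≤ ∫⁻ _ in A, (ENNReal.ofReal (regVol NM η (ε / qProd NN (b • w))) +
          ENNReal.ofReal (E a (ε / qProd NN (b • w)))) := by
        refine setLIntegral_mono' (measurableSet_region NM η _) fun x hx => ?_
        exact hE a b haR hbR x _ (by positivity) (hAB hx)
    _ = _ := by
        rw [setLIntegral_const, hA, volume_region hNM hm hη (by positivity), mul_comm]
        rfl

end Correlation

/-! ### Summing the errors from parallel denominators. -/

lemma sum_inv_sqrt_le (a : ℕ) : ∑ b ∈ Finset.Icc 1 a, (√(b : ℝ))⁻¹ ≤ 2 * √a := by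
  induction a with
  | zero => simp
  | succ a ih =>
    rw [Finset.sum_Icc_succ_top (by omega)]
    have h1 : 0 < √((a + 1 : ℕ) : ℝ) := Real.sqrt_pos.2 (by positivity)
    have h2 : √((a + 1 : ℕ) : ℝ) ^ 2 = a + 1 := by rw [Real.sq_sqrt (by positivity)]; push_cast; ring
    have h3 : √(a : ℝ) ^ 2 = a := Real.sq_sqrt (by positivity)
    have h4 : (√((a + 1 : ℕ) : ℝ))⁻¹ ≤ 2 * √((a + 1 : ℕ) : ℝ) - 2 * √(a : ℝ) := by
      rw [inv_eq_one_div, div_le_iff₀ h1]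
      nlinarith [sq_nonneg (√((a + 1 : ℕ) : ℝ) - √(a : ℝ))]
    linarith

lemma sum_inv_le (a : ℕ) : ∑ b ∈ Finset.Icc 1 a, (b : ℝ)⁻¹ ≤ 1 + Real.log a := by
  have h := harmonic_le_one_add_log a
  rw [harmonic_eq_sum_Icc] at h
  push_cast at h
  exact h

section

variable {k r : ℕ} {m : Fin k → ℕ} {n : Fin r → ℕ}
  {NM : (i : Fin k) → Seminorm ℝ (Fin (m i) → ℝ)} {NN : (j : Fin r) → Seminorm ℝ (Fin (n j) → ℝ)}
  {η : Fin k → ℝ} {ε : ℝ}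

lemma qFinset_ne_zero (hNN : ∀ j y, NN j y = 0 → y = 0) (hr : 0 < r) {T : ℝ} {q : BlockIndex n → ℤ}
    (hq : q ∈ qFinset NN T) : q ≠ 0 := by
  rintro rfl
  refine ((mem_qFinset hNN).1 hq ⟨0, hr⟩).1 ?_
  have : blockProj ⟨0, hr⟩ (toReal (0 : BlockIndex n → ℤ)) = 0 := by ext; simp [blockProj, toReal]
  rw [this, map_zero]

lemma mem_qFinset_of_smul_mem (hNN : ∀ j y, NN j y = 0 → y = 0) {T : ℝ} {w : BlockIndex n → ℤ} {a : ℤ}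
    (ha : a ≠ 0) (h : a • w ∈ qFinset NN T) : w ∈ qFinset NN T := by
  rw [mem_qFinset hNN] at h ⊢
  intro j
  have ha1 : (1 : ℝ) ≤ |(a : ℝ)| := by exact_mod_cast Int.one_le_abs ha
  obtain ⟨h1, h2⟩ := h j
  rw [seminorm_smul_block] at h1 h2
  refine ⟨right_ne_zero_of_mul h1, le_trans ?_ h2⟩
  exact le_mul_of_one_le_left (apply_nonneg _ _) ha1

/-- The first block of w has norm at least e^(t₀). Thus multipliers are at most exponential in T, so
harmonic sums over them cost only one factor T. -/
lemma exists_le_exp_of_smul_mem (hNN : ∀ j y, NN j y = 0 → y = 0) (hr : 0 < r) :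
    ∃ t₀ : ℝ, t₀ ≤ 0 ∧ ∀ T, ∀ (w : BlockIndex n → ℤ) (a : ℤ), a ≠ 0 → a • w ∈ qFinset NN T →
      (a : ℝ) ≤ Real.exp (T - t₀) := by
  obtain ⟨t₀, ht₀, hle⟩ := exists_exp_le_seminorm (hNN ⟨0, hr⟩)
  refine ⟨t₀, ht₀, fun T w a ha h => ?_⟩
  have h1 := ((mem_qFinset hNN).1 h ⟨0, hr⟩).2
  have h2 := hle (fun i => w ⟨⟨0, hr⟩, i⟩)
    ((mem_qFinset hNN).1 (mem_qFinset_of_smul_mem hNN ha h) ⟨0, hr⟩).1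
  rw [seminorm_smul_block] at h1
  rw [Real.exp_sub, le_div_iff₀ (Real.exp_pos _)]
  calc (a : ℝ) * Real.exp t₀ ≤ |(a : ℝ)| * Real.exp t₀ := by gcongr; exact le_abs_self _
    _ ≤ _ := mul_le_mul_of_nonneg_left h2 (abs_nonneg _)
    _ ≤ _ := h1

/-- The contribution of proportional denominators to the second moment. -/
noncomputable def pairErr (NM : (i : Fin k) → Seminorm ℝ (Fin (m i) → ℝ))
    (NN : (j : Fin r) → Seminorm ℝ (Fin (n j) → ℝ)) (η : Fin k → ℝ) (ε : ℝ) (E : ℝ → ℝ → ℝ) (A : ℕ)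
    (T : ℝ) (q q' : BlockIndex n → ℤ) : ℝ≥0∞ :=
  ∑ w ∈ qFinset NN T, ∑ a ∈ Finset.Icc 1 A, ∑ b ∈ Finset.Icc 1 a, ∑ u ∈ ({1, -1} : Finset ℤ),
    if (a : ℤ) • w = q ∧ (u * (b : ℤ)) • w = q' then
      ENNReal.ofReal (regVol NM η (ε / qProd NN q) * E a (ε / qProd NN q')) else 0

/-- The error of this pair is the single term of `pairErr` indexed by w, a, |b| and the sign of b.
Summing over all representations avoids having to choose one. -/
lemma lintegral_pairSum_le_pairErr (hNM : ∀ i x, NM i x = 0 → x = 0) (hm : ∀ i, 0 < m i)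
    (hNN : ∀ j y, NN j y = 0 → y = 0) (hr : 0 < r)
    (hη : ∀ i, 0 < η i) (hε : 0 < ε) {E : ℝ → ℝ → ℝ} (hE : CountError NM η E) {A : ℕ} {T : ℝ}
    (hA : ∀ (w : BlockIndex n → ℤ) (a : ℤ), a ≠ 0 → a • w ∈ qFinset NN T → a ≤ A)
    (w : BlockIndex n → ℤ) (a b : ℤ) (ha : 0 < a) (hb : b ≠ 0) (hba : |b| ≤ a)
    (hab : IsCoprime a b) (hqa : a • w ∈ qFinset NN T) (hqb : b • w ∈ qFinset NN T)
    (t : BlockIndex m → BlockIndex n → ℝ) :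
    ∫⁻ θ, pairSum NM NN η ε θ (a • w) (b • w) ∂(unitCube t) ≤
      ENNReal.ofReal (regVol NM η (ε / qProd NN (a • w))) *
        ENNReal.ofReal (regVol NM η (ε / qProd NN (b • w))) +
      pairErr NM NN η ε E A T (a • w) (b • w) := by
  have hpa := qProd_pos hNN hqa
  have hpb := qProd_pos hNN hqb
  have hwm := mem_qFinset_of_smul_mem hNN ha.ne' hqa
  refine (lintegral_pairSum_smul_le hNM hm hη hε hE w (qFinset_ne_zero hNN hr hwm) a b ha hba hab
    hpa hpb t).trans ?_
  rw [mul_add]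
  gcongr
  rw [← ENNReal.ofReal_mul (regVol_nonneg hNM hη (by positivity))]
  have hla := hA w a ha.ne' hqa
  have e1 : (a.natAbs : ℤ) = a := by omega
  have e2 : b.sign * (b.natAbs : ℤ) = b := Int.sign_mul_natAbs b
  have e3 : b.sign ∈ ({1, -1} : Finset ℤ) := by
    rcases lt_or_gt_of_ne hb with h | h
    · simp [Int.sign_eq_neg_one_of_neg h]
    · simp [Int.sign_eq_one_of_pos h]
  have e4 : (b.natAbs : ℤ) ≤ a := by rwa [Int.natCast_natAbs]
  unfold pairErr
  refine le_trans ?_ (Finset.single_le_sum (fun _ _ => zero_le) hwm)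
  refine le_trans ?_ (Finset.single_le_sum (fun _ _ => zero_le)
    (Finset.mem_Icc.2 ⟨by omega, by omega⟩ : a.natAbs ∈ Finset.Icc 1 A))
  refine le_trans ?_ (Finset.single_le_sum (fun _ _ => zero_le)
    (Finset.mem_Icc.2 ⟨by omega, by omega⟩ : b.natAbs ∈ Finset.Icc 1 a.natAbs))
  refine le_trans ?_ (Finset.single_le_sum (fun _ _ => zero_le) e3)
  rw [if_pos ⟨by rw [e1], by rw [e2]⟩, ← Int.cast_natCast a.natAbs, e1]

lemma lintegral_pairSum_le (hNM : ∀ i x, NM i x = 0 → x = 0) (hm : ∀ i, 0 < m i)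
    (hNN : ∀ j y, NN j y = 0 → y = 0) (hr : 0 < r)
    (hη : ∀ i, 0 < η i) (hε : 0 < ε) {E : ℝ → ℝ → ℝ} (hE : CountError NM η E) {A : ℕ} {T : ℝ}
    (hA : ∀ (w : BlockIndex n → ℤ) (a : ℤ), a ≠ 0 → a • w ∈ qFinset NN T → a ≤ A)
    {q q' : BlockIndex n → ℤ} (hq : q ∈ qFinset NN T) (hq' : q' ∈ qFinset NN T)
    (t : BlockIndex m → BlockIndex n → ℝ) :
    ∫⁻ θ, pairSum NM NN η ε θ q q' ∂(unitCube t) ≤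
      ENNReal.ofReal (regVol NM η (ε / qProd NN q)) * ENNReal.ofReal (regVol NM η (ε / qProd NN q')) +
      (pairErr NM NN η ε E A T q q' + pairErr NM NN η ε E A T q' q) := by
  have hpq := qProd_pos hNN hq
  have hpq' := qProd_pos hNN hq'
  have hq0 := qFinset_ne_zero hNN hr hq
  have hq0' := qFinset_ne_zero hNN hr hq'
  by_cases h : IntDep q q'
  · obtain ⟨w, a, b, hab, ha, hb, rfl, rfl⟩ := h.exists_eq_smul hq0 hq0'
    rcases le_or_gt |b| a with hba | hba
    · refine (lintegral_pairSum_le_pairErr hNM hm hNN hr hη hε hE hA w a b ha hb hba hab hq hq' t).trans ?_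
      gcongr
      exact le_self_add
    -- When |b| > a the roles are exchanged. Moving the sign of b into w makes the new leading
    -- coefficient |b| positive.
    · have e1 : b • w = |b| • (b.sign • w) := by
        rw [smul_smul, mul_comm, Int.sign_mul_abs]
      have e0 : b.sign * b.sign = 1 := by
        rcases lt_or_gt_of_ne hb with h | h
        · simp [Int.sign_eq_neg_one_of_neg h]
        · simp [Int.sign_eq_one_of_pos h]
      have e2 : a • w = (b.sign * a) • (b.sign • w) := by
        rw [smul_smul, mul_right_comm, e0, one_mul]
      have hsa : |b.sign * a| = a := by
        rw [abs_mul, abs_of_pos ha]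
        rcases lt_or_gt_of_ne hb with h | h
        · simp [Int.sign_eq_neg_one_of_neg h]
        · simp [Int.sign_eq_one_of_pos h]
      have hcop : IsCoprime |b| (b.sign * a) := by
        rw [Int.isCoprime_iff_gcd_eq_one] at hab ⊢
        rw [Int.gcd_comm] at hab
        rw [← hab]
        unfold Int.gcd
        rw [Int.natAbs_abs, ← Int.natAbs_abs (b.sign * a), hsa]
      simp_rw [pairSum_comm _ (a • w)]
      have := lintegral_pairSum_le_pairErr hNM hm hNN hr hη hε hE hA (b.sign • w) |b| (b.sign * a)
        (by positivity) (by rw [← abs_pos, hsa]; exact ha) (by rw [hsa]; exact hba.le) hcop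
        (by rwa [← e1]) (by rwa [← e2]) t
      rw [← e1, ← e2] at this
      refine this.trans ?_
      rw [mul_comm]
      gcongr
      exact le_add_self
  · refine (lintegral_pairSum_le_of_not_intDep q q' hq0 h t).trans ?_
    rw [volume_region hNM hm hη (by positivity), volume_region hNM hm hη (by positivity)]
    exact le_self_add

/-- The data w, a, b and a sign determine q and q', so the double sum over denominators collapses;
the factor 2 counts the signs, which do not affect the norm product. -/
lemma sum_sum_pairErr_le (E : ℝ → ℝ → ℝ) (A : ℕ) (T : ℝ) :
    ∑ q ∈ qFinset NN T, ∑ q' ∈ qFinset NN T, pairErr NM NN η ε E A T q q' ≤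
    ∑ w ∈ qFinset NN T, ∑ a ∈ Finset.Icc 1 A, ∑ b ∈ Finset.Icc 1 a,
      if (a : ℤ) • w ∈ qFinset NN T then 2 * ENNReal.ofReal (regVol NM η (ε / qProd NN ((a : ℤ) • w)) *
        E a (ε / qProd NN ((b : ℤ) • w))) else 0 := by
  classical
  unfold pairErr
  have comm : ∀ {X Y : Type} (s : Finset X) (t : X → Finset Y) (Q : Finset (BlockIndex n → ℤ))
      (f : (BlockIndex n → ℤ) → (BlockIndex n → ℤ) → (x : X) → Y → ℝ≥0∞), 
      ∑ q ∈ Q, ∑ q' ∈ Q, ∑ x ∈ s, ∑ y ∈ t x, f q q' x y =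
        ∑ x ∈ s, ∑ y ∈ t x, ∑ q ∈ Q, ∑ q' ∈ Q, f q q' x y := by
    intro X Y s t Q f
    simp_rw [Finset.sum_comm (s := Q) (t := s)]
    refine Finset.sum_congr rfl fun x _ => ?_
    simp_rw [Finset.sum_comm (s := Q) (t := t x)]
  rw [comm]
  refine Finset.sum_le_sum fun w _ => Finset.sum_le_sum fun a _ => ?_
  rw [comm]
  refine Finset.sum_le_sum fun b _ => ?_
  have hb : ∀ u ∈ ({1, -1} : Finset ℤ), (∑ q ∈ qFinset NN T, ∑ q' ∈ qFinset NN T,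
      if (a : ℤ) • w = q ∧ (u * (b : ℤ)) • w = q' then
      ENNReal.ofReal (regVol NM η (ε / qProd NN q) * E a (ε / qProd NN q')) else 0) ≤
      if (a : ℤ) • w ∈ qFinset NN T then ENNReal.ofReal (regVol NM η (ε / qProd NN ((a : ℤ) • w)) *
        E a (ε / qProd NN ((b : ℤ) • w))) else 0 := by
    intro u hu
    have hq : qProd NN ((u * (b : ℤ)) • w) = qProd NN ((b : ℤ) • w) := by
      rw [qProd_smul, qProd_smul]
      congr 2
      simp only [Finset.mem_insert, Finset.mem_singleton] at hu
      rcases hu with rfl | rfl <;> simp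
    simp_rw [ite_and, Finset.sum_ite_irrel, Finset.sum_const_zero, Finset.sum_ite_eq]
    split_ifs
    · rw [hq]
    · exact zero_le
    · exact le_rfl
  refine (Finset.sum_le_sum hb).trans_eq ?_
  rw [Finset.sum_const]
  split_ifs
  · simp
  · simp

/-- The volume for a w is O(T^(k-1)/(a P(w))), with P the norm product. The sum over b of h is
bounded, the sum over a of 1/a is O(T), and the sum over w of g is O(T^e); this accounts for the
three parts of the exponent. -/
lemma exists_sum_err_le (hNM : ∀ i x, NM i x = 0 → x = 0) (hNN : ∀ j y, NN j y = 0 → y = 0)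
    (hn : ∀ j, 0 < n j) (hη : ∀ i, 0 < η i) (hk : 0 < k) (hr : 0 < r) (hε : 0 < ε)
    {E : ℝ → ℝ → ℝ} (hE : ∀ a δ, 0 < a → 0 < δ → 0 ≤ E a δ) {g : (BlockIndex n → ℤ) → ℝ} {h : ℕ → ℕ → ℝ}
    {C G t₀ : ℝ} {e : ℕ} (hh : ∀ a b, 0 ≤ h a b) (hC : ∀ a, ∑ b ∈ Finset.Icc 1 a, h a b ≤ C)
    (ht₀ : t₀ ≤ 0) (hg : ∀ w, 0 ≤ g w) (hG : ∀ T, 1 ≤ T → ∑ w ∈ qFinset NN T, g w ≤ G * T ^ e)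
    (hgh : ∀ T, ∀ w ∈ qFinset NN T, ∀ a b : ℕ, 1 ≤ b → b ≤ a →
      E a (ε / qProd NN ((b : ℤ) • w)) / qProd NN w ≤ h a b * g w) :
    ∃ K : ℝ, 0 < K ∧ ∀ T, 1 ≤ T → ∑ w ∈ qFinset NN T, ∑ a ∈ Finset.Icc 1 ⌊Real.exp (T - t₀)⌋₊,
      ∑ b ∈ Finset.Icc 1 a, (if (a : ℤ) • w ∈ qFinset NN T then
        2 * ENNReal.ofReal (regVol NM η (ε / qProd NN ((a : ℤ) • w)) *
        E a (ε / qProd NN ((b : ℤ) • w))) else 0) ≤ ENNReal.ofReal (K * T ^ (k - 1 + 1 + e)) := by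
  obtain ⟨B, hB0, hB⟩ := exists_abs_log_qProd_le hNN
  obtain ⟨K, hK, hreg⟩ := exists_regVol_le hNM hη hk hε B
  refine ⟨max 1 (2 * K * C * (2 - t₀) * G), lt_max_of_lt_left one_pos, fun T hT => ?_⟩
  have hC0 : 0 ≤ C := by simpa using hC 0
  have hterm : ∀ w ∈ qFinset NN T, ∀ a ∈ Finset.Icc 1 ⌊Real.exp (T - t₀)⌋₊, ∀ b ∈ Finset.Icc 1 a,
      (if (a : ℤ) • w ∈ qFinset NN T then
        2 * ENNReal.ofReal (regVol NM η (ε / qProd NN ((a : ℤ) • w)) *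
        E a (ε / qProd NN ((b : ℤ) • w))) else 0) ≤
      ENNReal.ofReal (2 * K * T ^ (k - 1) * g w * ((a : ℝ)⁻¹ * h a b)) := by
    intro w hw a ha b hb
    rw [Finset.mem_Icc] at ha hb
    split_ifs with haw
    · have hpw := qProd_pos hNN hw
      have hpaw := qProd_pos hNN haw
      have haR : (1 : ℝ) ≤ a := by exact_mod_cast ha.1
      have hbR : (1 : ℝ) ≤ b := by exact_mod_cast hb.1
      have hpb : 0 < qProd NN ((b : ℤ) • w) := by
        rw [qProd_smul, Int.cast_natCast, abs_of_pos (by linarith)]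
        positivity
      have h1 := hreg T hT _ hpaw ((le_abs_self _).trans (hB T hT _ haw))
      have hpa : a * qProd NN w ≤ qProd NN ((a : ℤ) • w) := by
        rw [qProd_smul, Int.cast_natCast, abs_of_pos (by linarith)]
        gcongr
        refine le_self_pow₀ haR ?_
        exact (Finset.sum_pos (fun j _ => hn j) ⟨⟨0, hr⟩, Finset.mem_univ _⟩).ne'
      have h2 := hE a (ε / qProd NN ((b : ℤ) • w)) (by linarith) (by positivity)
      have h3 := hgh T w hw a b hb.1 hb.2
      rw [← ENNReal.ofReal_ofNat 2, ← ENNReal.ofReal_mul (by norm_num)]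
      refine ENNReal.ofReal_le_ofReal ?_
      calc 2 * (regVol NM η (ε / qProd NN ((a : ℤ) • w)) * E a (ε / qProd NN ((b : ℤ) • w)))
          ≤ 2 * (K * T ^ (k - 1) / (a * qProd NN w) * E a (ε / qProd NN ((b : ℤ) • w))) := by
            gcongr
            exact h1.trans (by gcongr)
        _ = 2 * K * T ^ (k - 1) * ((a : ℝ)⁻¹ * (E a (ε / qProd NN ((b : ℤ) • w)) / qProd NN w)) := by
            field_simp
        _ ≤ 2 * K * T ^ (k - 1) * ((a : ℝ)⁻¹ * (h a b * g w)) := by gcongr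
        _ = _ := by ring
    · exact zero_le
  refine (Finset.sum_le_sum fun w hw => Finset.sum_le_sum fun a ha => Finset.sum_le_sum fun b hb =>
    hterm w hw a ha b hb).trans ?_
  have hpos : ∀ w (a b : ℕ), 0 ≤ 2 * K * T ^ (k - 1) * g w * ((a : ℝ)⁻¹ * h a b) := fun w a b => by
    have := hg w; have := hh a b; positivity
  rw [Finset.sum_congr rfl fun w _ => (Finset.sum_congr rfl fun a _ =>
    (ENNReal.ofReal_sum_of_nonneg fun b _ => hpos w a b).symm)]
  rw [Finset.sum_congr rfl fun w _ =>
    (ENNReal.ofReal_sum_of_nonneg fun a _ => Finset.sum_nonneg fun b _ => hpos w a b).symm]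
  rw [← ENNReal.ofReal_sum_of_nonneg fun w _ => Finset.sum_nonneg fun a _ => Finset.sum_nonneg
    fun b _ => hpos w a b]
  refine ENNReal.ofReal_le_ofReal ?_
  simp_rw [← Finset.mul_sum]
  rw [← Finset.sum_mul, ← Finset.mul_sum]
  have hlog : Real.log (⌊Real.exp (T - t₀)⌋₊ : ℝ) ≤ T - t₀ := by
    rcases Nat.eq_zero_or_pos ⌊Real.exp (T - t₀)⌋₊ with h0 | h0
    · rw [h0]; simp; linarith
    · rw [Real.log_le_iff_le_exp (by exact_mod_cast h0)]
      exact Nat.floor_le (Real.exp_pos _).le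
  have hsum : ∑ a ∈ Finset.Icc 1 ⌊Real.exp (T - t₀)⌋₊, (a : ℝ)⁻¹ * ∑ b ∈ Finset.Icc 1 a, h a b ≤
      (2 - t₀) * T * C := by
    calc _ ≤ ∑ a ∈ Finset.Icc 1 ⌊Real.exp (T - t₀)⌋₊, (a : ℝ)⁻¹ * C := by
          gcongr with a ha; exact hC a
      _ = (∑ a ∈ Finset.Icc 1 ⌊Real.exp (T - t₀)⌋₊, (a : ℝ)⁻¹) * C := by rw [Finset.sum_mul]
      _ ≤ (2 - t₀) * T * C := by
          gcongr
          refine (sum_inv_le _).trans ?_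
          nlinarith
  have hGT := hG T hT
  have hg0 : 0 ≤ ∑ w ∈ qFinset NN T, g w := Finset.sum_nonneg fun w _ => hg w
  calc _ ≤ 2 * K * T ^ (k - 1) * (G * T ^ e) * ((2 - t₀) * T * C) := by
        have hG0 := hg0.trans hGT
        gcongr
        exact Finset.sum_nonneg fun a _ => mul_nonneg (by positivity) (Finset.sum_nonneg fun b _ => hh a b)
    _ = (2 * K * C * (2 - t₀) * G) * T ^ (k - 1 + 1 + e) := by rw [pow_add, pow_add]; ring
    _ ≤ _ := by gcongr; exact le_max_right _ _

/-- Products of volumes add up to the square of the mean, so the point is that parallel denominators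
cost one power of T less than the square of T^(k+r-1). -/
lemma exists_sum_pairSum_le (hNM : ∀ i x, NM i x = 0 → x = 0) (hNN : ∀ j y, NN j y = 0 → y = 0)
    (hm : ∀ i, 0 < m i) (hn : ∀ j, 0 < n j) (hη : ∀ i, 0 < η i) (hk : 0 < k) (hr : 0 < r) (hε : 0 < ε) :
    ∃ K : ℝ, 0 < K ∧ ∀ T, 1 ≤ T → ∀ t : BlockIndex m → BlockIndex n → ℝ,
      ∑ q ∈ qFinset NN T, ∑ q' ∈ qFinset NN T, ∫⁻ θ, pairSum NM NN η ε θ q q' ∂(unitCube t) ≤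
      ENNReal.ofReal ((∑ q ∈ qFinset NN T, regVol NM η (ε / qProd NN q)) ^ 2 +
        K * T ^ (2 * (k + r - 1) - 1)) := by
  obtain ⟨t₀, ht₀, hexp⟩ := exists_le_exp_of_smul_mem hNN hr
  obtain ⟨E, hE, K, hK, hsum⟩ : ∃ E : ℝ → ℝ → ℝ, CountError NM η E ∧ ∃ K : ℝ, 0 < K ∧ ∀ T, 1 ≤ T →
      ∑ w ∈ qFinset NN T, ∑ a ∈ Finset.Icc 1 ⌊Real.exp (T - t₀)⌋₊,
      ∑ b ∈ Finset.Icc 1 a, (if (a : ℤ) • w ∈ qFinset NN T then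
        2 * ENNReal.ofReal (regVol NM η (ε / qProd NN ((a : ℤ) • w)) *
        E a (ε / qProd NN ((b : ℤ) • w))) else 0) ≤
        ENNReal.ofReal (K * T ^ (2 * (k + r - 1) - 1)) := by
    -- The error O(1/a) leads to T^(k+r), which is within 2(k+r-1)-1 exactly when k + r ≥ 3. For k =
    -- r = 1 the allowed exponent is 1, and the refined count is required.
    by_cases hkr : k = 1 ∧ r = 1
    · obtain ⟨rfl, rfl⟩ := hkr
      obtain ⟨D, hD, hcount⟩ := exists_count_region_refined rfl hNM hm hη
      obtain ⟨G, hG, hsumG⟩ := exists_blockSum_rpow_le (hNN 0) (hn 0)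
      -- The decay in δ supplies an additional half power of the norm product, so the sum over w has
      -- exponent 3/2 and is bounded; the remaining factor 1/√(ab) sums over b ≤ a to at most 2.
      refine ⟨fun a δ => D * √(δ / a), hcount, ?_⟩
      have HA (a : ℕ) : ∑ b ∈ Finset.Icc 1 a, (√(a : ℝ))⁻¹ * (√(b : ℝ))⁻¹ ≤ 2 := by
        rw [← Finset.mul_sum]
        calc (√(a : ℝ))⁻¹ * ∑ b ∈ Finset.Icc 1 a, (√(b : ℝ))⁻¹ ≤ (√(a : ℝ))⁻¹ * (2 * √a) := by
              gcongr; exact sum_inv_sqrt_le a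
          _ ≤ 2 := by
              rcases eq_or_ne (√(a : ℝ)) 0 with h | h
              · rw [h]; norm_num
              · field_simp; exact le_rfl
      have HB (w : BlockIndex n → ℤ) : 0 ≤ D * √ε * ((qProd NN w)⁻¹ * √(qProd NN w)⁻¹) := by
        have : 0 ≤ qProd NN w := Finset.prod_nonneg fun j _ => pow_nonneg (apply_nonneg _ _) _
        positivity
      have HC (T : ℝ) (_ : 1 ≤ T) : ∑ w ∈ qFinset NN T, D * √ε * ((qProd NN w)⁻¹ * √(qProd NN w)⁻¹) ≤
          D * √ε * G * T ^ 0 := by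
        rw [← Finset.mul_sum, pow_zero, mul_one]
        gcongr
        refine le_trans (le_of_eq ?_) (hsumG T)
        have := sum_qFinset_prod NN T (fun j c =>
          (NN j (toReal c) ^ n j)⁻¹ * √(NN j (toReal c) ^ n j)⁻¹)
        simp only [Finset.univ_unique, Fin.default_eq_zero, Finset.prod_singleton] at this
        rw [← this]
        simp only [qProd, Finset.univ_unique, Fin.default_eq_zero, Finset.prod_singleton]
        rfl
      have HD (T : ℝ) : ∀ w ∈ qFinset NN T, ∀ a b : ℕ, 1 ≤ b → b ≤ a →
          D * √(ε / qProd NN ((b : ℤ) • w) / a) / qProd NN w ≤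
            (√(a : ℝ))⁻¹ * (√(b : ℝ))⁻¹ * (D * √ε * ((qProd NN w)⁻¹ * √(qProd NN w)⁻¹)) := by
        intro w hw a b hb hba
        have hpw := qProd_pos hNN hw
        have hbR : (1 : ℝ) ≤ b := by exact_mod_cast hb
        have haR : (1 : ℝ) ≤ a := by exact_mod_cast hb.trans hba
        have hpb : b * qProd NN w ≤ qProd NN ((b : ℤ) • w) := by
          rw [qProd_smul, Int.cast_natCast, abs_of_pos (by linarith)]
          gcongr
          refine le_self_pow₀ hbR ?_
          exact (Finset.sum_pos (fun j _ => hn j) ⟨⟨0, hr⟩, Finset.mem_univ _⟩).ne'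
        have h1 : √(ε / qProd NN ((b : ℤ) • w) / a) ≤ √ε * √(qProd NN w)⁻¹ * ((√(a : ℝ))⁻¹ * (√(b : ℝ))⁻¹) := by
          rw [← Real.sqrt_inv (a : ℝ), ← Real.sqrt_inv (b : ℝ), ← Real.sqrt_mul (by positivity),
            ← Real.sqrt_mul (by positivity), ← Real.sqrt_mul (by positivity)]
          refine Real.sqrt_le_sqrt ?_
          calc ε / qProd NN ((b : ℤ) • w) / a ≤ ε / (b * qProd NN w) / a := by gcongr
            _ = _ := by field_simp
        calc D * √(ε / qProd NN ((b : ℤ) • w) / a) / qProd NN w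
            ≤ D * (√ε * √(qProd NN w)⁻¹ * ((√(a : ℝ))⁻¹ * (√(b : ℝ))⁻¹)) / qProd NN w := by gcongr
          _ = _ := by rw [div_eq_mul_inv]; ring
      obtain ⟨K, hK, hsum⟩ := exists_sum_err_le hNM hNN hn hη hk hr hε (E := fun a δ => D * √(δ / a))
        (fun _ _ _ _ => by positivity) (g := fun w => D * √ε * ((qProd NN w)⁻¹ * √(qProd NN w)⁻¹))
        (h := fun a b => (√(a : ℝ))⁻¹ * (√(b : ℝ))⁻¹) (C := 2) (G := D * √ε * G) (e := 0)
        (fun _ _ => by positivity) HA ht₀ HB HC HD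
      exact ⟨K, hK, hsum⟩
    · obtain ⟨D, hD, hcount⟩ := exists_count_region_le hNM hm hη
      obtain ⟨G, hG, hsumG⟩ := exists_qSum_inv_le hNN hn
      -- The error 1/a is constant in b, so its sum over b ≤ a is at most 1, and the sum over w is
      -- O(T^r).
      refine ⟨fun a _ => D / a, ?_, ?_⟩
      · intro a b ha hb x δ hδ hx
        refine le_trans ?_ ((hcount a ha (fun i => b * x i) δ hδ).trans_eq ?_)
        · gcongr
          exact And.right
        · rw [volume_region hNM hm hη hδ]; rfl
      · obtain ⟨K, hK, hsum⟩ := exists_sum_err_le hNM hNN hn hη hk hr hε (E := fun a _ => D / a)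
          (fun _ _ _ _ => by positivity)
          (g := fun w => D * (qProd NN w)⁻¹) (h := fun a b => (a : ℝ)⁻¹) (C := 1) (G := D * G) (e := r)
          (fun _ _ => by positivity) (fun a => by
            rw [Finset.sum_const, Nat.card_Icc, nsmul_eq_mul, Nat.add_sub_cancel]
            exact mul_inv_le_one) ht₀
          (fun w => by
            have : 0 ≤ qProd NN w := Finset.prod_nonneg fun j _ => pow_nonneg (apply_nonneg _ _) _
            positivity)
          (fun T hT => by
            rw [← Finset.mul_sum, mul_assoc]
            gcongr
            exact hsumG T hT)
          (fun T w hw a b hb hba => le_of_eq (by rw [div_eq_mul_inv, div_eq_mul_inv]; ring))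
        refine ⟨K, hK, fun T hT => (hsum T hT).trans (ENNReal.ofReal_le_ofReal ?_)⟩
        gcongr
        omega
  -- The factor 2 comes from the two orders of the pair in `lintegral_pairSum_le`.
  refine ⟨2 * K, by positivity, fun T hT t => ?_⟩
  have hA : ∀ (w : BlockIndex n → ℤ) (a : ℤ), a ≠ 0 → a • w ∈ qFinset NN T →
      a ≤ (⌊Real.exp (T - t₀)⌋₊ : ℕ) := fun w a ha h => by
    have := Int.le_floor.2 (hexp T w a ha h)
    rw [← Int.floor_toNat]
    omega
  have hv : ∀ q ∈ qFinset NN T, 0 ≤ regVol NM η (ε / qProd NN q) := fun q hq =>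
    regVol_nonneg hNM hη (div_pos hε (qProd_pos hNN hq))
  refine (Finset.sum_le_sum fun q hq => Finset.sum_le_sum fun q' hq' =>
    lintegral_pairSum_le hNM hm hNN hr hη hε hE hA hq hq' t).trans ?_
  simp_rw [Finset.sum_add_distrib]
  rw [Finset.sum_comm (f := fun q q' => pairErr NM NN η ε E _ T q' q),
    ← Finset.sum_mul_sum, ← ENNReal.ofReal_sum_of_nonneg hv, ← two_mul, ENNReal.ofReal_add
    (by positivity) (by positivity), ← sq, ENNReal.ofReal_pow (Finset.sum_nonneg hv)]
  gcongr
  rw [mul_assoc, ENNReal.ofReal_mul (by norm_num), ENNReal.ofReal_ofNat]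
  gcongr
  exact (sum_sum_pairErr_le E _ T).trans (hsum T hT)

end

/-! ### Solutions, proportional pairs and vectors of large content. -/

section

variable {k r : ℕ} {m : Fin k → ℕ} {n : Fin r → ℕ}
  {NM : (i : Fin k) → Seminorm ℝ (Fin (m i) → ℝ)} {NN : (j : Fin r) → Seminorm ℝ (Fin (n j) → ℝ)}
  {η : Fin k → ℝ} {ε : ℝ}

/-- The approximates counted up to height `e^T`, in terms of regions depending on the denominator. -/
def solSet (NM : (i : Fin k) → Seminorm ℝ (Fin (m i) → ℝ))
    (NN : (j : Fin r) → Seminorm ℝ (Fin (n j) → ℝ)) (η : Fin k → ℝ) (ε T : ℝ)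
    (θ : BlockIndex m → BlockIndex n → ℝ) : Set ((BlockIndex m → ℤ) × (BlockIndex n → ℤ)) :=
  {v | v.2 ∈ qFinset NN T ∧ linForm (Matrix.of θ) v.1 v.2 ∈ region NM η (ε / qProd NN v.2)}

lemma continuous_linForm (p : BlockIndex m → ℤ) (q : BlockIndex n → ℤ) :
    Continuous fun θ : BlockIndex m → BlockIndex n → ℝ => linForm (Matrix.of θ) p q := by
  refine continuous_pi fun i => ?_
  simp only [linForm_of_apply]
  fun_prop

lemma measurable_tsum_linForm {A : Set (BlockIndex m → ℝ)} (hA : MeasurableSet A) (q : BlockIndex n → ℤ) :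
    Measurable fun θ : BlockIndex m → BlockIndex n → ℝ =>
      ∑' p, A.indicator (1 : (BlockIndex m → ℝ) → ℝ≥0∞) (linForm (Matrix.of θ) p q) :=
  Measurable.tsum fun p => (measurable_one.indicator hA).comp (continuous_linForm p q).measurable

lemma measurableSet_mem_solSet (T : ℝ) (v : (BlockIndex m → ℤ) × (BlockIndex n → ℤ)) :
    MeasurableSet {θ | v ∈ solSet NM NN η ε T θ} := by
  by_cases h : v.2 ∈ qFinset NN T
  · have : {θ | v ∈ solSet NM NN η ε T θ} = (fun θ => linForm (Matrix.of θ) v.1 v.2) ⁻¹'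
        region NM η (ε / qProd NN v.2) := by
      ext θ; exact and_iff_right h
    rw [this]
    exact (continuous_linForm v.1 v.2).measurable (measurableSet_region NM η _)
  · have : {θ | v ∈ solSet NM NN η ε T θ} = ∅ := by
      ext θ; exact iff_of_false (fun h' => h h'.1) id
    rw [this]; exact .empty

lemma measurable_tsum_solSet (T : ℝ) (f : (BlockIndex m → ℤ) × (BlockIndex n → ℤ) → ℝ≥0∞) :
    Measurable fun θ => ∑' v, (solSet NM NN η ε T θ).indicator f v := by
  refine Measurable.tsum fun v => ?_
  have : (fun θ => (solSet NM NN η ε T θ).indicator f v) =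
      {θ | v ∈ solSet NM NN η ε T θ}.indicator fun _ => f v := by
    ext θ; rfl
  rw [this]
  exact measurable_const.indicator (measurableSet_mem_solSet T v)

lemma tsum_solSet (T : ℝ) (θ : BlockIndex m → BlockIndex n → ℝ)
    (f : (BlockIndex m → ℤ) × (BlockIndex n → ℤ) → ℝ≥0∞) :
    ∑' v, (solSet NM NN η ε T θ).indicator f v = ∑ q ∈ qFinset NN T, ∑' p, f (p, q) *
      (region NM η (ε / qProd NN q)).indicator 1 (linForm (Matrix.of θ) p q) := by
  rw [ENNReal.tsum_prod', ENNReal.tsum_comm, tsum_eq_sum (s := qFinset NN T)]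
  · refine Finset.sum_congr rfl fun q hq => tsum_congr fun p => ?_
    by_cases h : linForm (Matrix.of θ) p q ∈ region NM η (ε / qProd NN q)
    · rw [Set.indicator_of_mem h, Set.indicator_of_mem (show (p, q) ∈ solSet NM NN η ε T θ from ⟨hq, h⟩)]
      simp
    · rw [Set.indicator_of_notMem h, Set.indicator_of_notMem fun h' => h h'.2, mul_zero]
  · intro q hq
    exact ENNReal.tsum_eq_zero.2 fun p => Set.indicator_of_notMem (fun h' => hq h'.1) _

lemma lintegral_tsum_solSet (hNM : ∀ i x, NM i x = 0 → x = 0) (hm : ∀ i, 0 < m i)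
    (hNN : ∀ j y, NN j y = 0 → y = 0) (hr : 0 < r) (hη : ∀ i, 0 < η i) (hε : 0 < ε) (T : ℝ)
    (t : BlockIndex m → BlockIndex n → ℝ) :
    ∫⁻ θ, ∑' v, (solSet NM NN η ε T θ).indicator 1 v ∂(unitCube t) =
      ENNReal.ofReal (∑ q ∈ qFinset NN T, regVol NM η (ε / qProd NN q)) := by
  simp_rw [tsum_solSet, Pi.one_apply, one_mul]
  rw [lintegral_finsetSum _ fun q _ => measurable_tsum_linForm (measurableSet_region NM η _) q,
    ENNReal.ofReal_sum_of_nonneg fun q hq => regVol_nonneg hNM hη (div_pos hε (qProd_pos hNN hq))]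
  refine Finset.sum_congr rfl fun q hq => ?_
  rw [lintegral_tsum_linForm (measurableSet_region NM η _) q (qFinset_ne_zero hNN hr hq),
    volume_region hNM hm hη (div_pos hε (qProd_pos hNN hq))]
  rfl

lemma sum_pairSum_eq (T : ℝ) (θ : BlockIndex m → BlockIndex n → ℝ) :
    open Classical in
    ∑ q ∈ qFinset NN T, ∑ q' ∈ qFinset NN T, pairSum NM NN η ε θ q q' =
    ∑' v, (solSet NM NN η ε T θ).indicator (fun v => ∑' v', (solSet NM NN η ε T θ).indicator
      (fun v' => if IntDep v v' then 0 else 1) v') v := by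
  classical
  simp_rw [tsum_solSet]
  refine Finset.sum_congr rfl fun q hq => ?_
  simp_rw [Finset.sum_mul]
  rw [Summable.tsum_finsetSum fun _ _ => ENNReal.summable]
  refine Finset.sum_congr rfl fun q' hq' => ?_
  unfold pairSum
  rw [ENNReal.tsum_prod']
  refine tsum_congr fun p => ?_
  rw [← ENNReal.tsum_mul_right]
  refine tsum_congr fun p' => ?_
  split_ifs
  · simp
  · rw [one_mul, mul_comm]

lemma measurable_pairSum (q q' : BlockIndex n → ℤ) :
    Measurable fun θ => pairSum NM NN η ε θ q q' := by
  unfold pairSum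
  refine Measurable.tsum fun pp => ?_
  split_ifs
  · exact measurable_const
  · exact ((measurable_one.indicator (measurableSet_region NM η _)).comp
      (continuous_linForm pp.1 q).measurable).mul
      ((measurable_one.indicator (measurableSet_region NM η _)).comp
      (continuous_linForm pp.2 q').measurable)

/-- `v` is divisible by an integer larger than `C`. -/
def BigContent (C : ℕ) (v : (BlockIndex m → ℤ) × (BlockIndex n → ℤ)) : Prop :=
  ∃ c : ℤ, (C : ℤ) < |c| ∧ ∃ w, v = c • w

/-- Both vectors are multiples a w and b w of one integer vector; a and b divide them, so neither
exceeds C in absolute value. -/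
lemma IntDep.exists_coeff {C : ℕ} {v v' : (BlockIndex m → ℤ) × (BlockIndex n → ℤ)} (hv : v.2 ≠ 0)
    (hv' : v'.2 ≠ 0) (h : IntDep v v') (hC : ¬ BigContent C v) (hC' : ¬ BigContent C v') :
    ∃ a ∈ Finset.Icc (-C : ℤ) C, ∃ b ∈ Finset.Icc (-C : ℤ) C, a ≠ 0 ∧ b • v = a • v' := by
  have e : IntDep (Sum.elim v.1 v.2) (Sum.elim v'.1 v'.2) := by
    obtain ⟨a, b, hab, h⟩ := h
    refine ⟨a, b, hab, ?_⟩
    ext (i | j)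
    · simpa using congrFun (congrArg Prod.fst h) i
    · simpa using congrFun (congrArg Prod.snd h) j
  obtain ⟨w, a, b, hab, ha, hb, h1, h2⟩ := e.exists_eq_smul
    (fun h0 => hv (funext fun j => by simpa using congrFun h0 (Sum.inr j)))
    (fun h0 => hv' (funext fun j => by simpa using congrFun h0 (Sum.inr j)))
  have h1' : v = a • (fun i => w (Sum.inl i), fun j => w (Sum.inr j)) := by
    ext i
    · simpa using congrFun h1 (Sum.inl i)
    · simpa using congrFun h1 (Sum.inr i)
  have h2' : v' = b • (fun i => w (Sum.inl i), fun j => w (Sum.inr j)) := by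
    ext i
    · simpa using congrFun h2 (Sum.inl i)
    · simpa using congrFun h2 (Sum.inr i)
  refine ⟨a, ?_, b, ?_, ha.ne', ?_⟩
  · rw [Finset.mem_Icc, ← abs_le]
    by_contra! hlt
    exact hC ⟨a, hlt, _, h1'⟩
  · rw [Finset.mem_Icc, ← abs_le]
    by_contra! hlt
    exact hC' ⟨b, hlt, _, h2'⟩
  · rw [h1', h2', smul_comm]

lemma tsum_smul_eq_le_one {M : Type} [AddCommGroup M] [IsAddTorsionFree M] [DecidableEq M] (x : M) {a : ℤ}
    (ha : a ≠ 0) : ∑' v : M, (if x = a • v then 1 else 0 : ℝ≥0∞) ≤ 1 := by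
  by_cases h : ∃ v₀, x = a • v₀
  · obtain ⟨v₀, rfl⟩ := h
    have (v : M) : a • v₀ = a • v ↔ v = v₀ := by
      rw [eq_comm]; exact (zsmul_right_injective ha).eq_iff
    simp_rw [this, tsum_ite_eq]
    exact le_rfl
  · push Not at h
    simp [h]

-- The square counts ordered pairs. Non-proportional pairs are collected by `pairSum`; a
-- proportional partner of v solves b v = a v' with a, b in [-C, C] and a ≠ 0, and each (a, b)
-- admits at most one v'.
open Classical in
lemma tsum_solSet_sq_le (hNN : ∀ j y, NN j y = 0 → y = 0) (hr : 0 < r) (T : ℝ) (C : ℕ)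
    (θ : BlockIndex m → BlockIndex n → ℝ) :
    (∑' v, (solSet NM NN η ε T θ).indicator (fun v => if BigContent C v then 0 else 1) v) ^ 2 ≤
      ∑ q ∈ qFinset NN T, ∑ q' ∈ qFinset NN T, pairSum NM NN η ε θ q q' +
      (2 * C + 1) ^ 2 * ∑' v, (solSet NM NN η ε T θ).indicator 1 v := by
  rw [sum_pairSum_eq, sq, ← ENNReal.tsum_mul_right, ← ENNReal.tsum_mul_left, ← ENNReal.tsum_add]
  refine ENNReal.tsum_le_tsum fun v => ?_
  by_cases hv : v ∈ solSet NM NN η ε T θ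
  swap
  · simp [hv]
  simp only [Set.indicator_of_mem hv, Pi.one_apply, mul_one]
  by_cases hB : BigContent C v
  · simp [hB]
  rw [if_neg hB, one_mul]
  calc ∑' v', (solSet NM NN η ε T θ).indicator (fun v => if BigContent C v then 0 else 1 : _ → ℝ≥0∞) v'
      ≤ ∑' v', ((solSet NM NN η ε T θ).indicator (fun v' => if IntDep v v' then 0 else 1 : _ → ℝ≥0∞) v' +
        ∑ a ∈ (Finset.Icc (-C : ℤ) C).filter (· ≠ 0), ∑ b ∈ Finset.Icc (-C : ℤ) C,
          if b • v = a • v' then 1 else 0) := by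
        refine ENNReal.tsum_le_tsum fun v' => ?_
        by_cases hv' : v' ∈ solSet NM NN η ε T θ
        swap
        · simp [hv']
        simp only [Set.indicator_of_mem hv']
        split_ifs with h1 h2 h2
        · exact zero_le
        · exact zero_le
        · obtain ⟨a, ha, b, hb, ha0, hab⟩ := IntDep.exists_coeff (qFinset_ne_zero hNN hr hv.1)
            (qFinset_ne_zero hNN hr hv'.1) h2 hB h1
          refine le_add_left ?_
          refine le_trans ?_ (Finset.single_le_sum (fun _ _ => zero_le)
            (Finset.mem_filter.2 ⟨ha, ha0⟩))
          refine le_trans ?_ (Finset.single_le_sum (fun _ _ => zero_le) hb)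
          rw [if_pos hab]
        · exact le_self_add
    _ = ∑' v', (solSet NM NN η ε T θ).indicator (fun v' => if IntDep v v' then 0 else 1 : _ → ℝ≥0∞) v' +
        ∑ a ∈ (Finset.Icc (-C : ℤ) C).filter (· ≠ 0), ∑ b ∈ Finset.Icc (-C : ℤ) C,
          ∑' v', if b • v = a • v' then 1 else 0 := by
        rw [ENNReal.tsum_add, Summable.tsum_finsetSum fun _ _ => ENNReal.summable]
        simp_rw [Summable.tsum_finsetSum fun _ _ => ENNReal.summable]
    _ ≤ _ := by
        gcongr
        calc _ ≤ ∑ a ∈ (Finset.Icc (-C : ℤ) C).filter (· ≠ 0), ∑ b ∈ Finset.Icc (-C : ℤ) C, (1 : ℝ≥0∞) :=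
              Finset.sum_le_sum fun a ha => Finset.sum_le_sum fun b _ =>
                tsum_smul_eq_le_one _ (Finset.mem_filter.1 ha).2
          _ ≤ ∑ a ∈ Finset.Icc (-C : ℤ) C, ∑ b ∈ Finset.Icc (-C : ℤ) C, (1 : ℝ≥0∞) :=
              Finset.sum_le_sum_of_subset (Finset.filter_subset _ _)
          _ = (2 * C + 1) ^ 2 := by
              simp only [Finset.sum_const, Int.card_Icc, nsmul_eq_mul, mul_one]
              rw [show ((C : ℤ) + 1 - -C).toNat = 2 * C + 1 by omega]
              push_cast; ring

-- A vector of content above C is c w with c > C. For fixed c, the scaling of ℝ^m gives at least one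
-- factor 1/c and the norm product of c q gives at least another, so the expected number is
-- O(T^(k+r-1)/c^2); summing over c > C gives 1/C.
open Classical in
lemma exists_lintegral_bigContent_le (hNM : ∀ i x, NM i x = 0 → x = 0) (hNN : ∀ j y, NN j y = 0 → y = 0)
    (hm : ∀ i, 0 < m i) (hn : ∀ j, 0 < n j) (hη : ∀ i, 0 < η i) (hk : 0 < k) (hr : 0 < r) (hε : 0 < ε) :
    ∃ K : ℝ, 0 < K ∧ ∀ T, 1 ≤ T → ∀ C : ℕ, 1 ≤ C → ∀ t : BlockIndex m → BlockIndex n → ℝ,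
      ∫⁻ θ, ∑' v, (solSet NM NN η ε T θ).indicator (fun v => if BigContent C v then 1 else 0) v ∂(unitCube t) ≤
        ENNReal.ofReal (K * T ^ (k + r - 1) / C) := by
  obtain ⟨t₀, ht₀, hexp⟩ := exists_le_exp_of_smul_mem hNN hr
  obtain ⟨B, hB0, hB⟩ := exists_abs_log_qProd_le hNN
  obtain ⟨K, hK, hreg⟩ := exists_regVol_le hNM hη hk hε B
  obtain ⟨G, hG, hsumG⟩ := exists_qSum_inv_le hNN hn
  refine ⟨K * G, by positivity, fun T hT C hC t => ?_⟩
  -- Divisors above the exponential bound do not occur. The maximum with C ensures C ≤ A, as the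
  -- tail estimate for inverse squares requires.
  set A := max C ⌊Real.exp (T - t₀)⌋₊ with hAdef
  have hA : ∀ (w : BlockIndex n → ℤ) (a : ℤ), a ≠ 0 → a • w ∈ qFinset NN T → a ≤ A := fun w a ha h => by
    have := Int.le_floor.2 (hexp T w a ha h)
    have h2 : ⌊Real.exp (T - t₀)⌋₊ ≤ A := le_max_right _ _
    rw [← Int.floor_toNat] at h2
    omega
  have hpt (θ : BlockIndex m → BlockIndex n → ℝ) :
      ∑' v, (solSet NM NN η ε T θ).indicator (fun v => if BigContent C v then 1 else 0 : _ → ℝ≥0∞) v ≤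
      ∑ c ∈ Finset.Ioc C A, ∑ q ∈ (qFinset NN T).filter fun q => (c : ℤ) • q ∈ qFinset NN T,
        ∑' p, (((c : ℝ) • · : (BlockIndex m → ℝ) → (BlockIndex m → ℝ)) ⁻¹'
          (region NM η (ε / qProd NN ((c : ℤ) • q)))).indicator 1 (linForm (Matrix.of θ) p q) := by
    calc _ ≤ ∑' v, ∑ c ∈ Finset.Ioc C A, ∑' w, (if v = (c : ℤ) • w then
            (solSet NM NN η ε T θ).indicator 1 ((c : ℤ) • w) else 0 : ℝ≥0∞) := by
          refine ENNReal.tsum_le_tsum fun v => ?_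
          by_cases hv : v ∈ solSet NM NN η ε T θ
          swap
          · simp [hv]
          rw [Set.indicator_of_mem hv]
          split_ifs with hbig
          swap
          · exact zero_le
          obtain ⟨c, hc, w, rfl⟩ := hbig
          have hcw : c • w = (c.natAbs : ℤ) • (c.sign • w) := by
            rw [smul_smul, mul_comm, Int.sign_mul_natAbs]
          rw [hcw] at hv ⊢
          have hc1 : (C : ℤ) < c.natAbs := by rwa [Int.natCast_natAbs]
          have hc2 := hA (c.sign • w.2) c.natAbs (by omega) hv.1
          refine le_trans ?_ (Finset.single_le_sum (fun _ _ => zero_le)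
            (Finset.mem_Ioc.2 ⟨by omega, by omega⟩ : c.natAbs ∈ Finset.Ioc C A))
          refine le_trans ?_ (ENNReal.le_tsum (c.sign • w))
          rw [if_pos rfl, Set.indicator_of_mem hv]
          exact le_rfl
      _ = ∑ c ∈ Finset.Ioc C A, ∑' w, (solSet NM NN η ε T θ).indicator 1 ((c : ℤ) • w) := by
          rw [Summable.tsum_finsetSum fun _ _ => ENNReal.summable]
          refine Finset.sum_congr rfl fun c _ => ?_
          rw [ENNReal.tsum_comm]
          refine tsum_congr fun w => ?_
          rw [tsum_ite_eq]
      _ ≤ _ := by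
          refine Finset.sum_le_sum fun c hc => ?_
          have hc0 : (c : ℤ) ≠ 0 := by have := (Finset.mem_Ioc.1 hc).1; omega
          rw [ENNReal.tsum_prod', ENNReal.tsum_comm, tsum_eq_sum (s := (qFinset NN T).filter
            fun q => (c : ℤ) • q ∈ qFinset NN T)]
          · refine Finset.sum_le_sum fun q hq => ENNReal.tsum_le_tsum fun p => ?_
            by_cases h : (c : ℤ) • (p, q) ∈ solSet NM NN η ε T θ
            swap
            · rw [Set.indicator_of_notMem h]; exact zero_le
            have h2 := h.2
            rw [Set.indicator_of_mem h, Set.indicator_of_mem]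
            · exact le_rfl
            · rw [Set.mem_preimage]
              convert! h2 using 1
              ext i
              simp only [linForm_of_apply, Pi.smul_apply, Prod.smul_mk, smul_eq_mul, Finset.mul_sum, mul_add]
              push_cast
              congr 1
              refine Finset.sum_congr rfl fun j _ => by ring
          · intro q hq
            refine ENNReal.tsum_eq_zero.2 fun p => Set.indicator_of_notMem (fun h => hq ?_) _
            exact Finset.mem_filter.2 ⟨mem_qFinset_of_smul_mem hNN hc0 h.1, h.1⟩
  refine (lintegral_mono hpt).trans ?_
  have hmeas (c : ℝ) (δ : ℝ) : MeasurableSet (((c : ℝ) • · : (BlockIndex m → ℝ) → (BlockIndex m → ℝ)) ⁻¹'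
      (region NM η δ)) := (measurableSet_region NM η δ).preimage (measurable_const_smul c)
  rw [lintegral_finsetSum _ fun c _ => Finset.measurable_sum _ fun q _ =>
    measurable_tsum_linForm (hmeas _ _) q]
  calc _ ≤ ∑ c ∈ Finset.Ioc C A, ENNReal.ofReal (K * G * T ^ (k + r - 1) * ((c : ℝ) ^ 2)⁻¹) := by
        refine Finset.sum_le_sum fun c hc => ?_
        have hc0 : 1 ≤ c := by have := (Finset.mem_Ioc.1 hc).1; omega
        have hcR : (1 : ℝ) ≤ c := by exact_mod_cast hc0
        rw [lintegral_finsetSum _ fun q _ => measurable_tsum_linForm (hmeas _ _) q]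
        calc _ ≤ ∑ q ∈ (qFinset NN T).filter fun q => (c : ℤ) • q ∈ qFinset NN T,
              ENNReal.ofReal (K * T ^ (k - 1) * ((c : ℝ) ^ 2)⁻¹ * (qProd NN q)⁻¹) := by
              refine Finset.sum_le_sum fun q hq => ?_
              obtain ⟨hq, hcq⟩ := Finset.mem_filter.1 hq
              have hpq := qProd_pos hNN hq
              have hpcq := qProd_pos hNN hcq
              have hcard : 1 ≤ Fintype.card (BlockIndex m) :=
                Fintype.card_pos_iff.2 ⟨⟨⟨0, hk⟩, ⟨0, hm _⟩⟩⟩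
              rw [lintegral_tsum_linForm (hmeas _ _) q (qFinset_ne_zero hNN hr hq),
                Measure.addHaar_preimage_smul _ (by positivity), volume_region hNM hm hη (by positivity),
                ← ENNReal.ofReal_mul (abs_nonneg _)]
              refine ENNReal.ofReal_le_ofReal ?_
              change _ * regVol NM η _ ≤ _
              have h1 := hreg T hT _ hpcq ((le_abs_self _).trans (hB T hT _ hcq))
              have hpa : c * qProd NN q ≤ qProd NN ((c : ℤ) • q) := by
                rw [qProd_smul, Int.cast_natCast, abs_of_pos (by linarith)]
                gcongr
                refine le_self_pow₀ hcR ?_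
                exact (Finset.sum_pos (fun j _ => hn j) ⟨⟨0, hr⟩, Finset.mem_univ _⟩).ne'
              rw [Module.finrank_fintype_fun_eq_card, abs_of_pos (by positivity)]
              calc _ ≤ ((c : ℝ) ^ 1)⁻¹ * (K * T ^ (k - 1) / (c * qProd NN q)) := by
                    gcongr
                    · exact regVol_nonneg hNM hη (by positivity)
                    · exact h1.trans (by gcongr)
                _ = _ := by field_simp
          _ = ENNReal.ofReal (∑ q ∈ (qFinset NN T).filter fun q => (c : ℤ) • q ∈ qFinset NN T,
              K * T ^ (k - 1) * ((c : ℝ) ^ 2)⁻¹ * (qProd NN q)⁻¹) := by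
              rw [ENNReal.ofReal_sum_of_nonneg]
              intro q hq
              have := qProd_pos hNN (Finset.mem_filter.1 hq).1
              positivity
          _ ≤ _ := by
              refine ENNReal.ofReal_le_ofReal ?_
              rw [← Finset.mul_sum]
              calc _ ≤ K * T ^ (k - 1) * ((c : ℝ) ^ 2)⁻¹ * (G * T ^ r) := by
                    gcongr
                    refine le_trans ?_ (hsumG T hT)
                    refine Finset.sum_le_sum_of_subset_of_nonneg (Finset.filter_subset _ _) fun q hq _ => ?_
                    have := qProd_pos hNN hq
                    positivity
                _ = _ := by
                    rw [show k + r - 1 = (k - 1) + r by omega, pow_add]; ring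
    _ = ENNReal.ofReal (∑ c ∈ Finset.Ioc C A, K * G * T ^ (k + r - 1) * ((c : ℝ) ^ 2)⁻¹) := by
        rw [ENNReal.ofReal_sum_of_nonneg]
        intro c _
        positivity
    _ ≤ _ := by
        refine ENNReal.ofReal_le_ofReal ?_
        rw [← Finset.mul_sum, div_eq_mul_inv]
        gcongr
        refine (sum_Ioc_inv_sq_le_sub (by omega) (le_max_left _ _)).trans ?_
        rw [sub_le_self_iff]
        positivity

end

/-- After the substitution x = T^e, convergence along geometric sequences with ratios tending to 1
suffices for a monotone function of integers. Real T is then squeezed between the floor of T^e and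
its successor. -/
lemma tendsto_div_pow_of_floor_pow {N : ℝ → ℝ} (hN : Monotone N) {e : ℕ} (he : 0 < e) {L : ℝ}
    {c : ℕ → ℝ} (cone : ∀ j, 1 < c j) (clim : Tendsto c atTop (𝓝 1))
    (h : ∀ j, Tendsto (fun i : ℕ => N ((⌊c j ^ i⌋₊ : ℝ) ^ (e : ℝ)⁻¹) / ⌊c j ^ i⌋₊) atTop (𝓝 L)) :
    Tendsto (fun T => N T / T ^ e) atTop (𝓝 L) := by
  have hu := tendsto_div_of_monotone_of_tendsto_div_floor_pow (fun i : ℕ => N ((i : ℝ) ^ (e : ℝ)⁻¹)) L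
    (fun a b hab => hN (by gcongr)) c cone clim h
  have hpow : Tendsto (fun T : ℝ => T ^ e) atTop atTop := tendsto_pow_atTop he.ne'
  have hfl : Tendsto (fun T : ℝ => ⌊T ^ e⌋₊) atTop atTop := tendsto_nat_floor_atTop.comp hpow
  have hdiv : Tendsto (fun T : ℝ => (⌊T ^ e⌋₊ : ℝ) / T ^ e) atTop (𝓝 1) :=
    (tendsto_nat_floor_div_atTop (R := ℝ)).comp hpow
  have hlow := (hu.comp hfl).mul hdiv
  have hinv : Tendsto (fun T : ℝ => (1 : ℝ) / T ^ e) atTop (𝓝 0) := hpow.const_div_atTop 1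
  have hup := (hu.comp ((tendsto_add_atTop_nat 1).comp hfl)).mul (hdiv.add hinv)
  rw [mul_one] at hlow
  rw [add_zero, mul_one] at hup
  have e0 : (e : ℝ) ≠ 0 := by exact_mod_cast he.ne'
  refine tendsto_of_tendsto_of_tendsto_of_le_of_le' hlow hup ?_ ?_
  · filter_upwards [eventually_ge_atTop 1] with T hT
    have hTe : 1 ≤ T ^ e := one_le_pow₀ hT
    have hfp : (0 : ℝ) < ⌊T ^ e⌋₊ := by exact_mod_cast Nat.floor_pos.2 hTe
    have h1 : (⌊T ^ e⌋₊ : ℝ) ^ (e : ℝ)⁻¹ ≤ T := by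
      calc (⌊T ^ e⌋₊ : ℝ) ^ (e : ℝ)⁻¹ ≤ (T ^ e) ^ (e : ℝ)⁻¹ := by
            gcongr; exact Nat.floor_le (by positivity)
        _ = T := Real.pow_rpow_inv_natCast (by linarith) he.ne'
    have h2 := hN h1
    simp only [Function.comp_apply]
    rw [div_mul_div_cancel₀ hfp.ne']
    gcongr
  · filter_upwards [eventually_ge_atTop 1] with T hT
    have hTe : 1 ≤ T ^ e := one_le_pow₀ hT
    have h1 : T ≤ ((⌊T ^ e⌋₊ + 1 : ℕ) : ℝ) ^ (e : ℝ)⁻¹ := by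
      calc T = (T ^ e) ^ (e : ℝ)⁻¹ := (Real.pow_rpow_inv_natCast (by linarith) he.ne').symm
        _ ≤ _ := by
          gcongr
          push_cast
          exact (Nat.lt_floor_add_one _).le
    have h2 := hN h1
    simp only [Function.comp_apply]
    rw [← add_div]
    push_cast at h2 ⊢
    rw [div_mul_div_cancel₀ (by positivity)]
    gcongr

/-! ### Mean square estimate for the truncated count. -/

section

variable {k r : ℕ} {m : Fin k → ℕ} {n : Fin r → ℕ}
  {NM : (i : Fin k) → Seminorm ℝ (Fin (m i) → ℝ)} {NN : (j : Fin r) → Seminorm ℝ (Fin (n j) → ℝ)}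
  {η : Fin k → ℝ} {ε : ℝ}

lemma exists_firstMoment_le (hNM : ∀ i x, NM i x = 0 → x = 0) (hNN : ∀ j y, NN j y = 0 → y = 0)
    (hn : ∀ j, 0 < n j) (hη : ∀ i, 0 < η i) (hk : 0 < k) (hr : 0 < r) (hε : 0 < ε) :
    ∃ K : ℝ, 0 < K ∧ ∀ T, 1 ≤ T →
      ∑ q ∈ qFinset NN T, regVol NM η (ε / qProd NN q) ≤ K * T ^ (k + r - 1) := by
  refine exists_le_mul_pow_of_tendsto (fun S T h => ?_) (tendsto_firstMoment hNM hNN hn hη hk hr hε)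
  exact Finset.sum_le_sum_of_subset_of_nonneg (qFinset_mono hNN h) fun q hq _ =>
    regVol_nonneg hNM hη (div_pos hε (qProd_pos hNN hq))

open Classical in
/-- The number of approximates whose content is at most `C`. -/
noncomputable def truncCount (NM : (i : Fin k) → Seminorm ℝ (Fin (m i) → ℝ))
    (NN : (j : Fin r) → Seminorm ℝ (Fin (n j) → ℝ)) (η : Fin k → ℝ) (ε T : ℝ) (C : ℕ)
    (θ : BlockIndex m → BlockIndex n → ℝ) : ℝ≥0∞ :=
  ∑' v, (solSet NM NN η ε T θ).indicator (fun v => if BigContent C v then 0 else 1) v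

open Classical in
/-- The number of approximates whose content exceeds `C`. -/
noncomputable def tailCount (NM : (i : Fin k) → Seminorm ℝ (Fin (m i) → ℝ))
    (NN : (j : Fin r) → Seminorm ℝ (Fin (n j) → ℝ)) (η : Fin k → ℝ) (ε T : ℝ) (C : ℕ)
    (θ : BlockIndex m → BlockIndex n → ℝ) : ℝ≥0∞ :=
  ∑' v, (solSet NM NN η ε T θ).indicator (fun v => if BigContent C v then 1 else 0) v

lemma truncCount_add_tailCount (T : ℝ) (C : ℕ) (θ : BlockIndex m → BlockIndex n → ℝ) :
    truncCount NM NN η ε T C θ + tailCount NM NN η ε T C θ =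
      ∑' v, (solSet NM NN η ε T θ).indicator 1 v := by
  unfold truncCount tailCount
  rw [← ENNReal.tsum_add]
  refine tsum_congr fun v => ?_
  by_cases hv : v ∈ solSet NM NN η ε T θ
  · simp only [Set.indicator_of_mem hv]
    split_ifs <;> simp
  · simp [hv]

/-- This is the expansion of (F - M)^2 arranged without subtraction; when F is infinite the right
side is infinite too. -/
lemma ofReal_sub_sq_add_le {F : ℝ≥0∞} {M : ℝ} (hM : 0 ≤ M) :
    ENNReal.ofReal ((F.toReal - M) ^ 2) + 2 * ENNReal.ofReal M * F ≤ F ^ 2 + ENNReal.ofReal (M ^ 2) := by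
  induction F with
  | top => simp
  | coe f =>
    have hf : 0 ≤ (f : ℝ) := f.coe_nonneg
    rw [← ENNReal.ofReal_coe_nnreal]
    generalize (f : ℝ) = x at hf
    rw [ENNReal.toReal_ofReal hf, ← ENNReal.ofReal_pow hf,
      ← ENNReal.ofReal_ofNat 2, ← ENNReal.ofReal_mul (by norm_num), ← ENNReal.ofReal_mul (by positivity),
      ← ENNReal.ofReal_add (by positivity) (by positivity),
      ← ENNReal.ofReal_add (by positivity) (by positivity)]
    exact ENNReal.ofReal_le_ofReal (by linarith [sq_nonneg (x - M), sub_sq x M])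

/-- Expanding the square, M^2 cancels between the second moment and the cross term, because the
truncated mean is M minus the mean of the tail. What remains is the parallel error, the proportional
pairs and M times the tail; C^3 ≤ T makes each of them O(T^(2(k+r-1))/C). -/
lemma exists_lintegral_truncCount_le (hNM : ∀ i x, NM i x = 0 → x = 0) (hNN : ∀ j y, NN j y = 0 → y = 0)
    (hm : ∀ i, 0 < m i) (hn : ∀ j, 0 < n j) (hη : ∀ i, 0 < η i) (hk : 0 < k) (hr : 0 < r) (hε : 0 < ε) :
    ∃ K : ℝ, 0 < K ∧ ∀ T, 1 ≤ T → ∀ C : ℕ, 1 ≤ C → (C : ℝ) ^ 3 ≤ T →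
      ∀ t : BlockIndex m → BlockIndex n → ℝ,
      ∫⁻ θ, ENNReal.ofReal (((truncCount NM NN η ε T C θ).toReal -
        ∑ q ∈ qFinset NN T, regVol NM η (ε / qProd NN q)) ^ 2) ∂(unitCube t) ≤
        ENNReal.ofReal (K * (T ^ (k + r - 1)) ^ 2 / C) := by
  obtain ⟨K₁, hK₁, h₁⟩ := exists_sum_pairSum_le hNM hNN hm hn hη hk hr hε
  obtain ⟨K₂, hK₂, h₂⟩ := exists_lintegral_bigContent_le hNM hNN hm hn hη hk hr hε
  obtain ⟨K₀, hK₀, h₀⟩ := exists_firstMoment_le hNM hNN hn hη hk hr hε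
  refine ⟨K₁ + 9 * K₀ + 2 * K₀ * K₂, by positivity, fun T hT C hC hCT t => ?_⟩
  set M := ∑ q ∈ qFinset NN T, regVol NM η (ε / qProd NN q) with hMdef
  have hM : 0 ≤ M := Finset.sum_nonneg fun q hq =>
    regVol_nonneg hNM hη (div_pos hε (qProd_pos hNN hq))
  have hMK := h₀ T hT
  rw [← hMdef] at hMK
  have hCR : (1 : ℝ) ≤ C := by exact_mod_cast hC
  set X := ∫⁻ θ, ENNReal.ofReal (((truncCount NM NN η ε T C θ).toReal - M) ^ 2) ∂(unitCube t) with hX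
  have hmF : Measurable (truncCount NM NN η ε T C) := measurable_tsum_solSet T _
  have hEN : ∫⁻ θ, truncCount NM NN η ε T C θ ∂(unitCube t) +
      ∫⁻ θ, tailCount NM NN η ε T C θ ∂(unitCube t) = ENNReal.ofReal M := by
    rw [← lintegral_add_left hmF, ← lintegral_tsum_solSet hNM hm hNN hr hη hε T t]
    exact lintegral_congr fun θ => truncCount_add_tailCount T C θ
  have hER := h₂ T hT C hC t
  have hEF2 : ∫⁻ θ, truncCount NM NN η ε T C θ ^ 2 ∂(unitCube t) ≤
      ENNReal.ofReal (M ^ 2 + K₁ * T ^ (2 * (k + r - 1) - 1)) +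
        ENNReal.ofReal ((2 * C + 1) ^ 2 * M) := by
    calc _ ≤ ∫⁻ θ, (∑ q ∈ qFinset NN T, ∑ q' ∈ qFinset NN T, pairSum NM NN η ε θ q q' +
        (2 * C + 1) ^ 2 * ∑' v, (solSet NM NN η ε T θ).indicator 1 v) ∂(unitCube t) :=
          lintegral_mono fun θ => tsum_solSet_sq_le hNN hr T C θ
      _ = ∑ q ∈ qFinset NN T, ∑ q' ∈ qFinset NN T, ∫⁻ θ, pairSum NM NN η ε θ q q' ∂(unitCube t) +
        (2 * C + 1) ^ 2 * ENNReal.ofReal M := by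
          rw [lintegral_add_left (Finset.measurable_sum _ fun q _ => Finset.measurable_sum _ fun q' _ =>
            measurable_pairSum q q'), lintegral_const_mul _ (measurable_tsum_solSet T _),
            lintegral_tsum_solSet hNM hm hNN hr hη hε T t,
            lintegral_finsetSum _ fun q _ => Finset.measurable_sum _ fun q' _ => measurable_pairSum q q']
          congr 1
          exact Finset.sum_congr rfl fun q _ => lintegral_finsetSum _ fun q' _ => measurable_pairSum q q'
      _ ≤ _ := by
          gcongr
          · exact h₁ T hT t
          · rw [ENNReal.ofReal_mul (by positivity)]
            gcongr
            rw [← ENNReal.ofReal_natCast C, ← ENNReal.ofReal_ofNat 2, ← ENNReal.ofReal_mul (by norm_num),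
              ← ENNReal.ofReal_one, ← ENNReal.ofReal_add (by positivity) (by positivity),
              ENNReal.ofReal_pow (by positivity)]
  have hkey : X + 2 * ENNReal.ofReal M * ∫⁻ θ, truncCount NM NN η ε T C θ ∂(unitCube t) ≤
      ∫⁻ θ, truncCount NM NN η ε T C θ ^ 2 ∂(unitCube t) + ENNReal.ofReal (M ^ 2) := by
    rw [hX, ← lintegral_const_mul _ hmF, ← lintegral_add_right _ (hmF.const_mul _)]
    refine (lintegral_mono fun θ => ofReal_sub_sq_add_le hM).trans_eq ?_
    rw [lintegral_add_right _ measurable_const, lintegral_const, measure_univ, mul_one]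
  set B := K₁ * T ^ (2 * (k + r - 1) - 1) + (2 * C + 1) ^ 2 * M + 2 * M * (K₂ * T ^ (k + r - 1) / C) with hB
  -- Subtraction in `ℝ≥0∞` is avoided by adding 2M^2, written as 2M times the sum of the truncated
  -- and tail means, to both sides.
  have hB' : X + ENNReal.ofReal (2 * M ^ 2) ≤ ENNReal.ofReal B + ENNReal.ofReal (2 * M ^ 2) := by
    calc X + ENNReal.ofReal (2 * M ^ 2) = X + 2 * ENNReal.ofReal M *
          (∫⁻ θ, truncCount NM NN η ε T C θ ∂(unitCube t) +
            ∫⁻ θ, tailCount NM NN η ε T C θ ∂(unitCube t)) := by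
          rw [hEN, ENNReal.ofReal_mul (by norm_num), ENNReal.ofReal_ofNat, ENNReal.ofReal_pow hM]
          ring
      _ ≤ (∫⁻ θ, truncCount NM NN η ε T C θ ^ 2 ∂(unitCube t) + ENNReal.ofReal (M ^ 2)) +
          2 * ENNReal.ofReal M * ENNReal.ofReal (K₂ * T ^ (k + r - 1) / C) := by
          rw [mul_add, ← add_assoc]
          gcongr
          exact hER
      _ ≤ (ENNReal.ofReal (M ^ 2 + K₁ * T ^ (2 * (k + r - 1) - 1)) +
        ENNReal.ofReal ((2 * C + 1) ^ 2 * M) + ENNReal.ofReal (M ^ 2)) +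
          2 * ENNReal.ofReal M * ENNReal.ofReal (K₂ * T ^ (k + r - 1) / C) := by gcongr
      _ = _ := by
          rw [← ENNReal.ofReal_ofNat 2, ← ENNReal.ofReal_mul (by norm_num),
            ← ENNReal.ofReal_mul (by positivity), ← ENNReal.ofReal_add (by positivity) (by positivity),
            ← ENNReal.ofReal_add (by positivity) (by positivity),
            ← ENNReal.ofReal_add (by positivity) (by positivity),
            ← ENNReal.ofReal_add (by positivity) (by positivity)]
          congr 1
          rw [hB]; ring
  refine (ENNReal.add_le_add_iff_right ENNReal.ofReal_ne_top).1 hB' |>.trans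
    (ENNReal.ofReal_le_ofReal ?_)
  have hCle : (C : ℝ) ≤ T := (le_self_pow₀ hCR (by norm_num)).trans hCT
  set P := T ^ (k + r - 1) with hP
  have hP0 : 0 < P := by positivity
  have hTP : T ≤ P := le_self_pow₀ hT (by omega)
  have e1 : T ^ (2 * (k + r - 1) - 1) * C ≤ P ^ 2 := by
    calc T ^ (2 * (k + r - 1) - 1) * C ≤ T ^ (2 * (k + r - 1) - 1) * T := by gcongr
      _ = P ^ 2 := by rw [hP, ← pow_succ, ← pow_mul]; congr 1; omega
  -- This term fixes the requirement C^3 ≤ T: proportional pairs contribute C^2 M, and one more C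
  -- comes from the denominator.
  have e2 : (2 * C + 1 : ℝ) ^ 2 * M * C ≤ 9 * K₀ * P ^ 2 := by
    calc (2 * C + 1 : ℝ) ^ 2 * M * C ≤ (2 * C + C : ℝ) ^ 2 * (K₀ * P) * C := by gcongr
      _ = 9 * K₀ * (C ^ 3 * P) := by ring
      _ ≤ 9 * K₀ * (P * P) := by gcongr; exact hCT.trans hTP
      _ = _ := by ring
  have e3 : 2 * M * (K₂ * P) ≤ 2 * K₀ * K₂ * P ^ 2 := by
    calc 2 * M * (K₂ * P) ≤ 2 * (K₀ * P) * (K₂ * P) := by gcongr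
      _ = _ := by ring
  rw [le_div_iff₀ (by linarith), hB]
  have e4 : 2 * M * (K₂ * P / C) * C = 2 * M * (K₂ * P) := by field_simp
  have e5 := mul_le_mul_of_nonneg_left e1 hK₁.le
  linarith

end

/-- The series of normalized functions has finite integral, so it converges almost everywhere and
its terms tend to 0. -/
lemma ae_tendsto_div_of_lintegral_le {Ω : Type} [MeasurableSpace Ω] {μ : Measure Ω} {g : ℕ → Ω → ℝ≥0∞}
    (hg : ∀ i, Measurable (g i)) {a P : ℕ → ℝ} (hP : ∀ i, 0 < P i) (ha : Summable a)
    (h : ∀ i, ∫⁻ x, g i x ∂μ ≤ ENNReal.ofReal (a i * P i)) :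
    ∀ᵐ x ∂μ, Tendsto (fun i => (g i x).toReal / P i) atTop (𝓝 0) := by
  have hlt : ∫⁻ x, ∑' i, g i x / ENNReal.ofReal (P i) ∂μ ≠ ∞ := by
    rw [lintegral_tsum fun i => ((hg i).div_const _).aemeasurable]
    refine ne_top_of_le_ne_top ha.tsum_ofReal_ne_top (ENNReal.tsum_le_tsum fun i => ?_)
    simp_rw [div_eq_mul_inv]
    rw [lintegral_mul_const _ (hg i), ← div_eq_mul_inv]
    refine ENNReal.div_le_of_le_mul ((h i).trans_eq ?_)
    rw [ENNReal.ofReal_mul' (hP i).le]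
  filter_upwards [ae_lt_top (Measurable.tsum fun i => (hg i).div_const _) hlt] with x hx
  have h1 := ENNReal.tendsto_atTop_zero_of_tsum_ne_top hx.ne
  have h2 := (ENNReal.tendsto_toReal ENNReal.zero_ne_top).comp h1
  refine h2.congr fun i => ?_
  simp [ENNReal.toReal_div, ENNReal.toReal_ofReal (hP i).le]

/-! ### Almost sure convergence along sequences and in full. -/

section

variable {k r : ℕ} {m : Fin k → ℕ} {n : Fin r → ℕ}
  {NM : (i : Fin k) → Seminorm ℝ (Fin (m i) → ℝ)} {NN : (j : Fin r) → Seminorm ℝ (Fin (n j) → ℝ)}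
  {η : Fin k → ℝ} {ε : ℝ}

lemma finite_solSet (hNM : ∀ i x, NM i x = 0 → x = 0) (T : ℝ) (θ : BlockIndex m → BlockIndex n → ℝ) :
    (solSet NM NN η ε T θ).Finite := by
  have hq (q : BlockIndex n → ℤ) :
      {p : BlockIndex m → ℤ | linForm (Matrix.of θ) p q ∈ region NM η (ε / qProd NN q)}.Finite := by
    set S : (i : Fin k) → Set (Fin (m i) → ℤ) := fun i => {c | NM i (toReal c) ≤
      η i + NM i (blockProj i ((Matrix.of θ).mulVec (toReal q)))} with hS
    have hfin : (Set.univ.pi S).Finite := Set.Finite.pi fun i => finite_seminorm_le (hNM i) _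
    have hinj : Function.Injective fun (p : BlockIndex m → ℤ) (i : Fin k) (a : Fin (m i)) => p ⟨i, a⟩ := by
      intro p p' h
      ext ⟨i, a⟩
      exact congrFun (congrFun h i) a
    refine (hfin.preimage hinj.injOn).subset fun p hp i _ => ?_
    have h1 := hp.1 i
    have h2 : toReal (fun a => p ⟨i, a⟩) = blockProj i (linForm (Matrix.of θ) p q) -
        blockProj i ((Matrix.of θ).mulVec (toReal q)) := by
      ext a
      simp [linForm, blockProj, toReal]
    change NM i (toReal (fun a => p ⟨i, a⟩)) ≤ _
    rw [h2]
    refine (map_sub_le_add _ _ _).trans ?_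
    gcongr
  refine ((qFinset NN T).finite_toSet.biUnion fun q _ => (hq q).image fun p => (p, q)).subset ?_
  rintro ⟨p, q⟩ ⟨h1, h2⟩
  exact Set.mem_biUnion (by exact_mod_cast h1) ⟨p, h2, rfl⟩

lemma toReal_tsum_indicator_one {V : Type} (s : Set V) :
    (∑' v, s.indicator (1 : V → ℝ≥0∞) v).toReal = s.ncard := by
  rw [← tsum_subtype]
  simp only [Pi.one_apply]
  rw [ENNReal.tsum_set_one]
  rcases s.finite_or_infinite with h | h
  · rw [← h.cast_ncard_eq]; simp
  · simp [h.encard_eq, h.ncard]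

/-- The squared deviation of the truncated count and the tail count both have normalized means O(1/C
i), which are summable. The full count is the sum of the two, and its mean satisfies the assumed
asymptotics. -/
lemma ae_tendsto_ncard_solSet_seq (hNM : ∀ i x, NM i x = 0 → x = 0) (hNN : ∀ j y, NN j y = 0 → y = 0)
    (hm : ∀ i, 0 < m i) (hn : ∀ j, 0 < n j) (hη : ∀ i, 0 < η i) (hk : 0 < k) (hr : 0 < r) (hε : 0 < ε)
    {L : ℝ} (hL : Tendsto (fun T => (∑ q ∈ qFinset NN T, regVol NM η (ε / qProd NN q)) /
      T ^ (k + r - 1)) atTop (𝓝 L))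
    {T : ℕ → ℝ} (hT : ∀ i, 1 ≤ T i) (hTlim : Tendsto T atTop atTop) {C : ℕ → ℕ} (hC : ∀ i, 1 ≤ C i)
    (hCT : ∀ i, (C i : ℝ) ^ 3 ≤ T i) (hsum : Summable fun i => (C i : ℝ)⁻¹)
    (t : BlockIndex m → BlockIndex n → ℝ) :
    ∀ᵐ θ ∂(unitCube t), Tendsto (fun i => ((solSet NM NN η ε (T i) θ).ncard : ℝ) / T i ^ (k + r - 1))
      atTop (𝓝 L) := by
  obtain ⟨K₁, hK₁, h₁⟩ := exists_lintegral_truncCount_le hNM hNN hm hn hη hk hr hε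
  obtain ⟨K₂, hK₂, h₂⟩ := exists_lintegral_bigContent_le hNM hNN hm hn hη hk hr hε
  have hP (i : ℕ) : 0 < T i ^ (k + r - 1) := by have := hT i; positivity
  have hF := ae_tendsto_div_of_lintegral_le (μ := unitCube t)
    (g := fun i θ => ENNReal.ofReal (((truncCount NM NN η ε (T i) (C i) θ).toReal -
        ∑ q ∈ qFinset NN (T i), regVol NM η (ε / qProd NN q)) ^ 2))
    (fun i => (((measurable_tsum_solSet _ _).ennreal_toReal.sub_const _).pow_const 2).ennreal_ofReal)
    (a := fun i => K₁ * (C i : ℝ)⁻¹) (P := fun i => (T i ^ (k + r - 1)) ^ 2)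
    (fun i => pow_pos (hP i) 2) (hsum.mul_left _)
    (fun i => (h₁ (T i) (hT i) (C i) (hC i) (hCT i) t).trans_eq (by congr 1; ring))
  have hR := ae_tendsto_div_of_lintegral_le (μ := unitCube t)
    (g := fun i θ => tailCount NM NN η ε (T i) (C i) θ)
    (fun i => measurable_tsum_solSet _ _)
    (a := fun i => K₂ * (C i : ℝ)⁻¹) (P := fun i => T i ^ (k + r - 1)) hP (hsum.mul_left _)
    (fun i => (h₂ (T i) (hT i) (C i) (hC i) t).trans_eq (by congr 1; ring))
  filter_upwards [hF, hR] with θ hFθ hRθ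
  have h1 : Tendsto (fun i => ((truncCount NM NN η ε (T i) (C i) θ).toReal -
        ∑ q ∈ qFinset NN (T i), regVol NM η (ε / qProd NN q)) / T i ^ (k + r - 1)) atTop (𝓝 0) := by
    rw [tendsto_zero_iff_abs_tendsto_zero]
    have h2 := (Real.continuous_sqrt.tendsto 0).comp hFθ
    rw [Real.sqrt_zero] at h2
    refine h2.congr fun i => ?_
    rw [Function.comp_apply, Function.comp_apply, ENNReal.toReal_ofReal (sq_nonneg _), ← div_pow,
      Real.sqrt_sq_eq_abs]
  have h3 := (h1.add hRθ).add (hL.comp hTlim)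
  rw [zero_add, zero_add] at h3
  refine h3.congr fun i => ?_
  have hadd := truncCount_add_tailCount (NM := NM) (NN := NN) (η := η) (ε := ε) (T i) (C i) θ
  have hfin : ∑' v, (solSet NM NN η ε (T i) θ).indicator 1 v ≠ (∞ : ℝ≥0∞) := by
    rw [← tsum_subtype]
    simp only [Pi.one_apply]
    rw [ENNReal.tsum_set_one]
    simpa using (finite_solSet hNM (T i) θ)
  have hne : truncCount NM NN η ε (T i) (C i) θ ≠ ∞ ∧ tailCount NM NN η ε (T i) (C i) θ ≠ ∞ := by
    rw [← ENNReal.add_ne_top, hadd]; exact hfin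
  rw [← toReal_tsum_indicator_one, ← hadd, ENNReal.toReal_add hne.1 hne.2]
  simp only [Function.comp_apply]
  ring

lemma ncard_solSet_mono (hNM : ∀ i x, NM i x = 0 → x = 0) (hNN : ∀ j y, NN j y = 0 → y = 0)
    (θ : BlockIndex m → BlockIndex n → ℝ) :
    Monotone fun T => ((solSet NM NN η ε T θ).ncard : ℝ) := by
  intro S T hST
  simp only [Nat.cast_le]
  exact Set.ncard_le_ncard (fun v hv => ⟨qFinset_mono hNN hST hv.1, hv.2⟩) (finite_solSet hNM T θ)

lemma exists_nat_seq {c : ℝ} (hc : 1 < c) {e : ℕ} (he : 0 < e) :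
    ∃ C : ℕ → ℕ, (∀ i, 1 ≤ C i) ∧ (∀ i, (C i : ℝ) ^ 3 ≤ (⌊c ^ i⌋₊ : ℝ) ^ (e : ℝ)⁻¹) ∧
      Summable fun i => (C i : ℝ)⁻¹ := by
  have he' : (0 : ℝ) < e := by exact_mod_cast he
  -- With T = x^(1/e) and x geometric, C is the integer part of T^(1/3) = x^β: its cube stays below
  -- T, and it still grows geometrically, so 1/C is summable.
  set β : ℝ := (3 * e : ℝ)⁻¹ with hβ
  have hβ0 : 0 < β := by positivity
  have hβe : (e : ℝ)⁻¹ = β * (3 : ℕ) := by rw [hβ]; push_cast; field_simp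
  have hfl (i : ℕ) : (1 : ℝ) ≤ ⌊c ^ i⌋₊ := by
    exact_mod_cast Nat.floor_pos.2 (one_le_pow₀ hc.le)
  have hrp (i : ℕ) : (1 : ℝ) ≤ (⌊c ^ i⌋₊ : ℝ) ^ β := Real.one_le_rpow (hfl i) hβ0.le
  refine ⟨fun i => ⌊(⌊c ^ i⌋₊ : ℝ) ^ β⌋₊, fun i => Nat.floor_pos.2 (hrp i), fun i => ?_, ?_⟩
  · rw [hβe, Real.rpow_mul (by positivity), Real.rpow_natCast]
    gcongr
    exact Nat.floor_le (by positivity)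
  · have hratio : (c ^ (-β)) < 1 := Real.rpow_lt_one_of_one_lt_of_neg hc (by linarith)
    have hgeo := (summable_geometric_of_lt_one (by positivity) hratio).mul_left (2 * 2 ^ β)
    refine Summable.of_nonneg_of_le (fun i => by positivity) (fun i => ?_) hgeo
    have hci : (0 : ℝ) < c ^ i := by positivity
    have h1 : c ^ i / 2 ≤ (⌊c ^ i⌋₊ : ℝ) := by
      have := Nat.lt_floor_add_one (c ^ i)
      have := hfl i
      linarith
    have h2 : (c ^ i / 2) ^ β / 2 ≤ (⌊(⌊c ^ i⌋₊ : ℝ) ^ β⌋₊ : ℝ) := by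
      have h3 := Nat.lt_floor_add_one ((⌊c ^ i⌋₊ : ℝ) ^ β)
      have h4 : (1 : ℝ) ≤ (⌊(⌊c ^ i⌋₊ : ℝ) ^ β⌋₊ : ℝ) := by exact_mod_cast Nat.floor_pos.2 (hrp i)
      have h5 : (c ^ i / 2) ^ β ≤ (⌊c ^ i⌋₊ : ℝ) ^ β := by gcongr
      linarith
    calc _ ≤ ((c ^ i / 2) ^ β / 2)⁻¹ := by gcongr
      _ = 2 * 2 ^ β * (c ^ (-β)) ^ i := by
        rw [Real.div_rpow hci.le (by norm_num), Real.rpow_neg (by positivity), inv_pow,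
          Real.rpow_pow_comm (by positivity)]
        field_simp

lemma ae_tendsto_ncard_solSet_unitCube (hNM : ∀ i x, NM i x = 0 → x = 0) (hNN : ∀ j y, NN j y = 0 → y = 0)
    (hm : ∀ i, 0 < m i) (hn : ∀ j, 0 < n j) (hη : ∀ i, 0 < η i) (hk : 0 < k) (hr : 0 < r) (hε : 0 < ε)
    (t : BlockIndex m → BlockIndex n → ℝ) :
    ∀ᵐ θ ∂(unitCube t), Tendsto (fun T => ((solSet NM NN η ε T θ).ncard : ℝ) / T ^ (k + r - 1))
      atTop (𝓝 (ε * (1 / (k + r - 1).factorial) * ((∏ i, ballVol (NM i)) * ∏ j, ballVol (NN j)) *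
        cConst (k + r - 1) n)) := by
  have he : 0 < k + r - 1 := by omega
  -- Countably many ratios tending to 1, so that the exceptional sets together remain null.
  set c : ℕ → ℝ := fun j => 1 + 1 / ((j : ℝ) + 1) with hcdef
  have cone (j : ℕ) : 1 < c j := by rw [hcdef]; simp only [lt_add_iff_pos_right]; positivity
  have clim : Tendsto c atTop (𝓝 1) := by
    simpa [hcdef] using tendsto_one_div_add_atTop_nhds_zero_nat.const_add (1 : ℝ)
  have hfl (j i : ℕ) : (1 : ℝ) ≤ ⌊c j ^ i⌋₊ := by
    exact_mod_cast Nat.floor_pos.2 (one_le_pow₀ (cone j).le)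
  have hae (j : ℕ) : ∀ᵐ θ ∂(unitCube t), Tendsto (fun i : ℕ =>
      ((solSet NM NN η ε ((⌊c j ^ i⌋₊ : ℝ) ^ ((k + r - 1 : ℕ) : ℝ)⁻¹) θ).ncard : ℝ) / ⌊c j ^ i⌋₊) atTop
      (𝓝 (ε * (1 / (k + r - 1).factorial) * ((∏ i, ballVol (NM i)) * ∏ j, ballVol (NN j)) *
        cConst (k + r - 1) n)) := by
    obtain ⟨C, hC1, hC2, hC3⟩ := exists_nat_seq (cone j) he
    filter_upwards [ae_tendsto_ncard_solSet_seq hNM hNN hm hn hη hk hr hε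
      (tendsto_firstMoment hNM hNN hn hη hk hr hε)
      (T := fun i => (⌊c j ^ i⌋₊ : ℝ) ^ ((k + r - 1 : ℕ) : ℝ)⁻¹)
      (fun i => Real.one_le_rpow (hfl j i) (by positivity))
      ((tendsto_rpow_atTop (by positivity)).comp (tendsto_natCast_atTop_atTop.comp
        (tendsto_nat_floor_atTop.comp (tendsto_pow_atTop_atTop_of_one_lt (cone j)))))
      hC1 hC2 hC3 t] with θ hθ
    refine hθ.congr fun i => ?_
    rw [Real.rpow_inv_natCast_pow (by positivity) he.ne']
  filter_upwards [ae_all_iff.2 hae] with θ hθ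
  exact tendsto_div_pow_of_floor_pow (ncard_solSet_mono hNM hNN θ) he cone clim hθ

end

lemma ae_of_forall_unitCube {ι κ : Type} [Fintype ι] [Fintype κ] {p : (ι → κ → ℝ) → Prop}
    (h : ∀ t : ι → κ → ℝ, ∀ᵐ θ ∂(unitCube t), p θ) : ∀ᵐ θ, p θ := by
  have hU : (⋃ t : ι → κ → ℤ, Set.pi univ fun i => Set.pi univ fun j =>
      Ioc ((t i j : ℤ) : ℝ) (t i j + 1)) = univ := by
    refine Set.eq_univ_of_forall fun θ => Set.mem_iUnion.2 ⟨fun i j => ⌈θ i j⌉ - 1, ?_⟩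
    intro i _ j _
    have h1 := Int.ceil_lt_add_one (θ i j)
    have h2 := Int.le_ceil (θ i j)
    constructor <;> push_cast <;> linarith
  rw [← Measure.restrict_univ (μ := (volume : Measure (ι → κ → ℝ))), ← hU, ae_restrict_iUnion_iff]
  intro t
  have := h fun i j => t i j
  rwa [unitCube_eq_restrict] at this

/-! ### Reduction of divisibility by s to the case s = 1. -/

section

variable {k r : ℕ} {m : Fin k → ℕ} {n : Fin r → ℕ}
  {NM : (i : Fin k) → Seminorm ℝ (Fin (m i) → ℝ)} {NN : (j : Fin r) → Seminorm ℝ (Fin (n j) → ℝ)}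
  {η : Fin k → ℝ} {ε : ℝ}

lemma blockNorm_le_iff (hr : 0 < r) (x : BlockIndex n → ℝ) (a : ℝ) :
    blockNorm NN x ≤ a ↔ ∀ j, NN j (blockProj j x) ≤ a := by
  have : Nonempty (Fin r) := ⟨⟨0, hr⟩⟩
  exact ciSup_le_iff (Set.finite_range _).bddAbove

/-- All the norms are homogeneous: dividing by s divides each η i by s, divides the weighted product
by s to the total dimension, and lowers the logarithmic height by log s. -/
lemma smul_mem_starApproxSet (hNN : ∀ j y, NN j y = 0 → y = 0) (hr : 0 < r) {s : ℕ} (hs : 0 < s) (T : ℝ)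
    (θ : BlockIndex m → BlockIndex n → ℝ) (w : (BlockIndex m → ℤ) × (BlockIndex n → ℤ)) :
    (s : ℤ) • w ∈ starApproxSet NM NN η ε T (Matrix.of θ) s ↔
      w ∈ solSet NM NN (fun i => η i / s) (ε / s ^ ((∑ i, m i) + ∑ j, n j)) (T - Real.log s) θ := by
  have hs0 : (0 : ℝ) < s := by exact_mod_cast hs
  have hlin (i : Fin k) : NM i (blockProj i (linForm (Matrix.of θ) ((s : ℤ) • w).1 ((s : ℤ) • w).2)) =
      s * NM i (blockProj i (linForm (Matrix.of θ) w.1 w.2)) := by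
    have : blockProj i (linForm (Matrix.of θ) ((s : ℤ) • w).1 ((s : ℤ) • w).2) =
        (s : ℝ) • blockProj i (linForm (Matrix.of θ) w.1 w.2) := by
      ext a
      simp only [blockProj, linForm_of_apply, Pi.smul_apply, Prod.smul_fst, Prod.smul_snd, smul_eq_mul,
        mul_add, Finset.mul_sum]
      push_cast
      congr 1
      exact Finset.sum_congr rfl fun j _ => by ring
    rw [this, map_smul_eq_mul, Real.norm_of_nonneg hs0.le]
  have hden (j : Fin r) : NN j (blockProj j (toReal ((s : ℤ) • w).2)) =
      s * NN j (blockProj j (toReal w.2)) := by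
    rw [Prod.smul_snd, seminorm_smul_block, Int.cast_natCast, abs_of_pos hs0]
  have hexp : Real.exp (T - Real.log s) = Real.exp T / s := by rw [Real.exp_sub, Real.exp_log hs0]
  have hgcd : (s : ℤ) ∣ Finset.univ.gcd (Sum.elim ((s : ℤ) • w).1 ((s : ℤ) • w).2) := by
    rw [Finset.dvd_gcd_iff]
    rintro (i | j) - <;> simp
  have hprod : (∏ i, NM i (blockProj i (linForm (Matrix.of θ) ((s : ℤ) • w).1 ((s : ℤ) • w).2)) ^ m i) *
      (∏ j, NN j (blockProj j (toReal ((s : ℤ) • w).2)) ^ n j) =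
      (s : ℝ) ^ ((∑ i, m i) + ∑ j, n j) *
        ((∏ i, NM i (blockProj i (linForm (Matrix.of θ) w.1 w.2)) ^ m i) * qProd NN w.2) := by
    simp only [hlin, hden, mul_pow, Finset.prod_mul_distrib, Finset.prod_pow_eq_pow_sum, pow_add, qProd]
    ring
  have hne : (∀ j, NN j (blockProj j (toReal ((s : ℤ) • w).2)) ≠ 0) ↔
      ∀ j, NN j (blockProj j (toReal w.2)) ≠ 0 := by
    simp only [hden, ne_eq, mul_eq_zero, hs0.ne', false_or]
  have hle : blockNorm NN (toReal ((s : ℤ) • w).2) ≤ Real.exp T ↔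
      ∀ j, NN j (blockProj j (toReal w.2)) ≤ Real.exp (T - Real.log s) := by
    simp only [blockNorm_le_iff hr, hden, hexp, le_div_iff₀ hs0, mul_comm]
  have heta (i : Fin k) : s * NM i (blockProj i (linForm (Matrix.of θ) w.1 w.2)) ≤ η i ↔
      NM i (blockProj i (linForm (Matrix.of θ) w.1 w.2)) ≤ η i / s := by
    rw [le_div_iff₀ hs0, mul_comm]
  have hmain (hq : w.2 ∈ qFinset NN (T - Real.log s)) :
      (s : ℝ) ^ ((∑ i, m i) + ∑ j, n j) *
        ((∏ i, NM i (blockProj i (linForm (Matrix.of θ) w.1 w.2)) ^ m i) * qProd NN w.2) ≤ ε ↔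
      (∏ i, NM i (blockProj i (linForm (Matrix.of θ) w.1 w.2)) ^ m i) ≤
        ε / s ^ ((∑ i, m i) + ∑ j, n j) / qProd NN w.2 := by
    rw [le_div_iff₀ (qProd_pos hNN hq), le_div_iff₀ (by positivity), mul_comm]
  constructor
  · rintro ⟨h1, h2, -⟩
    have hq : w.2 ∈ qFinset NN (T - Real.log s) :=
      (mem_qFinset hNN).2 fun j => ⟨hne.1 h1.ne_zero j, hle.1 h2 j⟩
    refine ⟨hq, fun i => (heta i).1 ?_, (hmain hq).1 ?_⟩
    · rw [← hlin]; exact h1.le_eta i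
    · rw [← hprod]; exact h1.prod_le
  · rintro ⟨hq, h1, h2⟩
    have hq' := (mem_qFinset hNN).1 hq
    refine ⟨⟨fun i => ?_, ?_, hne.2 fun j => (hq' j).1⟩, hle.2 fun j => (hq' j).2, hgcd⟩
    · rw [hlin]; exact (heta i).2 (h1 i)
    · rw [hprod]; exact (hmain hq).2 h2

lemma starApproxSet_eq_image (hNN : ∀ j y, NN j y = 0 → y = 0) (hr : 0 < r) {s : ℕ} (hs : 0 < s) (T : ℝ)
    (θ : BlockIndex m → BlockIndex n → ℝ) :
    starApproxSet NM NN η ε T (Matrix.of θ) s = (fun w => (s : ℤ) • w) ''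
      solSet NM NN (fun i => η i / s) (ε / s ^ ((∑ i, m i) + ∑ j, n j)) (T - Real.log s) θ := by
  ext v
  constructor
  · intro hv
    have hdvd := Finset.dvd_gcd_iff.1 hv.2.2
    choose p hp using fun i => hdvd (Sum.inl i) (Finset.mem_univ _)
    choose q hq using fun j => hdvd (Sum.inr j) (Finset.mem_univ _)
    have hvw : (s : ℤ) • (p, q) = v := Prod.ext (funext fun i => (hp i).symm) (funext fun j => (hq j).symm)
    exact ⟨(p, q), (smul_mem_starApproxSet hNN hr hs T θ _).1 (hvw ▸ hv), hvw⟩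
  · rintro ⟨w, hw, rfl⟩
    exact (smul_mem_starApproxSet hNN hr hs T θ w).2 hw

end

/-- The height shift log s is harmless because (T - a)^e/T^e tends to 1. -/
lemma tendsto_comp_sub_div_pow {f : ℝ → ℝ} {e : ℕ} {L : ℝ} (h : Tendsto (fun T => f T / T ^ e) atTop (𝓝 L))
    (a : ℝ) : Tendsto (fun T => 1 / T ^ e * f (T - a)) atTop (𝓝 L) := by
  have h1 : Tendsto (fun T : ℝ => T - a) atTop atTop := tendsto_atTop_add_const_right _ (-a) tendsto_id
  have h2 : Tendsto (fun T : ℝ => ((T - a) / T) ^ e) atTop (𝓝 1) := by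
    have h3 : Tendsto (fun T : ℝ => 1 - a / T) atTop (𝓝 1) := by
      simpa using (tendsto_id.const_div_atTop a).const_sub 1
    have h4 := h3.pow e
    rw [one_pow] at h4
    refine h4.congr' ?_
    filter_upwards [eventually_gt_atTop 0] with T hT
    rw [sub_div, div_self hT.ne']
  have h5 := (h.comp h1).mul h2
  rw [mul_one] at h5
  refine h5.congr' ?_
  filter_upwards [eventually_gt_atTop 0, eventually_gt_atTop a] with T hT hTa
  have : T - a ≠ 0 := (sub_pos.2 hTa).ne'
  rw [Function.comp_apply, div_pow]
  field_simp

end MultDioph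

theorem mainTheorem9 {k r : ℕ} (hk : 0 < k) (hr : 0 < r)
    (m : Fin k → ℕ) (n : Fin r → ℕ) (hm : ∀ i, 0 < m i) (hn : ∀ j, 0 < n j)
    (NM : (i : Fin k) → Seminorm ℝ (Fin (m i) → ℝ)) (hNM : ∀ i x, NM i x = 0 → x = 0)
    (NN : (j : Fin r) → Seminorm ℝ (Fin (n j) → ℝ)) (hNN : ∀ j y, NN j y = 0 → y = 0)
    (η : Fin k → ℝ) (hη : ∀ i, 0 < η i) (ε : ℝ) (hε : 0 < ε) :
    ∀ᵐ θ : MultDioph.BlockIndex m → MultDioph.BlockIndex n → ℝ, ∀ s : ℕ, 0 < s →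
      (∀ T : ℝ, (MultDioph.starApproxSet NM NN η ε T (Matrix.of θ) s).Finite) ∧
      Tendsto
        (fun T : ℝ =>
          1 / T ^ (k + r - 1) *
            ((MultDioph.starApproxSet NM NN η ε T (Matrix.of θ) s).ncard : ℝ))
        atTop
        (𝓝 (ε / (s : ℝ) ^ ((∑ i, m i) + ∑ j, n j) * (1 / ((k + r - 1).factorial : ℝ)) *
          (volume : Measure ((MultDioph.BlockIndex m → ℝ) ×
            (MultDioph.BlockIndex n → ℝ))).real (MultDioph.unitBall NM NN) *
          MultDioph.cConst (k + r - 1) n)) := by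
  rw [ae_all_iff]
  intro s
  rcases Nat.eq_zero_or_pos s with rfl | hs
  · exact .of_forall fun θ h => absurd h (lt_irrefl 0)
  have hs0 : (0 : ℝ) < s := by exact_mod_cast hs
  -- The limit for the rescaled data is independent of η, so only ε/s^d records the divisibility by
  -- s.
  filter_upwards [MultDioph.ae_of_forall_unitCube fun t =>
    MultDioph.ae_tendsto_ncard_solSet_unitCube hNM hNN hm hn (η := fun i => η i / s)
      (fun i => div_pos (hη i) hs0) hk hr
      (ε := ε / (s : ℝ) ^ ((∑ i, m i) + ∑ j, n j)) (by positivity) t] with θ hθ _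
  refine ⟨fun T => ?_, ?_⟩
  · rw [MultDioph.starApproxSet_eq_image hNN hr hs]
    exact (MultDioph.finite_solSet hNM _ θ).image _
  · rw [MultDioph.volume_unitBall hk hr]
    refine (MultDioph.tendsto_comp_sub_div_pow hθ (Real.log s)).congr fun T => ?_
    rw [MultDioph.starApproxSet_eq_image hNN hr hs, Set.ncard_image_of_injective _
      (zsmul_right_injective (by exact_mod_cast hs.ne'))]
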